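/- A planar tree $T$ is given by finite ordered sets $D_0(T), D_1(T), D_2(T),\dots$ (the vertices at height $0,1,2,\dots$), where $D_0(T)$ (the root) and $D_1(T)$ have exactly one element, together with order preserving parent maps $D_r(T)\to D_{r-1}(T)$, $r\ge 1$; trees are identified if they are isomorphic by order preserving bijections compatible with the parent maps. The edges of $T$ join each vertex other than the root to its parent, the size $|T|\in\{1,2,\dots\}\cup\{\infty\}$ is the number of edges, the height $h(T)$ is the maximal height of a vertex, and $B_r(T)$, $r\ge 1$, is the subtree spanned by the vertices of height at most $r$. The set $\mathcal T$ of all planar trees is a metric space with $\mathrm{dist}(T,T')=\inf\{\frac1r : r\in\{1,2,\dots\},\ B_r(T)=B_r(T')\}$ and carries its Borel $\sigma$-algebra. For $\mu\in\mathbb R$ and $N\ge1$ let $\nu^{(\mu)}_N$ be the probability measure on $\mathcal T$ supported on the finite set of trees of size $N$ with $\nu_N^{(\mu)}(\{T\})=e^{-\mu h(T)}/Z_N^{(\mu)}$ for $|T|=N$, where $Z_N^{(\mu)}=\sum_{|T|=N}e^{-\mu h(T)}$. **Theorem.** Let $\mu>0$. The measures $\nu_N^{(\mu)}$ converge weakly,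 as $N\to\infty$, to a Borel probability measure $\nu^{(\mu)}$ on $\mathcal T$ (the local limit), and there exist constants $C_1'',C_2''>0$ (depending only on $\mu$) such that for $\nu^{(\mu)}$-almost every $T\in\mathcal T$ there is a number $r_0(T)\in\mathbb N$ with $$C_1''\, r^3\;\le\; |B_r(T)|\;\le\; C_2''\, r^3\log r\qquad\text{for all integers } r\ge r_0(T).$$ In particular, for $\nu^{(\mu)}$-almost every $T$ the Hausdorff dimension (volume growth exponent) $d_h=\lim_{r\to\infty}\frac{\log|B_r(T)|}{\log r}$ exists and equals $3$. -/

import Mathlib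

open Filter Topology MeasureTheory
open scoped ENNReal BoundedContinuousFunction

/-- A (locally finite, rooted) planar tree. The vertices at height `r` form the finite ordered set
`D_r = Fin (width r)`, and `parent r : D_{r+1} → D_r` is the order preserving parent map. The sets
`D_0` (the root) and `D_1` are one-point sets. Since order preserving bijections between the sets
`Fin n` are identities, two such trees are isomorphic as planar trees if and only if they are
equal. -/
structure PlanarTree where
  width : ℕ → ℕ
  parent : ∀ r : ℕ, Fin (width (r + 1)) → Fin (width r)
  parent_mono : ∀ r : ℕ, Monotone (parent r)
  width_zero : width 0 = 1
  width_one : width 1 = 1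

namespace PlanarTree

/-- The vertex set `V(T)`, the disjoint union of the sets `D_r`. -/
abbrev Vertex (T : PlanarTree) : Type := Σ r : ℕ, Fin (T.width r)

/-- The edge set `E(T)`, consisting of the pairs `{i, φ_r(i)}`. -/
def edges (T : PlanarTree) : Set (Sym2 T.Vertex) :=
  {e | ∃ (r : ℕ) (i : Fin (T.width (r + 1))),
    e = s((⟨r + 1, i⟩ : T.Vertex), (⟨r, T.parent r i⟩ : T.Vertex))}

/-- The size `|T|`, i.e. the number of edges, possibly infinite. -/
noncomputable def size (T : PlanarTree) : ℕ∞ := T.edges.encard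

/-- The height `h(T)`, the maximal height of a vertex (`⊤` if there is no bound). -/
noncomputable def height (T : PlanarTree) : ℕ∞ :=
  ⨆ r : {r : ℕ // T.width r ≠ 0}, ((r : ℕ) : ℕ∞)

theorem le_of_lt_ite {P : Prop} [Decidable P] {i n : ℕ} (h : i < if P then n else 0) : P := by
  by_contra hP
  simp [hP] at h

/-- The ball `B_r(T)` around the root: the subtree spanned by the vertices of height at most `r`.
It is meant for `r ≥ 1`; for `r = 0` it is, by convention, the same as for `r = 1`. -/
def ball (r : ℕ) (T : PlanarTree) : PlanarTree where
  width s := if s ≤ max r 1 then T.width s else 0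
  parent s i :=
    ⟨T.parent s ⟨i, i.2.trans_eq (if_pos (le_of_lt_ite i.2))⟩, by
      rw [if_pos ((Nat.le_succ s).trans (le_of_lt_ite i.2))]
      exact Fin.is_lt _⟩
  parent_mono s := by
    intro i j hij
    exact T.parent_mono s (show (⟨i, _⟩ : Fin (T.width (s + 1))) ≤ ⟨j, _⟩ from hij)
  width_zero := by simp [T.width_zero]
  width_one := by simp [T.width_one]

theorem eq_of_val {T T' : PlanarTree} (hw : ∀ s, T.width s = T'.width s)
    (hp : ∀ s i (h : i < T.width (s + 1)) (h' : i < T'.width (s + 1)),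
      (T.parent s ⟨i, h⟩ : ℕ) = T'.parent s ⟨i, h'⟩) : T = T' := by
  obtain ⟨w, p, _, _, _⟩ := T
  obtain ⟨w', p', _, _, _⟩ := T'
  obtain rfl : w = w' := funext hw
  obtain rfl : p = p' := by
    funext s i
    exact Fin.ext (hp s i i.2 i.2)
  rfl

theorem val_congr {T T' : PlanarTree} (h : T = T') (s i : ℕ) (h1 : i < T.width (s + 1))
    (h2 : i < T'.width (s + 1)) : (T.parent s ⟨i, h1⟩ : ℕ) = T'.parent s ⟨i, h2⟩ := by
  subst h
  rfl

theorem ball_ball {s r : ℕ} (hsr : s ≤ r) (T : PlanarTree) : ball s (ball r T) = ball s T := by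
  refine eq_of_val (fun k => ?_) (fun k i h h' => rfl)
  by_cases hk : k ≤ max s 1
  · have : k ≤ max r 1 := hk.trans (max_le_max hsr le_rfl)
    simp only [ball, if_pos hk, if_pos this]
  · simp only [ball, if_neg hk]

theorem ball_eq_mono {s r : ℕ} (hsr : s ≤ r) {T T' : PlanarTree} (h : ball r T = ball r T') :
    ball s T = ball s T' := by
  rw [← ball_ball hsr T, ← ball_ball hsr T', h]

theorem eq_of_forall_ball {T T' : PlanarTree} (h : ∀ r, ball r T = ball r T') : T = T' := by
  have hw : ∀ s, T.width s = T'.width s := by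
    intro s
    have := congrArg (fun U => U.width s) (h s)
    simpa [ball] using this
  refine eq_of_val hw (fun s i h1 h2 => ?_)
  exact val_congr (h (s + 1)) s i (by simpa [ball] using h1) (by simpa [ball] using h2)

/-- The set of values `1 / r`, `r = 1, 2, …`, for which `T` and `T'` share the ball of radius `r`
around the root. -/
def sharedRadii (T T' : PlanarTree) : Set ℝ :=
  {x | ∃ r : ℕ, 1 ≤ r ∧ ball r T = ball r T' ∧ x = 1 / (r : ℝ)}

/-- The distance of two trees: the infimum of all `1 / r` with `B_r(T) = B_r(T')`. -/
noncomputable instance : Dist PlanarTree := ⟨fun T T' => sInf (sharedRadii T T')⟩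

theorem dist_def (T T' : PlanarTree) : dist T T' = sInf (sharedRadii T T') := rfl

theorem sharedRadii_nonempty (T T' : PlanarTree) : (sharedRadii T T').Nonempty := by
  refine ⟨1 / ((1 : ℕ) : ℝ), 1, le_rfl, ?_, rfl⟩
  refine eq_of_val (fun s => ?_) (fun s i h h' => ?_)
  · by_cases hs : s ≤ 1
    · interval_cases s <;> simp [ball, width_zero, width_one]
    · simp [ball, hs]
  · have hs : s + 1 ≤ max 1 1 := le_of_lt_ite h
    obtain rfl : s = 0 := by simpa using hs
    have h1 := ((ball 1 T).parent 0 ⟨i, h⟩).2.trans_eq (width_zero _)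
    have h2 := ((ball 1 T').parent 0 ⟨i, h'⟩).2.trans_eq (width_zero _)
    omega

theorem sharedRadii_pos {T T' : PlanarTree} {x : ℝ} (hx : x ∈ sharedRadii T T') : 0 < x := by
  obtain ⟨r, hr, -, rfl⟩ := hx
  have : (0 : ℝ) < r := by exact_mod_cast hr
  positivity

theorem sharedRadii_bddBelow (T T' : PlanarTree) : BddBelow (sharedRadii T T') :=
  ⟨0, fun _ hx => (sharedRadii_pos hx).le⟩

theorem dist_lt_iff {T T' : PlanarTree} {a : ℝ} :
    dist T T' < a ↔ ∃ r : ℕ, 1 ≤ r ∧ ball r T = ball r T' ∧ 1 / (r : ℝ) < a := by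
  rw [dist_def, csInf_lt_iff (sharedRadii_bddBelow T T') (sharedRadii_nonempty T T')]
  constructor
  · rintro ⟨_, ⟨r, hr, h, rfl⟩, ha⟩
    exact ⟨r, hr, h, ha⟩
  · rintro ⟨r, hr, h, ha⟩
    exact ⟨_, ⟨r, hr, h, rfl⟩, ha⟩

theorem planarDist_nonneg (T T' : PlanarTree) : 0 ≤ dist T T' :=
  le_csInf (sharedRadii_nonempty T T') fun _ hx => (sharedRadii_pos hx).le

theorem planarDist_le_max (T T' T'' : PlanarTree) :
    dist T T'' ≤ max (dist T T') (dist T' T'') := by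
  refine le_of_forall_gt fun a ha => ?_
  obtain ⟨h1, h2⟩ := max_lt_iff.1 ha
  obtain ⟨r, hr, hrT, hra⟩ := dist_lt_iff.1 h1
  obtain ⟨s, hs, hsT, hsa⟩ := dist_lt_iff.1 h2
  refine dist_lt_iff.2 ⟨min r s, le_min hr hs,
    (ball_eq_mono (min_le_left r s) hrT).trans (ball_eq_mono (min_le_right r s) hsT), ?_⟩
  rcases min_choice r s with h | h <;> rw [h] <;> assumption

/-- The metric space of planar trees. -/
noncomputable instance : MetricSpace PlanarTree where
  dist_self T := by
    refine le_antisymm (le_of_forall_gt fun a ha => dist_lt_iff.2 ?_) (planarDist_nonneg T T)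
    obtain ⟨n, hn⟩ := exists_nat_one_div_lt ha
    exact ⟨n + 1, by omega, rfl, by exact_mod_cast hn⟩
  dist_comm T T' := by
    have : sharedRadii T T' = sharedRadii T' T := by
      ext x
      simp only [sharedRadii, Set.mem_ofPred_eq, eq_comm]
    rw [dist_def, dist_def, this]
  dist_triangle T T' T'' := (planarDist_le_max T T' T'').trans
    (max_le_add_of_nonneg (planarDist_nonneg _ _) (planarDist_nonneg _ _))
  eq_of_dist_eq_zero := by
    intro T T' h
    refine eq_of_forall_ball fun n => ?_
    have hn : dist T T' < 1 / ((n : ℝ) + 1) := by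
      rw [h]
      positivity
    obtain ⟨r, hr, hb, hlt⟩ := dist_lt_iff.1 hn
    refine ball_eq_mono ?_ hb
    have hr0 : (0 : ℝ) < r := by exact_mod_cast hr
    have := (one_div_lt_one_div hr0 (by positivity)).1 hlt
    have h3 : (n : ℝ) < r := by linarith
    exact_mod_cast h3.le

/-- Measures on the space of trees are Borel measures. -/
noncomputable instance : MeasurableSpace PlanarTree := borel PlanarTree

instance : BorelSpace PlanarTree := ⟨rfl⟩

/-- The weight `exp (-μ h(T))` (only used for finite trees). -/
noncomputable def weight (μ : ℝ) (T : PlanarTree) : ℝ≥0∞ :=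
  ENNReal.ofReal (Real.exp (-μ * (T.height.toNat : ℝ)))

/-- The finite size partition function `Z_N`, the sum of `exp (-μ h(T))` over all trees of
size `N`. -/
noncomputable def partitionFunction (μ : ℝ) (N : ℕ) : ℝ≥0∞ :=
  ∑' T : {T : PlanarTree // T.size = (N : ℕ∞)}, weight μ T

/-- The measure `ν_N` giving mass `exp (-μ h(T)) / Z_N` to each tree `T` of size `N` and no mass to
other trees; a probability measure for `N ≥ 1`. -/
noncomputable def finiteSizeMeasure (μ : ℝ) (N : ℕ) : Measure PlanarTree :=
  Measure.sum fun T : {T : PlanarTree // T.size = (N : ℕ∞)} =>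
    (weight μ T / partitionFunction μ N) • Measure.dirac (T : PlanarTree)

/-- `ν` is the local limit `ν^{(μ)}`: a Borel probability measure that is the weak limit of the
measures `ν_N` as `N → ∞` (such a measure is unique, the space of trees being metric). -/
def IsLocalLimit (μ : ℝ) (ν : Measure PlanarTree) : Prop :=
  IsProbabilityMeasure ν ∧
    ∀ F : PlanarTree →ᵇ ℝ,
      Tendsto (fun N : ℕ => ∫ T, F T ∂(finiteSizeMeasure μ N)) atTop (𝓝 (∫ T, F T ∂ν))

/-- The volume `|B_r(T)|` of the ball of radius `r` around the root, i.e. its number of edges. -/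
noncomputable def ballVolume (r : ℕ) (T : PlanarTree) : ℕ := (ball r T).size.toNat

/-- `T` has Hausdorff dimension (volume growth exponent) `d`: the limit
`lim_{r → ∞} log |B_r(T)| / log r` exists and equals `d`. -/
def HasHausdorffDim (T : PlanarTree) (d : ℝ) : Prop :=
  Tendsto (fun r : ℕ => Real.log (ballVolume r T : ℝ) / Real.log (r : ℝ)) atTop (𝓝 d)

end PlanarTree

/-! Counting. A tree whose ball of radius r is `T` is obtained by continuing the k vertices at
height r. Writing x = exp(-μ), summation by parts turns the weight x^h into a sum over bounds m on
the number of further levels, so every cylinder has ν_N-mass given by Σ_m x^m times the number of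
continuations of k vertices by at most m levels. These numbers are coefficients of L_m^k, where
L_{m+1} = 1/(1 - X L_m). This recursion is solved by walks on a path, and the sine transform gives
the exact formula `coeff_levelSeries`.

Saddle point. After division by 4^n the leading term of the formula is α ρ^n with ρ = cos²(π/(m+2))
and α of order 4π²/m³. The factor exp(-μm) ρ^n is about exp(-(μm + π²n/m²)), so only m near θ₀
n^(1/3) matters, where μθ₀³ = 2π², and there αn is close to 2μ. For k vertices, a nonempty set of j
+ 1 of them has large progeny, while each other vertex contributes total mass close to 2. Relative
to one vertex this gives the factor 2^(k-1) h(k) with h(k) = Σ_j C(k,j+1) μ^j/j!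
(`eventually_le_tsum_coeff_pow`). Only a lower bound is proved.

Limit. The lower bound is enough because nothing is lost: h is an eigenfunction, with eigenvalue
exp(μ), of the critical geometric Galton–Watson process (`tsum_multichoose_mul_harmonicWeight`).
Hence the candidate cylinder probabilities are consistent and define a probability measure, the
h-transform of that process. Fatou's lemma for sums over cylinders then gives the open set criterion
of the portmanteau theorem (`limitMeasure_le_liminf`).

Growth. In the critical process the expected number of (j+1)-subsets of the generation at height n +
1 is n^j (`gwSum_choose`), so moments under the h-transform are Poisson moments with parameter μn.
The width at height n + 1 has mean μn² + O(n) and mean square deviation O(n³) from μn². By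
Cauchy–Schwarz the volume at radius R deviates from Σ μs² by O(R^5) in mean square, against a main
term of order R³. Chebyshev and Borel–Cantelli along R = 2^k, and monotonicity in between, give
cubic bounds on both sides. The logarithm in the stated upper bound is not needed, and the dimension
follows. -/

/-- Monotone maps `Fin b → Fin k` correspond to multisets of size `b` in `Fin k`. -/
theorem Nat.card_orderHom_fin (k b : ℕ) : Nat.card (Fin b →o Fin k) = Nat.multichoose k b := by
  rw [← Sym.card_sym_fin_eq_multichoose, ← Nat.card_eq_fintype_card]
  refine Nat.card_congr (Equiv.ofBijective
    (fun f => (⟨(List.ofFn f : Multiset (Fin k)), by simp⟩ : Sym (Fin k) b)) ⟨?_, ?_⟩)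
  · intro f g h
    have h1 : (List.ofFn f).Perm (List.ofFn g) := Multiset.coe_eq_coe.1 (congrArg Subtype.val h)
    have h2 := h1.eq_of_sortedLE f.monotone.sortedLE_ofFn g.monotone.sortedLE_ofFn
    exact OrderHom.ext _ _ (List.ofFn_injective h2)
  · rintro ⟨s, hs⟩
    have hlen : (s.sort (· ≤ ·)).length = b := by rw [Multiset.length_sort, hs]
    have hsort : (s.sort (· ≤ ·)).Pairwise (· ≤ ·) := Multiset.pairwise_sort s _
    have hof : List.ofFn (fun i : Fin b => (s.sort (· ≤ ·)).get (i.cast hlen.symm)) =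
        s.sort (· ≤ ·) := by
      subst hlen
      exact List.ofFn_get _
    refine ⟨⟨fun i => (s.sort (· ≤ ·)).get (i.cast hlen.symm), ?_⟩, ?_⟩
    · rw [← List.sortedLE_ofFn_iff, hof]
      exact hsort.sortedLE
    · refine Subtype.ext ?_
      change ((List.ofFn (fun i : Fin b => (s.sort (· ≤ ·)).get (i.cast hlen.symm)) : List _) :
        Multiset (Fin k)) = s
      rw [hof, Multiset.sort_eq]

/-! ### Widths, heights and volumes of balls -/

namespace PlanarTree

theorem width_ball (r : ℕ) (T : PlanarTree) (s : ℕ) :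
    (ball r T).width s = if s ≤ max r 1 then T.width s else 0 := rfl

theorem width_ball_of_le {r s : ℕ} (T : PlanarTree) (h : s ≤ r) :
    (ball r T).width s = T.width s := by
  rw [width_ball, if_pos (h.trans (le_max_left _ _))]

theorem width_succ_eq_zero {T : PlanarTree} {r : ℕ} (h : T.width r = 0) :
    T.width (r + 1) = 0 := by
  by_contra hne
  have := (T.parent r ⟨0, Nat.pos_of_ne_zero hne⟩).2
  omega

theorem width_eq_zero_of_le {T : PlanarTree} {r s : ℕ} (h : T.width r = 0) (hrs : r ≤ s) :
    T.width s = 0 := by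
  induction s, hrs using Nat.le_induction with
  | base => exact h
  | succ s _ ih => exact width_succ_eq_zero ih

theorem ball_eq_self_iff {r : ℕ} (hr : 1 ≤ r) {T : PlanarTree} :
    ball r T = T ↔ T.width (r + 1) = 0 := by
  constructor
  · intro h
    rw [← h, width_ball, if_neg (by omega)]
  · intro h
    refine eq_of_val (fun s => ?_) (fun s i h1 h2 => rfl)
    rw [width_ball]
    split_ifs with hs
    · rfl
    · exact (width_eq_zero_of_le h (by omega)).symm

theorem ball_eq_self_mono {r s : ℕ} (hr : 1 ≤ r) (hrs : r ≤ s) {T : PlanarTree}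
    (h : ball r T = T) : ball s T = T := by
  rw [ball_eq_self_iff hr] at h
  rw [ball_eq_self_iff (hr.trans hrs)]
  exact width_eq_zero_of_le h (by omega)

theorem height_le_iff {m : ℕ} (hm : 1 ≤ m) {T : PlanarTree} :
    T.height ≤ m ↔ ball m T = T := by
  rw [ball_eq_self_iff hm, height, iSup_le_iff]
  constructor
  · intro h
    by_contra hne
    have := h ⟨m + 1, hne⟩
    have h2 : m + 1 ≤ m := by exact_mod_cast this
    omega
  · rintro h ⟨r, hr⟩
    by_contra hlt
    have : ¬ r ≤ m := fun h' => hlt (by exact_mod_cast h')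
    exact hr (width_eq_zero_of_le h (by omega))

/-- Every vertex other than the root accounts for exactly one edge; the unordered pair determines
its upper end because the heights differ by one. -/
theorem size_eq_card (T : PlanarTree) : T.size = ENat.card (Σ s, Fin (T.width (s + 1))) := by
  let f : (Σ s, Fin (T.width (s + 1))) → Sym2 T.Vertex := fun p =>
    s((⟨p.1 + 1, p.2⟩ : T.Vertex), (⟨p.1, T.parent p.1 p.2⟩ : T.Vertex))
  have hf : Function.Injective f := by
    rintro ⟨s, i⟩ ⟨t, j⟩ h
    rcases Sym2.eq_iff.1 h with ⟨h1, -⟩ | ⟨h1, h2⟩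
    · simp only [Sigma.mk.injEq] at h1
      obtain ⟨h1, h2⟩ := h1
      obtain rfl : s = t := by omega
      simpa using h2
    · have e1 : s + 1 = t := congrArg Sigma.fst h1
      have e2 : s = t + 1 := congrArg Sigma.fst h2
      omega
  have hr : T.edges = Set.range f := by
    ext e
    constructor
    · rintro ⟨r, i, rfl⟩
      exact ⟨⟨r, i⟩, rfl⟩
    · rintro ⟨⟨r, i⟩, rfl⟩
      exact ⟨r, i, rfl⟩
  rw [size, hr, ← Set.image_univ, hf.encard_image, Set.encard_univ]

/-- The number of edges below height `r`. -/
def volume (r : ℕ) (T : PlanarTree) : ℕ := ∑ s ∈ Finset.range r, T.width (s + 1)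

theorem volume_succ (r : ℕ) (T : PlanarTree) :
    T.volume (r + 1) = T.volume r + T.width (r + 1) := Finset.sum_range_succ _ _

theorem volume_ball {r s : ℕ} (h : s ≤ r) (T : PlanarTree) : (ball r T).volume s = T.volume s :=
  Finset.sum_congr rfl fun t ht => width_ball_of_le T (by
    have := Finset.mem_range.1 ht
    omega)

theorem size_of_ball_eq_self {r : ℕ} (hr : 1 ≤ r) {T : PlanarTree} (h : ball r T = T) :
    T.size = (T.volume r : ℕ∞) := by
  rw [ball_eq_self_iff hr] at h
  let e : (Σ s : Fin r, Fin (T.width (s + 1))) → (Σ s, Fin (T.width (s + 1))) :=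
    fun p => ⟨p.1, p.2⟩
  have he : Function.Bijective e := by
    constructor
    · rintro ⟨s, i⟩ ⟨t, j⟩ hst
      simp only [e, Sigma.mk.injEq] at hst
      obtain ⟨h1, h2⟩ := hst
      obtain rfl : s = t := Fin.ext h1
      simpa using h2
    · rintro ⟨s, i⟩
      have hs : s < r := by
        by_contra hs
        have := width_eq_zero_of_le h (show r + 1 ≤ s + 1 by omega)
        have := i.2
        omega
      exact ⟨⟨⟨s, hs⟩, i⟩, rfl⟩
  rw [size_eq_card, ← ENat.card_congr (Equiv.ofBijective e he), ENat.card_eq_coe_fintype_card,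
    Fintype.card_sigma, volume]
  simp [Finset.sum_range]

theorem ballVolume_eq {r : ℕ} (hr : 1 ≤ r) (T : PlanarTree) : ballVolume r T = T.volume r := by
  rw [ballVolume, size_of_ball_eq_self hr (ball_ball le_rfl T), volume_ball le_rfl]
  rfl

theorem exists_ball_eq_self {T : PlanarTree} (h : T.size ≠ ⊤) :
    ∃ m, 1 ≤ m ∧ ball m T = T := by
  by_contra! hne
  have hw : ∀ s, T.width (s + 1) ≠ 0 := by
    intro s hs
    exact hne (s + 1) (by omega) ((ball_eq_self_iff (by omega)).2 (width_succ_eq_zero hs))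
  apply h
  rw [size_eq_card, ENat.card_eq_top]
  exact Infinite.of_injective
    (fun s : ℕ => (⟨s, ⟨0, Nat.pos_of_ne_zero (hw s)⟩⟩ : Σ s, Fin (T.width (s + 1))))
    (fun s t hst => congrArg Sigma.fst hst)

/-! ### Extension by one level, and countability of the set of balls -/

/-- The tree obtained from the ball of radius `r` by adding a level of `b` vertices at height
`r + 1`, with parents given by `f`. -/
def extend (r : ℕ) (hr : 1 ≤ r) (T : PlanarTree) (b : ℕ) (f : Fin b →o Fin (T.width r)) :
    PlanarTree where
  width s := if s ≤ r then T.width s else if s = r + 1 then b else 0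
  parent s i :=
    if h : s + 1 ≤ r then
      ⟨T.parent s ⟨i, i.2.trans_eq (if_pos h)⟩, (Fin.is_lt _).trans_eq (if_pos (by omega)).symm⟩
    else
      have hs : s + 1 = r + 1 := le_of_lt_ite (i.2.trans_eq (if_neg h))
      ⟨f ⟨i, i.2.trans_eq (by rw [if_neg h, if_pos hs])⟩, by
        obtain rfl : s = r := by omega
        exact (Fin.is_lt _).trans_eq (if_pos le_rfl).symm⟩
  parent_mono s := by
    intro i j hij
    by_cases h : s + 1 ≤ r
    · simp only [dif_pos h]
      exact T.parent_mono s (show (⟨i, _⟩ : Fin (T.width (s + 1))) ≤ ⟨j, _⟩ from hij)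
    · simp only [dif_neg h]
      exact f.monotone (show (⟨i, _⟩ : Fin b) ≤ ⟨j, _⟩ from hij)
  width_zero := by simp [T.width_zero]
  width_one := by simp [T.width_one, hr]

/-- The trees of height at most `r + 1` whose ball of radius `r` is `T`. -/
abbrev Extension (r : ℕ) (T : PlanarTree) : Type :=
  {U : PlanarTree // ball (r + 1) U = U ∧ ball r U = T}

theorem width_extend_succ (r : ℕ) (hr : 1 ≤ r) (T : PlanarTree) (b : ℕ)
    (f : Fin b →o Fin (T.width r)) : (extend r hr T b f).width (r + 1) = b := by
  simp [extend]

theorem ball_succ_extend (r : ℕ) (hr : 1 ≤ r) (T : PlanarTree) (b : ℕ)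
    (f : Fin b →o Fin (T.width r)) : ball (r + 1) (extend r hr T b f) = extend r hr T b f := by
  rw [ball_eq_self_iff (by omega)]
  simp [extend]

theorem ball_extend (r : ℕ) (hr : 1 ≤ r) (T : PlanarTree) (hT : ball r T = T) (b : ℕ)
    (f : Fin b →o Fin (T.width r)) : ball r (extend r hr T b f) = T := by
  refine eq_of_val (fun s => ?_) (fun s i h1 h2 => ?_)
  · rw [width_ball]
    split_ifs with hs
    · have : s ≤ r := by omega
      simp [extend, this]
    · exact (width_eq_zero_of_le ((ball_eq_self_iff hr).1 hT) (by omega)).symm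
  · have hs : s + 1 ≤ r := by
      have := le_of_lt_ite h1
      omega
    simp [ball, extend, hs]

theorem bijective_extend (r : ℕ) (hr : 1 ≤ r) (T : PlanarTree) (hT : ball r T = T) :
    Function.Bijective (fun p : (Σ b, Fin b →o Fin (T.width r)) =>
      (⟨extend r hr T p.1 p.2, ball_succ_extend r hr T p.1 p.2, ball_extend r hr T hT p.1 p.2⟩ :
        Extension r T)) := by
  constructor
  · rintro ⟨b, f⟩ ⟨c, g⟩ h
    have h' : extend r hr T b f = extend r hr T c g := congrArg Subtype.val h
    obtain rfl : b = c := by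
      rw [← width_extend_succ r hr T b f, ← width_extend_succ r hr T c g, h']
    congr 1
    refine OrderHom.ext _ _ (funext fun i => Fin.ext ?_)
    have := val_congr h' r i (by rw [width_extend_succ]; exact i.2)
      (by rw [width_extend_succ]; exact i.2)
    simpa [extend] using this
  · rintro ⟨U, hU, rfl⟩
    have hw : U.width r = (ball r U).width r := (width_ball_of_le U le_rfl).symm
    refine ⟨⟨U.width (r + 1), ⟨fun i => (U.parent r i).cast hw, ?_⟩⟩, ?_⟩
    · intro i j hij
      exact U.parent_mono r hij
    · refine Subtype.ext (eq_of_val (fun s => ?_) (fun s i h1 h2 => ?_))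
      · change (if s ≤ r then (ball r U).width s else if s = r + 1 then U.width (r + 1) else 0) = _
        split_ifs with h h'
        · exact width_ball_of_le U h
        · rw [h']
        · exact (width_eq_zero_of_le ((ball_eq_self_iff (by omega)).1 hU) (by omega)).symm
      · by_cases h : s + 1 ≤ r
        · simp [extend, h, ball]
        · have hs : s = r := by
            by_contra hne
            have : U.width (s + 1) = 0 :=
              width_eq_zero_of_le ((ball_eq_self_iff (by omega)).1 hU) (by omega)
            exact absurd h2 (by simp [this])
          subst hs
          simp only [extend, h, dite_false]
          rfl

instance (b k : ℕ) : Finite (Fin b →o Fin k) :=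
  Finite.of_injective (fun f => (f : Fin b → Fin k)) DFunLike.coe_injective

/-- Summing a function of the width of the last level over all extensions. -/
theorem tsum_extension {r : ℕ} (hr : 1 ≤ r) {T : PlanarTree} (hT : ball r T = T)
    (F : ℕ → ℝ≥0∞) :
    ∑' U : Extension r T, F (U.1.width (r + 1)) =
      ∑' b, (Nat.multichoose (T.width r) b : ℝ≥0∞) * F b := by
  rw [← (Equiv.ofBijective _ (bijective_extend r hr T hT)).tsum_eq, ENNReal.tsum_sigma']
  refine tsum_congr fun b => ?_
  simp only [Equiv.ofBijective_apply, width_extend_succ]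
  rw [ENNReal.tsum_const, ENat.card_eq_coe_natCard, Nat.card_orderHom_fin]
  simp

theorem countable_extension (r : ℕ) (hr : 1 ≤ r) (T : PlanarTree) (hT : ball r T = T) :
    Countable (Extension r T) :=
  (bijective_extend r hr T hT).2.countable

/-- The trees of height at most `r`. -/
abbrev Ball (r : ℕ) : Type := {T : PlanarTree // ball r T = T}

theorem eq_of_ball_one {T U : PlanarTree} (hT : ball 1 T = T) (hU : ball 1 U = U) : T = U := by
  rw [ball_eq_self_iff le_rfl] at hT hU
  refine eq_of_val (fun s => ?_) (fun s i h1 h2 => ?_)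
  · rcases s with _ | _ | s
    · rw [T.width_zero, U.width_zero]
    · rw [T.width_one, U.width_one]
    · rw [width_eq_zero_of_le hT (by omega), width_eq_zero_of_le hU (by omega)]
  · have hs : s = 0 := by
      by_contra hs
      have := width_eq_zero_of_le hT (show 1 + 1 ≤ s + 1 by omega)
      omega
    subst hs
    have h1 := (T.parent 0 ⟨i, h1⟩).2.trans_eq T.width_zero
    have h2 := (U.parent 0 ⟨i, h2⟩).2.trans_eq U.width_zero
    omega

/-- A tree of height at most `r + 1` is an extension of its ball of radius `r`. -/
def ballSuccEquiv (r : ℕ) : (Σ T : Ball r, Extension r T.1) ≃ Ball (r + 1) where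
  toFun p := ⟨p.2.1, p.2.2.1⟩
  invFun U := ⟨⟨ball r U.1, ball_ball le_rfl _⟩, ⟨U.1, U.2, rfl⟩⟩
  left_inv := by
    rintro ⟨⟨T, hT⟩, ⟨U, hU, hUT⟩⟩
    dsimp only at hUT
    subst hUT
    rfl
  right_inv _ := rfl

/-- Countability lets the measure of a union of cylinders of radius r be written as a sum over
balls. -/
theorem countable_ball (r : ℕ) : Countable (Ball r) := by
  have h1 : Countable (Ball 1) := by
    have : Subsingleton (Ball 1) := ⟨fun T U => Subtype.ext (eq_of_ball_one T.2 U.2)⟩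
    infer_instance
  rcases Nat.eq_zero_or_pos r with rfl | hr
  · exact h1
  · induction r, hr using Nat.le_induction with
    | base => exact h1
    | succ r hr ih =>
      have : ∀ T : Ball r, Countable (Extension r T.1) := fun T => countable_extension r hr T.1 T.2
      exact (ballSuccEquiv r).symm.injective.countable

instance (r : ℕ) : Countable (Ball r) := countable_ball r

/-- The tree with a single edge. -/
def edge : PlanarTree where
  width s := if s ≤ 1 then 1 else 0
  parent s i := ⟨0, by
    have := i.2
    have := le_of_lt_ite this
    rw [if_pos (by omega)]
    exact one_pos⟩
  parent_mono _ _ _ _ := le_rfl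
  width_zero := rfl
  width_one := rfl

theorem ball_one (T : PlanarTree) : ball 1 T = edge :=
  eq_of_ball_one (ball_ball le_rfl T) ((ball_eq_self_iff le_rfl).2 rfl)

/-! ### Continuations and the weight of a cylinder -/

/-- The number of ways to continue a level of `k` vertices by at most `m` further levels with `n`
vertices in total. -/
def continuations : ℕ → ℕ → ℕ → ℕ
  | 0, _, n => if n = 0 then 1 else 0
  | m + 1, k, n => ∑ b ∈ Finset.range (n + 1), Nat.multichoose k b * continuations m b (n - b)

/-- Induction on m: the trees are sorted by their ball of radius r + 1, which is an extension of
`T`. Only the width of the new level enters, so `tsum_extension` reproduces the recursion of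
`continuations`. -/
theorem tsum_indicator_continuations (m : ℕ) {r : ℕ} (hr : 1 ≤ r) {T : PlanarTree}
    (hT : ball r T = T) (n : ℕ) :
    ∑' U : PlanarTree, {U : PlanarTree | ball r U = T ∧ ball (r + m) U = U ∧
      U.volume (r + m) = n}.indicator (1 : PlanarTree → ℝ≥0∞) U =
      if T.volume r ≤ n then (continuations m (T.width r) (n - T.volume r) : ℝ≥0∞) else 0 := by
  induction m generalizing r T with
  | zero =>
    rw [tsum_eq_single T]
    · by_cases h : T.volume r = n
      · rw [Set.indicator_of_mem (by exact ⟨hT, hT, h⟩), if_pos h.le, h]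
        simp [continuations]
      · rw [Set.indicator_of_notMem (by rintro ⟨-, -, h'⟩; exact h h')]
        split_ifs with h'
        · have : n - T.volume r ≠ 0 := by omega
          simp [continuations, this]
        · rfl
    · intro U hU
      refine Set.indicator_of_notMem ?_ _
      rintro ⟨h1, h2, -⟩
      exact hU (h2.symm.trans h1)
  | succ m ih =>
    have key : ∀ U : PlanarTree, {U : PlanarTree | ball r U = T ∧ ball (r + (m + 1)) U = U ∧
        U.volume (r + (m + 1)) = n}.indicator (1 : PlanarTree → ℝ≥0∞) U =
        ∑' T' : Extension r T, {U : PlanarTree | ball (r + 1) U = T'.1 ∧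
          ball (r + 1 + m) U = U ∧ U.volume (r + 1 + m) = n}.indicator
            (1 : PlanarTree → ℝ≥0∞) U := by
      intro U
      have hrm : r + (m + 1) = r + 1 + m := by omega
      rw [hrm]
      by_cases hU : ball r U = T
      · rw [tsum_eq_single (⟨ball (r + 1) U, ball_ball le_rfl U,
          (ball_ball (Nat.le_succ r) U).trans hU⟩ : Extension r T)]
        · by_cases h : ball (r + 1 + m) U = U ∧ U.volume (r + 1 + m) = n
          · rw [Set.indicator_of_mem (by exact ⟨hU, h⟩), Set.indicator_of_mem (by exact ⟨rfl, h⟩)]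
          · rw [Set.indicator_of_notMem (by rintro ⟨-, h'⟩; exact h h'),
              Set.indicator_of_notMem (by rintro ⟨-, h'⟩; exact h h')]
        · intro T' hT'
          refine Set.indicator_of_notMem ?_ _
          rintro ⟨h1, -⟩
          exact hT' (Subtype.ext h1.symm)
      · rw [Set.indicator_of_notMem (by rintro ⟨h', -⟩; exact hU h')]
        refine (ENNReal.tsum_eq_zero.2 fun T' => Set.indicator_of_notMem ?_ _).symm
        rintro ⟨h1, -⟩
        apply hU
        rw [← T'.2.2, ← h1, ball_ball (Nat.le_succ r)]
    simp_rw [key]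
    rw [ENNReal.tsum_comm]
    set F : ℕ → ℝ≥0∞ := fun b => if T.volume r + b ≤ n then
      (continuations m b (n - (T.volume r + b)) : ℝ≥0∞) else 0 with hF
    have step : ∀ T' : Extension r T, ∑' U, {U : PlanarTree | ball (r + 1) U = T'.1 ∧
          ball (r + 1 + m) U = U ∧ U.volume (r + 1 + m) = n}.indicator
            (1 : PlanarTree → ℝ≥0∞) U = F (T'.1.width (r + 1)) := by
      intro T'
      have hv : T'.1.volume (r + 1) = T.volume r + T'.1.width (r + 1) := by
        rw [volume_succ, ← volume_ball le_rfl T'.1, T'.2.2]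
      rw [ih (by omega) T'.2.1, hv]
    rw [tsum_congr step, tsum_extension hr hT F]
    simp only [hF]
    split_ifs with h
    · rw [tsum_eq_sum (s := Finset.range (n - T.volume r + 1))]
      · simp only [continuations, Nat.cast_sum, Nat.cast_mul]
        refine Finset.sum_congr rfl fun b hb => ?_
        have := Finset.mem_range.1 hb
        rw [if_pos (by omega), Nat.sub_sub]
      · intro b hb
        have : ¬ b < n - T.volume r + 1 := fun h' => hb (Finset.mem_range.2 h')
        rw [if_neg (by omega), mul_zero]
    · refine ENNReal.tsum_eq_zero.2 fun b => ?_
      rw [if_neg (by omega), mul_zero]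

theorem le_height {T : PlanarTree} {r : ℕ} (h : T.width r ≠ 0) : (r : ℕ∞) ≤ T.height :=
  le_iSup (fun r : {r : ℕ // T.width r ≠ 0} => ((r : ℕ) : ℕ∞)) ⟨r, h⟩

theorem height_ne_top {T : PlanarTree} (h : T.size ≠ ⊤) : T.height ≠ ⊤ := by
  obtain ⟨m, hm, hb⟩ := exists_ball_eq_self h
  exact ne_top_of_le_ne_top (ENat.natCast_ne_top m) ((height_le_iff hm).2 hb)

/-- The weight per unit of height. -/
noncomputable def heightFugacity (μ : ℝ) : ℝ≥0∞ := ENNReal.ofReal (Real.exp (-μ))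

theorem heightFugacity_lt_one {μ : ℝ} (hμ : 0 < μ) : heightFugacity μ < 1 := by
  rw [heightFugacity, ENNReal.ofReal_lt_one, Real.exp_lt_one_iff]
  linarith

theorem heightFugacity_pos (μ : ℝ) : 0 < heightFugacity μ :=
  ENNReal.ofReal_pos.2 (Real.exp_pos _)

theorem heightFugacity_pow (μ : ℝ) (m : ℕ) :
    heightFugacity μ ^ m = ENNReal.ofReal (Real.exp (-μ * m)) := by
  rw [heightFugacity, ← ENNReal.ofReal_pow (Real.exp_pos _).le, ← Real.exp_nat_mul, mul_comm]

/-- A geometric tail. It replaces the exact height h by the events h ≤ r + m, which are what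
`continuations` counts. -/
theorem pow_eq_tsum_pow {x : ℝ≥0∞} (hx : x < 1) {r h : ℕ} (hrh : r ≤ h) :
    x ^ h = (1 - x) * ∑' m : ℕ, if h ≤ r + m then x ^ (r + m) else 0 := by
  have hs := Summable.sum_add_tsum_nat_add' (k := h - r)
    (f := fun m : ℕ => if h ≤ r + m then x ^ (r + m) else 0) ENNReal.summable
  rw [← hs, Finset.sum_eq_zero, zero_add]
  · have : ∀ m, (if h ≤ r + (m + (h - r)) then x ^ (r + (m + (h - r))) else 0) = x ^ h * x ^ m := by
      intro m
      rw [if_pos (by omega), ← pow_add]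
      congr 1
      omega
    simp_rw [this]
    rw [ENNReal.tsum_mul_left, ENNReal.tsum_geometric, mul_left_comm, ENNReal.mul_inv_cancel,
      mul_one]
    · exact (tsub_pos_of_lt hx).ne'
    · exact ne_top_of_le_ne_top ENNReal.one_ne_top tsub_le_self
  · intro m hm
    have := Finset.mem_range.1 hm
    rw [if_neg (by omega)]

/-- The sum of `x ^ m` times the number of continuations by `m` levels. -/
noncomputable def continuationSeries (x : ℝ≥0∞) (k n : ℕ) : ℝ≥0∞ :=
  ∑' m : ℕ, x ^ m * (continuations m k n : ℝ≥0∞)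

theorem tsum_weight_cylinder {μ : ℝ} (hμ : 0 < μ) {r : ℕ} (hr : 1 ≤ r) {T : PlanarTree}
    (hT : ball r T = T) (hw : T.width r ≠ 0) {N : ℕ} (hN : T.volume r ≤ N) :
    ∑' U : PlanarTree, {U : PlanarTree | U.size = (N : ℕ∞) ∧ ball r U = T}.indicator (weight μ) U =
      (1 - heightFugacity μ) * (heightFugacity μ ^ r *
        continuationSeries (heightFugacity μ) (T.width r) (N - T.volume r)) := by
  set x := heightFugacity μ with hx
  have key : ∀ U : PlanarTree,
      {U : PlanarTree | U.size = (N : ℕ∞) ∧ ball r U = T}.indicator (weight μ) U =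
      (1 - x) * ∑' m : ℕ, x ^ (r + m) * {U : PlanarTree | ball r U = T ∧ ball (r + m) U = U ∧
        U.volume (r + m) = N}.indicator (1 : PlanarTree → ℝ≥0∞) U := by
    intro U
    by_cases hU : U.size = (N : ℕ∞) ∧ ball r U = T
    · rw [Set.indicator_of_mem (by exact hU)]
      have hfin : U.size ≠ ⊤ := by
        rw [hU.1]
        exact ENat.natCast_ne_top N
      have hh := height_ne_top hfin
      have hwU : U.width r ≠ 0 := by
        rwa [← width_ball_of_le U le_rfl, hU.2]
      have hrh : r ≤ U.height.toNat := by
        have := ENat.toNat_le_toNat (le_height hwU) hh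
        simpa using this
      rw [weight, ← heightFugacity_pow, pow_eq_tsum_pow (heightFugacity_lt_one hμ) hrh]
      congr 1
      refine tsum_congr fun m => ?_
      -- The height bound is the condition that the ball of radius r + m is the whole tree, the form
      -- used in the count.
      have hiff : U.height.toNat ≤ r + m ↔ ball (r + m) U = U := by
        rw [← height_le_iff (by omega), ← ENat.natCast_toNat hh]
        norm_cast
      by_cases hb : ball (r + m) U = U
      · rw [if_pos (hiff.2 hb), Set.indicator_of_mem, Pi.one_apply, mul_one]
        refine ⟨hU.2, hb, ?_⟩
        have := size_of_ball_eq_self (by omega) hb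
        rw [hU.1] at this
        exact_mod_cast this.symm
      · rw [if_neg (fun h => hb (hiff.1 h)), Set.indicator_of_notMem, mul_zero]
        rintro ⟨-, h, -⟩
        exact hb h
    · rw [Set.indicator_of_notMem (by exact hU), ENNReal.tsum_eq_zero.2, mul_zero]
      intro m
      rw [Set.indicator_of_notMem, mul_zero]
      rintro ⟨h1, h2, h3⟩
      refine hU ⟨?_, h1⟩
      rw [size_of_ball_eq_self (by omega) h2, h3]
  rw [tsum_congr key, ENNReal.tsum_mul_left, ENNReal.tsum_comm, continuationSeries,
    ← ENNReal.tsum_mul_left (a := x ^ r)]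
  congr 1
  refine tsum_congr fun m => ?_
  rw [ENNReal.tsum_mul_left, tsum_indicator_continuations m hr hT N, if_pos hN, pow_add, mul_assoc]

theorem volume_edge : edge.volume 1 = 1 := by simp [volume, edge]

theorem partitionFunction_eq {μ : ℝ} (hμ : 0 < μ) {N : ℕ} (hN : 1 ≤ N) :
    partitionFunction μ N = (1 - heightFugacity μ) * (heightFugacity μ *
        continuationSeries (heightFugacity μ) 1 (N - 1)) := by
  have h := tsum_weight_cylinder hμ le_rfl (T := edge) (ball_one _) (by simp [edge])
    (N := N) (by rw [volume_edge]; exact hN)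
  rw [volume_edge, pow_one, show edge.width 1 = 1 from rfl] at h
  rw [← h, partitionFunction]
  simp only [ball_one, and_true]
  exact tsum_subtype {T : PlanarTree | T.size = (N : ℕ∞)} (weight μ)

theorem isOpen_cylinder (r : ℕ) (T : PlanarTree) : IsOpen {U : PlanarTree | ball r U = T} := by
  rw [Metric.isOpen_iff]
  intro U hU
  refine ⟨1 / ((r : ℝ) + 1), by positivity, fun V hV => ?_⟩
  obtain ⟨s, hs, hb, hlt⟩ := dist_lt_iff.1 (Metric.mem_ball.1 hV)
  have hs0 : (0 : ℝ) < s := by exact_mod_cast hs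
  have := (one_div_lt_one_div hs0 (by positivity)).1 hlt
  have h3 : (r : ℝ) < s := by linarith
  have h4 : r ≤ s := by exact_mod_cast h3.le
  exact (ball_eq_mono h4 hb).trans hU

theorem measurableSet_cylinder (r : ℕ) (T : PlanarTree) :
    MeasurableSet {U : PlanarTree | ball r U = T} := (isOpen_cylinder r T).measurableSet

theorem finiteSizeMeasure_apply (μ : ℝ) (N : ℕ) {s : Set PlanarTree} (hs : MeasurableSet s) :
    finiteSizeMeasure μ N s = (∑' U : PlanarTree,
      {U : PlanarTree | U.size = (N : ℕ∞) ∧ U ∈ s}.indicator (weight μ) U) /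
        partitionFunction μ N := by
  rw [finiteSizeMeasure, Measure.sum_apply _ hs, div_eq_mul_inv, ← ENNReal.tsum_mul_right]
  simp only [Measure.smul_apply, Measure.dirac_apply' _ hs, smul_eq_mul]
  refine (tsum_subtype {T : PlanarTree | T.size = (N : ℕ∞)}
    (fun T => weight μ T / partitionFunction μ N * s.indicator 1 T)).trans
    (tsum_congr fun U => ?_)
  by_cases h1 : U.size = (N : ℕ∞) <;> by_cases h2 : U ∈ s <;>
    simp [Set.indicator, h1, h2, div_eq_mul_inv]

theorem finiteSizeMeasure_cylinder {μ : ℝ} (hμ : 0 < μ) {r : ℕ} (hr : 1 ≤ r) {T : PlanarTree}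
    (hT : ball r T = T) (hw : T.width r ≠ 0) {N : ℕ} (hN1 : 1 ≤ N) (hN : T.volume r ≤ N) :
    finiteSizeMeasure μ N {U | ball r U = T} =
      heightFugacity μ ^ (r - 1) *
        (continuationSeries (heightFugacity μ) (T.width r) (N - T.volume r) /
        continuationSeries (heightFugacity μ) 1 (N - 1)) := by
  rw [finiteSizeMeasure_apply μ N (measurableSet_cylinder r T), partitionFunction_eq hμ hN1]
  have h := tsum_weight_cylinder hμ hr hT hw hN
  simp only [Set.mem_ofPred_eq]
  rw [h]
  have hx1 : 1 - heightFugacity μ ≠ 0 := (tsub_pos_of_lt (heightFugacity_lt_one hμ)).ne'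
  have hx2 : 1 - heightFugacity μ ≠ ⊤ := ne_top_of_le_ne_top ENNReal.one_ne_top tsub_le_self
  have hx3 := (heightFugacity_pos μ).ne'
  have hx4 := (heightFugacity_lt_one hμ).ne_top
  rw [ENNReal.mul_div_mul_left _ _ hx1 hx2]
  obtain ⟨r, rfl⟩ : ∃ k, r = k + 1 := ⟨r - 1, by omega⟩
  rw [pow_succ', mul_assoc, ENNReal.mul_div_mul_left _ _ hx3 hx4, Nat.add_sub_cancel,
    mul_div_assoc]

/-! ### Generating functions of continuations and their spectral formula -/

open PowerSeries in
/-- The generating function of the continuations of a single vertex by at most `m` levels. -/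
noncomputable def levelSeries : ℕ → PowerSeries ℝ
  | 0 => 1
  | m + 1 => (1 - X * levelSeries m)⁻¹

open PowerSeries in
theorem levelSeries_succ_mul (m : ℕ) :
    levelSeries (m + 1) * (1 - X * levelSeries m) = 1 :=
  PowerSeries.inv_mul_cancel _ (by simp)

/-- Truncation of the binomial series for `(1 - Y)⁻ᵏ`. -/
theorem exists_one_sub_pow_mul_sum_multichoose {R : Type*} [CommRing R] (Y : R) (B k : ℕ) :
    ∃ Z : R, (1 - Y) ^ k * ∑ b ∈ Finset.range (B + 1), (Nat.multichoose k b : R) * Y ^ b =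
      1 + Y ^ (B + 1) * Z := by
  induction k with
  | zero =>
    refine ⟨0, ?_⟩
    rw [Finset.sum_range_succ', Finset.sum_eq_zero] <;> simp
  | succ k ih =>
    obtain ⟨Z, hZ⟩ := ih
    -- Multiplication by 1 - Y lowers k by Pascal's rule; the truncation leaves one boundary term,
    -- of degree B + 1, absorbed into Z.
    have key : (1 - Y) * ∑ b ∈ Finset.range (B + 1), (Nat.multichoose (k + 1) b : R) * Y ^ b =
        ∑ b ∈ Finset.range (B + 1), (Nat.multichoose k b : R) * Y ^ b -
          (Nat.multichoose (k + 1) B : R) * Y ^ (B + 1) := by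
      clear hZ
      induction B with
      | zero => simp
      | succ B ih =>
        rw [Finset.sum_range_succ, mul_add, ih, Finset.sum_range_succ _ (B + 1),
          Nat.multichoose_succ_succ]
        push_cast
        ring
    refine ⟨Z - (1 - Y) ^ k * (Nat.multichoose (k + 1) B : R), ?_⟩
    rw [pow_succ, mul_assoc, key, mul_sub, hZ]
    ring

-- The k-th power of 1/(1 - X L_m) is a negative binomial series in X L_m. Truncating it at b = n
-- leaves an error divisible by X^(n+1), invisible in degree n, so no infinite sum of power series
-- is needed.
open PowerSeries in
theorem coeff_levelSeries_pow_succ (m k n : ℕ) :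
    coeff n (levelSeries (m + 1) ^ k) =
      ∑ b ∈ Finset.range (n + 1), (Nat.multichoose k b : ℝ) * coeff (n - b) (levelSeries m ^ b) := by
  obtain ⟨Z, hZ⟩ := exists_one_sub_pow_mul_sum_multichoose (X * levelSeries m) n k
  have h1 : ∑ b ∈ Finset.range (n + 1), (Nat.multichoose k b : ℝ⟦X⟧) * (X * levelSeries m) ^ b =
      levelSeries (m + 1) ^ k + X ^ (n + 1) * (levelSeries m ^ (n + 1) * Z *
        levelSeries (m + 1) ^ k) := by
    have h2 : levelSeries (m + 1) ^ k * (1 - X * levelSeries m) ^ k = 1 := by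
      rw [← mul_pow, levelSeries_succ_mul, one_pow]
    linear_combination levelSeries (m + 1) ^ k * hZ -
      (∑ b ∈ Finset.range (n + 1), (Nat.multichoose k b : ℝ⟦X⟧) * (X * levelSeries m) ^ b) * h2
  have h2 := congrArg (coeff n) h1
  rw [map_add, coeff_X_pow_mul', if_neg (by omega), add_zero] at h2
  rw [← h2, map_sum]
  refine Finset.sum_congr rfl fun b hb => ?_
  have := Finset.mem_range.1 hb
  rw [mul_pow, show (Nat.multichoose k b : ℝ⟦X⟧) = C (Nat.multichoose k b : ℝ) by simp,
    coeff_C_mul, coeff_X_pow_mul', if_pos (by omega)]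

open PowerSeries in
theorem continuations_eq_coeff (m k n : ℕ) :
    (continuations m k n : ℝ) = coeff n (levelSeries m ^ k) := by
  induction m generalizing k n with
  | zero => simp [continuations, levelSeries, coeff_one]
  | succ m ih =>
    rw [coeff_levelSeries_pow_succ, continuations]
    push_cast
    simp_rw [ih]

/-- Sine sums counting walks on a path with `M` vertices. -/
noncomputable def sineSum (M n j : ℕ) : ℝ :=
  2 / (M + 1) * ∑ k ∈ Finset.range (M + 1), Real.sin (k * (Real.pi / (M + 1))) *
    Real.sin (j * (k * (Real.pi / (M + 1)))) * (2 * Real.cos (k * (Real.pi / (M + 1)))) ^ n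

theorem sineSum_zero (M n : ℕ) : sineSum M n 0 = 0 := by simp [sineSum]

theorem sineSum_end (M n : ℕ) : sineSum M n (M + 1) = 0 := by
  rw [sineSum, Finset.sum_eq_zero, mul_zero]
  intro k _
  have : ((M + 1 : ℕ) : ℝ) * (k * (Real.pi / (M + 1))) = k * Real.pi := by
    push_cast
    field_simp
  rw [this, Real.sin_nat_mul_pi, mul_zero, zero_mul]

/-- The step of the walk to a neighbour, from sin(a - x) + sin(a + x) = 2 cos x sin a. With
`sineSum_zero` and `sineSum_end` as absorbing boundaries and `sineSum_zero_left` as start at vertex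
1, the sums count walks with n steps from 1 to j. -/
theorem sineSum_succ (M n j : ℕ) :
    sineSum M (n + 1) (j + 1) = sineSum M n j + sineSum M n (j + 2) := by
  rw [sineSum, sineSum, sineSum, ← mul_add, ← Finset.sum_add_distrib]
  congr 1
  refine Finset.sum_congr rfl fun k _ => ?_
  set x : ℝ := k * (Real.pi / (M + 1))
  have h1 : ((j + 1 : ℕ) : ℝ) * x = j * x + x := by push_cast; ring
  have h2 : ((j + 2 : ℕ) : ℝ) * x = (j * x + x) + x := by push_cast; ring
  have h3 : Real.sin ((j : ℝ) * x) = Real.sin ((j * x + x) - x) := by congr 1; ring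
  rw [h1, h2, h3, Real.sin_sub, Real.sin_add (j * x + x) x]
  ring

theorem two_sin_mul_sum_cos (x : ℝ) (n : ℕ) :
    2 * Real.sin (x / 2) * ∑ k ∈ Finset.range n, Real.cos (k * x) =
      Real.sin ((n - 1 / 2) * x) + Real.sin (x / 2) := by
  induction n with
  | zero =>
    have : ((0 : ℕ) - 1 / 2 : ℝ) * x = -(x / 2) := by push_cast; ring
    rw [this]
    simp
  | succ n ih =>
    rw [Finset.sum_range_succ, mul_add, ih]
    have h1 : ((n + 1 : ℕ) - 1 / 2 : ℝ) * x = n * x + x / 2 := by push_cast; ring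
    have h2 : ((n : ℝ) - 1 / 2) * x = n * x - x / 2 := by ring
    rw [h1, h2, Real.sin_add, Real.sin_sub]
    ring

theorem sum_cos_pi_div {M l : ℕ} (h0 : 0 < l) (h1 : l < 2 * (M + 1)) :
    ∑ k ∈ Finset.range (M + 1), Real.cos (k * (l * (Real.pi / (M + 1)))) =
      (1 - (-1) ^ l) / 2 := by
  have hM : (0 : ℝ) < M + 1 := by positivity
  set x : ℝ := l * (Real.pi / (M + 1)) with hx
  have h := two_sin_mul_sum_cos x (M + 1)
  have hl : (0 : ℝ) < l := by exact_mod_cast h0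
  have hl2 : (l : ℝ) < 2 * (M + 1) := by exact_mod_cast h1
  have hs : 0 < Real.sin (x / 2) := by
    apply Real.sin_pos_of_pos_of_lt_pi
    · have := Real.pi_pos
      positivity
    · rw [hx, ← mul_div_assoc, div_div, div_lt_iff₀ (by positivity)]
      nlinarith [Real.pi_pos]
  have h2 : (((M + 1 : ℕ) : ℝ) - 1 / 2) * x = l * Real.pi - x / 2 := by
    rw [hx]
    push_cast
    field_simp
  rw [h2, Real.sin_sub, Real.sin_nat_mul_pi, Real.cos_nat_mul_pi] at h
  have h3 : Real.sin (x / 2) * (2 * ∑ k ∈ Finset.range (M + 1), Real.cos (k * x)) =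
      Real.sin (x / 2) * (1 - (-1) ^ l) := by linear_combination h
  have := mul_left_cancel₀ hs.ne' h3
  linarith

/-- Discrete orthogonality of sines: the product of sines is a difference of cosines at frequencies
j and j + 2, of equal parity, whose sums agree unless j = 0. -/
theorem sineSum_zero_left {M j : ℕ} (hj : j + 1 ≤ M) :
    sineSum M 0 (j + 1) = if j = 0 then 1 else 0 := by
  have hM : (0 : ℝ) < M + 1 := by positivity
  have key : ∀ k : ℕ, Real.sin (k * (Real.pi / (M + 1))) *
      Real.sin ((j + 1 : ℕ) * (k * (Real.pi / (M + 1)))) *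
        (2 * Real.cos (k * (Real.pi / (M + 1)))) ^ 0 =
      (Real.cos (k * (j * (Real.pi / (M + 1)))) -
        Real.cos (k * ((j + 2 : ℕ) * (Real.pi / (M + 1))))) / 2 := by
    intro k
    have h1 : (k : ℝ) * (j * (Real.pi / (M + 1))) =
      ((j + 1 : ℕ) : ℝ) * (k * (Real.pi / (M + 1))) - k * (Real.pi / (M + 1)) := by
        push_cast; ring
    have h2 : (k : ℝ) * ((j + 2 : ℕ) * (Real.pi / (M + 1))) =
      ((j + 1 : ℕ) : ℝ) * (k * (Real.pi / (M + 1))) + k * (Real.pi / (M + 1)) := by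
        push_cast; ring
    rw [h1, h2, Real.cos_sub, Real.cos_add]
    ring
  rw [sineSum, Finset.sum_congr rfl fun k _ => key k, ← Finset.sum_div, Finset.sum_sub_distrib,
    sum_cos_pi_div (l := j + 2) (by omega) (by omega)]
  rcases Nat.eq_zero_or_pos j with rfl | hj0
  · have := hM.ne'
    simp
    field_simp
    exact this
  · rw [sum_cos_pi_div (M := M) hj0 (by omega), if_neg hj0.ne', pow_add]
    simp

/-- A walk cannot travel farther than its number of steps. This makes the constant terms in
`walkSeries_succ` match. -/
theorem sineSum_eq_zero {M n j : ℕ} (h1 : n + 1 < j) (h2 : j ≤ M + 1) : sineSum M n j = 0 := by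
  induction n generalizing j with
  | zero =>
    rcases Nat.eq_or_lt_of_le h2 with rfl | h2
    · exact sineSum_end M 0
    · obtain ⟨j, rfl⟩ : ∃ i, j = i + 1 := ⟨j - 1, by omega⟩
      rw [sineSum_zero_left (by omega), if_neg (by omega)]
  | succ n ih =>
    rcases Nat.eq_or_lt_of_le h2 with rfl | h2
    · exact sineSum_end M _
    · obtain ⟨j, rfl⟩ : ∃ i, j = i + 1 := ⟨j - 1, by omega⟩
      rw [sineSum_succ, ih (by omega) (by omega), ih (by omega) (by omega), add_zero]

open PowerSeries in
/-- The generating function of the walks that end at height `j`. -/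
noncomputable def walkSeries (M : ℕ) : ℕ → PowerSeries ℝ
  | 0 => 1
  | j + 1 => PowerSeries.mk fun n => sineSum M (2 * n + j) (j + 1)

open PowerSeries in
theorem walkSeries_end (M : ℕ) : walkSeries M (M + 1) = 0 := by
  ext n
  simp [walkSeries, sineSum_end]

open PowerSeries in
theorem walkSeries_succ {M j : ℕ} (hj : j + 1 ≤ M) :
    walkSeries M (j + 1) = walkSeries M j + X * walkSeries M (j + 2) := by
  ext n
  rw [map_add]
  rcases n with _ | n
  · rw [coeff_zero_X_mul, add_zero]
    rcases j with _ | j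
    · simp [walkSeries, sineSum_zero_left hj]
    · simp only [walkSeries, coeff_mk, mul_zero, zero_add]
      rw [sineSum_succ, sineSum_eq_zero (j := j + 1 + 2) (by omega) (by omega), add_zero]
  · rw [coeff_succ_X_mul]
    rcases j with _ | j
    · simp only [walkSeries, coeff_mk, coeff_one, if_neg (Nat.succ_ne_zero n), zero_add, add_zero]
      rw [show 2 * (n + 1) = (2 * n + 1) + 1 by ring, sineSum_succ, sineSum_zero, zero_add]
    · simp only [walkSeries, coeff_mk]
      rw [show 2 * (n + 1) + (j + 1) = (2 * n + j + 2) + 1 by ring, sineSum_succ]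
      congr 2; ring

/-- The quotients of consecutive walk series satisfy the continued fraction recursion of
`levelSeries`. The induction runs down from the far end of the path, where `walkSeries_end` supplies
the start `levelSeries 0`. -/
theorem walkSeries_eq_mul {M i : ℕ} (hi : i + 1 ≤ M) :
    walkSeries M (M - i) = levelSeries i * walkSeries M (M - i - 1) := by
  induction i with
  | zero =>
    obtain ⟨M, rfl⟩ : ∃ k, M = k + 1 := ⟨M - 1, by omega⟩
    have := walkSeries_succ (M := M + 1) (j := M) le_rfl
    rw [walkSeries_end, mul_zero, add_zero] at this
    simpa [levelSeries] using this
  | succ i ih =>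
    obtain ⟨j, hj⟩ : ∃ j, M = i + j + 2 := ⟨M - i - 2, by omega⟩
    have ih := ih (by omega)
    have h := walkSeries_succ (M := M) (j := j) (by omega)
    rw [show M - i = j + 2 by omega, show j + 2 - 1 = j + 1 by omega] at ih
    rw [show M - (i + 1) = j + 1 by omega, show j + 1 - 1 = j by omega]
    rw [ih] at h
    linear_combination levelSeries (i + 1) * h - walkSeries M (j + 1) * levelSeries_succ_mul i

open PowerSeries in
theorem coeff_levelSeries (m n : ℕ) :
    coeff n (levelSeries m) = 2 / (m + 2) * ∑ k ∈ Finset.range (m + 2),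
      Real.sin (k * (Real.pi / (m + 2))) ^ 2 *
        (4 * Real.cos (k * (Real.pi / (m + 2))) ^ 2) ^ n := by
  have h := walkSeries_eq_mul (M := m + 1) (i := m) le_rfl
  rw [show m + 1 - m = 1 by omega, show 1 - 1 = 0 by rfl] at h
  simp only [walkSeries, mul_one] at h
  rw [← h, coeff_mk, sineSum]
  push_cast
  rw [show (m : ℝ) + 1 + 1 = m + 2 by ring, show m + 1 + 1 = m + 2 by rfl]
  congr 1
  refine Finset.sum_congr rfl fun k _ => ?_
  rw [add_zero, pow_mul, mul_pow, one_mul, show (2 : ℝ) ^ 2 = 4 by norm_num]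
  ring

end PlanarTree

/-! ### Coefficientwise bounds for powers of power series -/

theorem PowerSeries.coeff_mul_le_coeff_mul {f g f' g' : PowerSeries ℝ} (hf : ∀ n, 0 ≤ coeff n f)
    (hff : ∀ n, coeff n f ≤ coeff n f') (hg : ∀ n, 0 ≤ coeff n g)
    (hgg : ∀ n, coeff n g ≤ coeff n g') (n : ℕ) : coeff n (f * g) ≤ coeff n (f' * g') := by
  rw [coeff_mul, coeff_mul]
  exact Finset.sum_le_sum fun p _ =>
    mul_le_mul (hff _) (hgg _) (hg _) ((hf _).trans (hff _))

theorem PowerSeries.coeff_mul_nonneg {f g : PowerSeries ℝ} (hf : ∀ n, 0 ≤ coeff n f)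
    (hg : ∀ n, 0 ≤ coeff n g) (n : ℕ) : 0 ≤ coeff n (f * g) := by
  rw [coeff_mul]
  exact Finset.sum_nonneg fun p _ => mul_nonneg (hf _) (hg _)

theorem PowerSeries.coeff_pow_nonneg {f : PowerSeries ℝ} (hf : ∀ n, 0 ≤ coeff n f) (k n : ℕ) :
    0 ≤ coeff n (f ^ k) := by
  induction k generalizing n with
  | zero =>
    rw [pow_zero, coeff_one]
    split_ifs <;> norm_num
  | succ k ih =>
    rw [pow_succ]
    exact coeff_mul_nonneg ih hf n

theorem PowerSeries.coeff_pow_le_coeff_pow {f g : PowerSeries ℝ} (hf : ∀ n, 0 ≤ coeff n f)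
    (hfg : ∀ n, coeff n f ≤ coeff n g) (k n : ℕ) : coeff n (f ^ k) ≤ coeff n (g ^ k) := by
  induction k generalizing n with
  | zero => simp
  | succ k ih =>
    rw [pow_succ, pow_succ]
    exact coeff_mul_le_coeff_mul (coeff_pow_nonneg hf k) ih hf hfg n

open PowerSeries in
/-- Coefficients of the powers of a geometric series starting at degree `L`. -/
theorem PowerSeries.coeff_geometric_pow (a x : ℝ) (L j n : ℕ) (hn : L * (j + 1) ≤ n) :
    coeff n ((C (a * x ^ L) * X ^ L * rescale x (mk 1) : ℝ⟦X⟧) ^ (j + 1)) =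
      a ^ (j + 1) * x ^ n * (j + (n - L * (j + 1))).choose j := by
  obtain ⟨d, rfl⟩ : ∃ d, n = d + L * (j + 1) := ⟨n - L * (j + 1), by omega⟩
  rw [mul_pow, mul_pow, ← map_pow, ← map_pow, ← pow_mul, mul_assoc, coeff_C_mul,
    coeff_X_pow_mul, mk_one_pow_eq_mk_choose_add, coeff_rescale, coeff_mk, Nat.add_sub_cancel,
    mul_pow, ← pow_mul, pow_add]
  ring

theorem Nat.pow_div_factorial_le_choose_add (j d : ℕ) :
    (d : ℝ) ^ j / j.factorial ≤ ((j + d).choose j : ℝ) := by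
  have h := Nat.pow_le_choose (α := ℝ) j (j + d)
  have h2 : j + d + 1 - j = d + 1 := by omega
  rw [h2] at h
  refine le_trans ?_ h
  gcongr
  omega

open PowerSeries in
/-- Lower bound for mixed products of a polynomial and a geometric series. -/
theorem PowerSeries.le_coeff_pow_mul_geometric_pow {P : ℝ⟦X⟧} {L : ℕ} {β : ℝ}
    (hP : ∀ n, 0 ≤ coeff n P) (hβ : β = ∑ l ∈ Finset.range L, coeff l P)
    {a x : ℝ} (ha : 0 ≤ a) (hx : 0 ≤ x) (hx1 : x ≤ 1) (i j n : ℕ) (hn : L * (i + (j + 1)) ≤ n) :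
    β ^ i * (a ^ (j + 1) * x ^ n * ((n - L * (i + (j + 1)) : ℕ) : ℝ) ^ j / j.factorial) ≤
      coeff n (P ^ i * (C (a * x ^ L) * X ^ L * rescale x (mk 1) : ℝ⟦X⟧) ^ (j + 1)) := by
  have hβ0 : 0 ≤ β := hβ ▸ Finset.sum_nonneg fun l _ => hP l
  have hQ : ∀ n, 0 ≤ coeff n (C (a * x ^ L) * X ^ L * rescale x (mk 1) : ℝ⟦X⟧) := by
    intro n
    rw [mul_assoc, coeff_C_mul, coeff_X_pow_mul']
    split_ifs
    · rw [coeff_rescale, coeff_mk]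
      simp only [Pi.one_apply, mul_one]
      positivity
    · simp
  induction i generalizing n with
  | zero =>
    rw [pow_zero, pow_zero, one_mul, one_mul, coeff_geometric_pow _ _ _ _ _ (by simpa using hn),
      zero_add, mul_div_assoc]
    gcongr
    exact Nat.pow_div_factorial_le_choose_add _ _
  | succ i ih =>
    set Q : ℝ⟦X⟧ := C (a * x ^ L) * X ^ L * rescale x (mk 1) with hQdef
    -- One factor `P` is split off and only its degrees l < L are kept. Their coefficients sum to β,
    -- and each costs at most L of the degree left for the other factors.
    rw [pow_succ' P, mul_assoc P, coeff_mul, Finset.Nat.sum_antidiagonal_eq_sum_range_succ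
      (fun k l => coeff k P * coeff l (P ^ i * Q ^ (j + 1)))]
    have hL : L ≤ n := by nlinarith
    have hsub : Finset.range L ⊆ Finset.range (n + 1) :=
      Finset.range_subset_range.2 (by omega)
    refine le_trans ?_ (Finset.sum_le_sum_of_subset_of_nonneg hsub fun l _ _ =>
      mul_nonneg (hP l) (coeff_mul_nonneg (coeff_pow_nonneg hP i) (coeff_pow_nonneg hQ _) _))
    rw [pow_succ', mul_assoc, hβ, Finset.sum_mul]
    refine Finset.sum_le_sum fun l hl => mul_le_mul_of_nonneg_left ?_ (hP l)
    rw [← hβ]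
    have hl := Finset.mem_range.1 hl
    have e1 : L * (i + 1 + (j + 1)) = L * (i + (j + 1)) + L := by ring
    refine le_trans ?_ (ih (n - l) (by omega))
    have h1 : n - L * (i + 1 + (j + 1)) ≤ n - l - L * (i + (j + 1)) := by omega
    have h2 : x ^ n ≤ x ^ (n - l) := pow_le_pow_of_le_one hx hx1 (by omega)
    gcongr

/-! ### Normalized series and isolation of the leading eigenvalue -/

namespace PlanarTree

theorem continuations_le_succ (m k n : ℕ) : continuations m k n ≤ continuations (m + 1) k n := by
  induction m generalizing k n with
  | zero =>
    by_cases h : n = 0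
    · subst h
      simp [continuations]
    · simp [continuations, h]
  | succ m ih =>
    rw [continuations, continuations]
    exact Finset.sum_le_sum fun b _ => Nat.mul_le_mul_left _ (ih _ _)

theorem continuations_mono (k n : ℕ) : Monotone fun m => continuations m k n :=
  monotone_nat_of_le_succ fun m => continuations_le_succ m k n

open PowerSeries in
/-- The generating function of continuations, normalized to radius of convergence `1` in the limit
of infinitely many levels. -/
noncomputable def normSeries (m : ℕ) : PowerSeries ℝ := rescale (1 / 4 : ℝ) (levelSeries m)

open PowerSeries in
theorem coeff_normSeries_pow (m k n : ℕ) :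
    coeff n (normSeries m ^ k) = (1 / 4) ^ n * (continuations m k n : ℝ) := by
  rw [normSeries, ← map_pow, coeff_rescale, continuations_eq_coeff]

open PowerSeries in
theorem coeff_normSeries_nonneg (m n : ℕ) : 0 ≤ coeff n (normSeries m) := by
  have := coeff_normSeries_pow m 1 n
  rw [pow_one] at this
  rw [this]
  positivity

open PowerSeries in
theorem coeff_normSeries_mono (n : ℕ) : Monotone fun m => coeff n (normSeries m) := by
  intro m m' h
  have h1 := coeff_normSeries_pow m 1 n
  have h2 := coeff_normSeries_pow m' 1 n
  rw [pow_one] at h1 h2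
  have h3 : (continuations m 1 n : ℝ) ≤ continuations m' 1 n := by
    exact_mod_cast continuations_mono 1 n h
  simp only [h1, h2]
  gcongr

open PowerSeries in
theorem coeff_normSeries (m n : ℕ) :
    coeff n (normSeries m) = 2 / (m + 2) * ∑ k ∈ Finset.range (m + 2),
      Real.sin (k * (Real.pi / (m + 2))) ^ 2 * (Real.cos (k * (Real.pi / (m + 2))) ^ 2) ^ n := by
  rw [normSeries, coeff_rescale, coeff_levelSeries, mul_left_comm, Finset.mul_sum]
  congr 1
  refine Finset.sum_congr rfl fun k _ => ?_
  rw [mul_left_comm, ← mul_pow]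
  congr 2
  ring

/-- The weight of the leading eigenvalue. -/
noncomputable def leadingWeight (m : ℕ) : ℝ := 4 * Real.sin (Real.pi / (m + 2)) ^ 2 / (m + 2)

/-- The leading eigenvalue. -/
noncomputable def leadingRatio (m : ℕ) : ℝ := Real.cos (Real.pi / (m + 2)) ^ 2

theorem leadingWeight_nonneg (m : ℕ) : 0 ≤ leadingWeight m := by
  unfold leadingWeight
  positivity

theorem leadingRatio_nonneg (m : ℕ) : 0 ≤ leadingRatio m := sq_nonneg _

theorem leadingRatio_le_one (m : ℕ) : leadingRatio m ≤ 1 := Real.cos_sq_le_one _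

/-- The contribution of the non-leading eigenvalues. -/
noncomputable def remainder (m n : ℕ) : ℝ :=
  2 / (m + 2) * ∑ k ∈ Finset.Ico 2 (m + 1),
      Real.sin (k * (Real.pi / (m + 2))) ^ 2 * (Real.cos (k * (Real.pi / (m + 2))) ^ 2) ^ n

theorem remainder_nonneg (m n : ℕ) : 0 ≤ remainder m n := by
  unfold remainder
  positivity

open PowerSeries in
theorem coeff_normSeries_eq {m : ℕ} (hm : 1 ≤ m) (n : ℕ) :
    coeff n (normSeries m) = leadingWeight m * leadingRatio m ^ n + remainder m n := by
  -- The index 0 contributes nothing, and 1 and m + 1 give equal terms by reflection at π/2. They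
  -- are distinct because m ≥ 1, which explains the factor 4 in `leadingWeight`.
  have hr : Finset.range (m + 2) = insert 0 (insert 1 (insert (m + 1) (Finset.Ico 2 (m + 1)))) := by
    ext k
    simp only [Finset.mem_range, Finset.mem_insert, Finset.mem_Ico]
    omega
  have h0 : (0 : ℝ) < m + 2 := by positivity
  have e : ((m + 1 : ℕ) : ℝ) * (Real.pi / (m + 2)) = Real.pi - Real.pi / (m + 2) := by
    push_cast
    field_simp
    ring
  rw [coeff_normSeries, hr, Finset.sum_insert, Finset.sum_insert, Finset.sum_insert, e,
    Real.sin_pi_sub, Real.cos_pi_sub, leadingWeight, leadingRatio, remainder]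
  · simp only [CharP.cast_eq_zero, zero_mul, Real.sin_zero, Nat.cast_one, one_mul, neg_sq]
    ring
  · simp
  · simp only [Finset.mem_insert, Finset.mem_Ico]
    omega
  · simp only [Finset.mem_insert, Finset.mem_Ico]
    omega

-- Each k ≠ 0 contributes sin² · 1/(1 - cos²) = 1. The limit 2 as m grows is the total mass of a
-- vertex with bounded progeny, the source of the powers of 2 in `gwWeight`.
open PowerSeries in
theorem hasSum_coeff_normSeries (m : ℕ) :
    HasSum (fun n => coeff n (normSeries m)) (2 * (m + 1) / (m + 2)) := by
  simp_rw [coeff_normSeries]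
  have h0 : (0 : ℝ) < m + 2 := by positivity
  have key : ∀ k ∈ Finset.range (m + 2), HasSum (fun n : ℕ =>
      Real.sin (k * (Real.pi / (m + 2))) ^ 2 * (Real.cos (k * (Real.pi / (m + 2))) ^ 2) ^ n)
      (if k = 0 then 0 else 1) := by
    intro k hk
    have hk := Finset.mem_range.1 hk
    split_ifs with h
    · subst h
      simp
    · have hk0 : (0 : ℝ) < k := by exact_mod_cast Nat.pos_of_ne_zero h
      have hk2 : (k : ℝ) < m + 2 := by exact_mod_cast hk
      have hs : 0 < Real.sin (k * (Real.pi / (m + 2))) := by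
        apply Real.sin_pos_of_pos_of_lt_pi
        · have := Real.pi_pos
          positivity
        · rw [← mul_div_assoc, div_lt_iff₀ h0]
          nlinarith [Real.pi_pos]
      have hsc := Real.sin_sq_add_cos_sq (k * (Real.pi / (m + 2)))
      have h1 : Real.cos (k * (Real.pi / (m + 2))) ^ 2 < 1 := by nlinarith
      have h2 := (hasSum_geometric_of_lt_one (sq_nonneg _) h1).mul_left
        (Real.sin (k * (Real.pi / (m + 2))) ^ 2)
      convert! h2 using 1
      rw [show 1 - Real.cos (k * (Real.pi / (m + 2))) ^ 2 =
        Real.sin (k * (Real.pi / (m + 2))) ^ 2 by linarith, mul_inv_cancel₀]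
      positivity
  have := (hasSum_sum key).mul_left (2 / ((m : ℝ) + 2))
  convert! this using 1
  rw [Finset.sum_range_succ']
  simp
  ring

open PowerSeries in
/-- Lower bound for the number of continuations of a level of `K` vertices: any nonempty set of
the vertices may have large progeny. -/
theorem le_coeff_normSeries_pow {m₀ L : ℕ} {β : ℝ}
    (hβ : β = ∑ l ∈ Finset.range L, coeff l (normSeries m₀)) {m : ℕ} (hm : 1 ≤ m) (hm0 : m₀ ≤ m)
    (K n : ℕ) (hn : L * K ≤ n) :
    leadingWeight m * leadingRatio m ^ n * ∑ j ∈ Finset.range K, (K.choose (j + 1) : ℝ) *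
      β ^ (K - (j + 1)) * (leadingWeight m * ((n - L * K : ℕ) : ℝ)) ^ j / j.factorial ≤
      coeff n (normSeries m ^ K) := by
  -- `P` is the part of bounded progeny, taken from the fixed level `m₀` so that β does not depend
  -- on m. `Q` is the leading geometric term from degree L on. Their supports are disjoint and their
  -- sum lies below `normSeries m`.
  set P : ℝ⟦X⟧ := PowerSeries.mk fun l => if l < L then coeff l (normSeries m₀) else 0 with hPdef
  set Q : ℝ⟦X⟧ := C (leadingWeight m * leadingRatio m ^ L) * X ^ L *
    rescale (leadingRatio m) (PowerSeries.mk 1) with hQdef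
  have hα := leadingWeight_nonneg m
  have hρ := leadingRatio_nonneg m
  have hρ1 := leadingRatio_le_one m
  have hP : ∀ l, 0 ≤ coeff l P := by
    intro l
    rw [hPdef, coeff_mk]
    split_ifs
    · exact coeff_normSeries_nonneg _ _
    · exact le_rfl
  have hQc : ∀ l, coeff l Q = if L ≤ l then leadingWeight m * leadingRatio m ^ l else 0 := by
    intro l
    rw [hQdef, mul_assoc, coeff_C_mul, coeff_X_pow_mul']
    split_ifs with h
    · rw [coeff_rescale, coeff_mk, Pi.one_apply, mul_one, mul_assoc, ← pow_add]
      congr 2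
      omega
    · simp
  have hQ : ∀ l, 0 ≤ coeff l Q := by
    intro l
    rw [hQc]
    split_ifs <;> positivity
  have hβ' : β = ∑ l ∈ Finset.range L, coeff l P := by
    rw [hβ]
    refine Finset.sum_congr rfl fun l hl => ?_
    rw [hPdef, coeff_mk, if_pos (Finset.mem_range.1 hl)]
  have hβ0 : 0 ≤ β := hβ' ▸ Finset.sum_nonneg fun l _ => hP l
  have hle : ∀ l, coeff l (Q + P) ≤ coeff l (normSeries m) := by
    intro l
    rw [map_add, hQc, hPdef, coeff_mk]
    by_cases h : l < L
    · rw [if_neg (by omega), if_pos h, zero_add]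
      exact coeff_normSeries_mono l hm0
    · rw [if_pos (by omega), if_neg h, add_zero, coeff_normSeries_eq hm]
      linarith [remainder_nonneg m l]
  refine le_trans ?_ (coeff_pow_le_coeff_pow (fun l => ?_) hle K n)
  swap
  · rw [map_add]
    exact add_nonneg (hQ l) (hP l)
  -- In the binomial expansion the term without a factor `Q` is split off and discarded as
  -- nonnegative.
  rw [add_pow, map_sum, Finset.sum_range_succ', Finset.mul_sum]
  refine le_add_of_le_of_nonneg (Finset.sum_le_sum fun j hj => ?_) ?_
  · have hj := Finset.mem_range.1 hj
    have h := le_coeff_pow_mul_geometric_pow hP hβ' hα hρ hρ1 (K - (j + 1)) j n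
      (by rwa [Nat.sub_add_cancel (by omega)])
    rw [Nat.sub_add_cancel (by omega), ← hQdef] at h
    rw [mul_comm (Q ^ (j + 1)), show (K.choose (j + 1) : ℝ⟦X⟧) = C (K.choose (j + 1) : ℝ) by simp,
      coeff_mul_C]
    refine le_trans (le_of_eq ?_) (mul_le_mul_of_nonneg_right h (Nat.cast_nonneg _))
    ring
  · rw [show (K.choose 0 : ℝ⟦X⟧) = C (K.choose 0 : ℝ) by simp, coeff_mul_C]
    exact mul_nonneg (coeff_mul_nonneg (coeff_pow_nonneg hQ _) (coeff_pow_nonneg hP _) _)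
      (Nat.cast_nonneg _)

end PlanarTree

/-! ### Elementary bounds for the eigenvalues and the leading weight -/

/-- The product exp(y²/2) cos y equals 1 at 0 and decreases, since its derivative has the sign of y
cos y - sin y and y < tan y. -/
theorem Real.cos_le_exp_neg_sq_div_two {y : ℝ} (h0 : 0 ≤ y) (h1 : y ≤ Real.pi / 2) :
    Real.cos y ≤ Real.exp (-(y ^ 2 / 2)) := by
  have hd : ∀ x : ℝ, HasDerivAt (fun x => Real.exp (x ^ 2 / 2) * Real.cos x)
      (Real.exp (x ^ 2 / 2) * (x * Real.cos x - Real.sin x)) x := by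
    intro x
    have h : HasDerivAt (fun x : ℝ => Real.exp (x ^ 2 / 2))
        (Real.exp (x ^ 2 / 2) * ((2 : ℕ) * x ^ (2 - 1) / 2)) x :=
      ((hasDerivAt_pow 2 x).div_const 2).exp
    convert! h.mul (Real.hasDerivAt_cos x) using 1
    norm_num
    ring
  have hanti : AntitoneOn (fun x => Real.exp (x ^ 2 / 2) * Real.cos x)
      (Set.Icc 0 (Real.pi / 2)) := by
    refine antitoneOn_of_deriv_nonpos (convex_Icc _ _) (fun x _ =>
      (hd x).continuousAt.continuousWithinAt) (fun x _ =>
      (hd x).differentiableAt.differentiableWithinAt) (fun x hx => ?_)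
    rw [interior_Icc] at hx
    rw [(hd x).deriv]
    have hc : 0 < Real.cos x := Real.cos_pos_of_mem_Ioo ⟨by linarith [hx.1, Real.pi_pos], hx.2⟩
    have ht := Real.lt_tan hx.1 hx.2
    rw [Real.tan_eq_sin_div_cos, lt_div_iff₀ hc] at ht
    exact mul_nonpos_of_nonneg_of_nonpos (Real.exp_pos _).le (by linarith)
  have h := hanti (Set.left_mem_Icc.2 (h0.trans h1)) ⟨h0, h1⟩ h0
  simp only [ne_eq, OfNat.ofNat_ne_zero, not_false_eq_true, zero_pow, zero_div, Real.exp_zero,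
    Real.cos_zero, mul_one] at h
  rw [Real.exp_neg, ← one_div, le_div_iff₀ (Real.exp_pos _), mul_comm]
  exact h

theorem Real.cos_sq_le_exp_neg_sq {d y : ℝ} (hd : 0 ≤ d) (h0 : d ≤ y) (h1 : y ≤ Real.pi - d) :
    Real.cos y ^ 2 ≤ Real.exp (-d ^ 2) := by
  wlog hy : y ≤ Real.pi / 2 generalizing y
  · have := this (y := Real.pi - y) (by linarith) (by linarith) (by linarith)
    rwa [Real.cos_pi_sub, neg_sq] at this
  have hc : 0 ≤ Real.cos y := Real.cos_nonneg_of_mem_Icc ⟨by linarith, hy⟩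
  calc Real.cos y ^ 2 ≤ Real.exp (-(y ^ 2 / 2)) ^ 2 := by
        gcongr
        exact Real.cos_le_exp_neg_sq_div_two (by linarith) hy
    _ = Real.exp (-y ^ 2) := by
        rw [← Real.exp_nat_mul]
        congr 1
        push_cast
        ring
    _ ≤ _ := by
        gcongr

theorem Real.exp_neg_le_cos_sq {u : ℝ} (hu : u ^ 2 ≤ 1 / 2) :
    Real.exp (-(u ^ 2 + 2 * u ^ 4)) ≤ Real.cos u ^ 2 := by
  have h1 : Real.sin u ^ 2 ≤ u ^ 2 := sq_le_sq.2 (Real.abs_sin_le_abs)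
  have h2 := Real.sin_sq_add_cos_sq u
  have h3 : (1 : ℝ) + (u ^ 2 + 2 * u ^ 4) ≤ Real.exp (u ^ 2 + 2 * u ^ 4) := by
    linarith [Real.add_one_le_exp (u ^ 2 + 2 * u ^ 4)]
  have h4 : 0 ≤ u ^ 2 := sq_nonneg u
  rw [Real.exp_neg, inv_le_iff_one_le_mul₀ (Real.exp_pos _)]
  -- With v = u² the product is 1 + v² (1 - 2v), and v ≤ 1/2.
  calc (1 : ℝ) ≤ (1 - u ^ 2) * (1 + (u ^ 2 + 2 * u ^ 4)) := by
        nlinarith [mul_nonneg (mul_nonneg h4 h4) (sub_nonneg.2 hu)]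
    _ ≤ Real.cos u ^ 2 * Real.exp (u ^ 2 + 2 * u ^ 4) := by
        apply mul_le_mul (by linarith) h3 (by positivity) (by positivity)

namespace PlanarTree

theorem leadingRatio_pow_le (m n : ℕ) :
    leadingRatio m ^ n ≤ Real.exp (-(Real.pi ^ 2 * n / ((m : ℝ) + 2) ^ 2)) := by
  have h0 : (0 : ℝ) < m + 2 := by positivity
  have hpi := Real.pi_pos
  have h1 : Real.pi / (m + 2) ≤ Real.pi / 2 := by
    gcongr
    linarith
  have := Real.cos_sq_le_exp_neg_sq (d := Real.pi / (m + 2)) (y := Real.pi / (m + 2))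
    (by positivity) le_rfl (by linarith)
  calc leadingRatio m ^ n ≤ Real.exp (-(Real.pi / (m + 2)) ^ 2) ^ n := by
        unfold leadingRatio
        gcongr
    _ = _ := by
        rw [← Real.exp_nat_mul]
        congr 1
        field_simp

/-- The remaining angles are at distance at least 2π/(m+2) from 0 and π, so the decay exponent is
four times the leading one. This makes these terms negligible at every m. -/
theorem remainder_le (m n : ℕ) :
    remainder m n ≤ 2 * Real.exp (-(4 * Real.pi ^ 2 * n / ((m : ℝ) + 2) ^ 2)) := by
  have h0 : (0 : ℝ) < m + 2 := by positivity
  have hpi := Real.pi_pos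
  have key : ∀ k ∈ Finset.Ico 2 (m + 1), Real.sin (k * (Real.pi / (m + 2))) ^ 2 *
      (Real.cos (k * (Real.pi / (m + 2))) ^ 2) ^ n ≤
      Real.exp (-(4 * Real.pi ^ 2 * n / ((m : ℝ) + 2) ^ 2)) := by
    intro k hk
    obtain ⟨h2, h3⟩ := Finset.mem_Ico.1 hk
    have h2' : (2 : ℝ) ≤ k := by exact_mod_cast h2
    have h3' : (k : ℝ) ≤ m := by exact_mod_cast (show k ≤ m by omega)
    have hc : Real.cos (k * (Real.pi / (m + 2))) ^ 2 ≤
        Real.exp (-(2 * (Real.pi / (m + 2))) ^ 2) := by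
      apply Real.cos_sq_le_exp_neg_sq (by positivity)
      · gcongr
      · have : Real.pi = (m + 2) * (Real.pi / (m + 2)) := by field_simp
        have h4 : 0 < Real.pi / ((m : ℝ) + 2) := by positivity
        nlinarith
    calc _ ≤ 1 * Real.exp (-(2 * (Real.pi / (m + 2))) ^ 2) ^ n := by
          gcongr
          exact Real.sin_sq_le_one _
      _ = _ := by
          rw [one_mul, ← Real.exp_nat_mul]
          congr 1
          field_simp
          ring
  have hs := Finset.sum_le_card_nsmul _ _ _ key
  rw [Nat.card_Ico, nsmul_eq_mul] at hs
  unfold remainder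
  set E := Real.exp (-(4 * Real.pi ^ 2 * n / ((m : ℝ) + 2) ^ 2))
  have hE : 0 < E := Real.exp_pos _
  have hcard : ((m + 1 - 2 : ℕ) : ℝ) ≤ m + 2 := by
    exact_mod_cast (show m + 1 - 2 ≤ m + 2 by omega)
  calc _ ≤ 2 / ((m : ℝ) + 2) * ((m + 2) * E) := by
        gcongr
        exact hs.trans (by gcongr)
    _ = 2 * E := by field_simp

theorem leadingWeight_le (m : ℕ) : leadingWeight m ≤ 2 := by
  unfold leadingWeight
  rw [div_le_iff₀ (by positivity)]
  have := Real.sin_sq_le_one (Real.pi / (m + 2))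
  have : (0 : ℝ) ≤ m := Nat.cast_nonneg m
  linarith

theorem le_leadingWeight (m : ℕ) : 16 / ((m : ℝ) + 2) ^ 3 ≤ leadingWeight m := by
  have h0 : (0 : ℝ) < m + 2 := by positivity
  have hpi := Real.pi_pos
  have h1 : Real.pi / (m + 2) ≤ Real.pi / 2 := by
    gcongr
    linarith [(Nat.cast_nonneg m : (0 : ℝ) ≤ m)]
  have h2 := Real.mul_le_sin (x := Real.pi / (m + 2)) (by positivity) h1
  have h3 : 2 / Real.pi * (Real.pi / (m + 2)) = 2 / (m + 2) := by field_simp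
  rw [h3] at h2
  unfold leadingWeight
  calc (16 : ℝ) / ((m : ℝ) + 2) ^ 3 = 4 * (2 / (m + 2)) ^ 2 / (m + 2) := by
        field_simp
        ring
    _ ≤ _ := by gcongr

/-! ### The saddle point in the number of levels -/

/-- The exponent `μ θ + π² / θ²` has a strict minimum at `θ₀ = (2 π² / μ)^(1/3)`. -/
theorem exists_exponent_gap {μ θ₀ δ : ℝ} (hμ : 0 < μ) (hθ₀ : 0 < θ₀)
    (h : μ * θ₀ ^ 3 = 2 * Real.pi ^ 2) (hδ : 0 < δ) :
    ∃ η, 0 < η ∧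
      (∀ θ, 0 < θ → δ ≤ |θ - θ₀| → 3 / 2 * μ * θ₀ + η ≤ μ * θ + Real.pi ^ 2 / θ ^ 2) ∧
      (∀ θ, 0 < θ → 3 / 2 * μ * θ₀ + η ≤ μ * θ + 4 * Real.pi ^ 2 / θ ^ 2) := by
  have hpi : Real.pi ^ 2 = μ * θ₀ ^ 3 / 2 := by linarith
  have key : ∀ θ, 0 < θ → μ * θ + Real.pi ^ 2 / θ ^ 2 - 3 / 2 * μ * θ₀ =
      μ * (θ - θ₀) ^ 2 * (2 * θ + θ₀) / (2 * θ ^ 2) := by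
    intro θ hθ
    rw [hpi]
    field_simp
    ring
  have hfar : ∀ θ, 2 * θ₀ < θ → μ * θ₀ / 2 ≤ μ * θ + Real.pi ^ 2 / θ ^ 2 - 3 / 2 * μ * θ₀ := by
    intro θ hθ
    have : 0 ≤ Real.pi ^ 2 / θ ^ 2 := by positivity
    nlinarith
  -- For θ ≤ 2θ₀ the exact excess in `key` is at least μδ²/(8θ₀), and the additional 3π²/θ² present
  -- with 4π² is at least 3μθ₀/8. For θ > 2θ₀ the excess is at least μθ₀/2 in both cases.
  refine ⟨min (μ * δ ^ 2 / (8 * θ₀)) (3 * μ * θ₀ / 8), by positivity, fun θ hθ hd => ?_,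
    fun θ hθ => ?_⟩
  · rcases le_or_gt θ (2 * θ₀) with hle | hgt
    · have h1 : μ * δ ^ 2 / (8 * θ₀) ≤ μ * (θ - θ₀) ^ 2 * (2 * θ + θ₀) / (2 * θ ^ 2) := by
        have hd2 : δ ^ 2 ≤ (θ - θ₀) ^ 2 := by
          rw [← sq_abs (θ - θ₀)]
          gcongr
        have h3 : 1 / (8 * θ₀) ≤ (2 * θ + θ₀) / (2 * θ ^ 2) := by
          rw [div_le_div_iff₀ (by positivity) (by positivity)]
          nlinarith
        calc μ * δ ^ 2 / (8 * θ₀) = μ * δ ^ 2 * (1 / (8 * θ₀)) := by ring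
          _ ≤ μ * (θ - θ₀) ^ 2 * ((2 * θ + θ₀) / (2 * θ ^ 2)) := by gcongr
          _ = _ := by ring
      have := key θ hθ
      linarith [min_le_left (μ * δ ^ 2 / (8 * θ₀)) (3 * μ * θ₀ / 8)]
    · have := hfar θ hgt
      have := min_le_right (μ * δ ^ 2 / (8 * θ₀)) (3 * μ * θ₀ / 8)
      have : 0 < μ * θ₀ := by positivity
      linarith
  · have hm := min_le_right (μ * δ ^ 2 / (8 * θ₀)) (3 * μ * θ₀ / 8)
    have hpos : 0 < μ * θ₀ := by positivity
    have e : 4 * Real.pi ^ 2 / θ ^ 2 = Real.pi ^ 2 / θ ^ 2 + 3 * (Real.pi ^ 2 / θ ^ 2) := by ring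
    rcases le_or_gt θ (2 * θ₀) with hle | hgt
    · have h1 : μ * θ₀ / 8 ≤ Real.pi ^ 2 / θ ^ 2 := by
        rw [hpi, div_le_div_iff₀ (by positivity) (by positivity)]
        have : θ ^ 2 ≤ (2 * θ₀) ^ 2 := by gcongr
        nlinarith
      have h2 : 0 ≤ μ * (θ - θ₀) ^ 2 * (2 * θ + θ₀) / (2 * θ ^ 2) := by positivity
      have := key θ hθ
      linarith
    · have := hfar θ hgt
      have : 0 ≤ Real.pi ^ 2 / θ ^ 2 := by positivity
      linarith

/-- The numbers of levels that dominate at size `t ^ 3`. -/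
noncomputable def window (θ₀ δ t : ℝ) : Finset ℕ :=
  (Finset.range (⌊(θ₀ + δ) * t⌋₊ + 1)).filter fun m => |((m : ℝ) + 2) - θ₀ * t| ≤ δ * t

theorem mem_window {θ₀ δ t : ℝ} {m : ℕ} :
    m ∈ window θ₀ δ t ↔ |((m : ℝ) + 2) - θ₀ * t| ≤ δ * t := by
  rw [window, Finset.mem_filter, Finset.mem_range, and_iff_right_iff_imp]
  intro h
  have := (abs_le.1 h).2
  rw [Nat.lt_succ_iff]
  apply Nat.le_floor
  nlinarith

-- Outside the window, and for the non-leading terms everywhere, the exponent exceeds its minimum by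
-- a fixed multiple of t = n^(1/3). A geometric factor in m is kept so that these errors can be
-- summed over all m.
open PowerSeries in
theorem exp_mul_coeff_le {μ θ₀ δ : ℝ} (hμ : 0 < μ) (hθ₀ : 0 < θ₀)
    (h : μ * θ₀ ^ 3 = 2 * Real.pi ^ 2) (hδ : 0 < δ) :
    ∃ η τ, 0 < η ∧ 0 < τ ∧ ∀ (n : ℕ) (t : ℝ), 1 ≤ n → 0 < t → t ^ 3 = n → ∀ m : ℕ,
      Real.exp (-μ * m) * coeff n (normSeries m) ≤
        (if m ∈ window θ₀ δ t then Real.exp (-μ * m) * (leadingWeight m * leadingRatio m ^ n)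
          else 0) +
        4 * Real.exp (2 * μ) * Real.exp (-((3 / 2 * μ * θ₀ + η) * t)) * Real.exp (-τ) ^ m := by
  obtain ⟨η, hη, hfar, hrem⟩ := exists_exponent_gap hμ hθ₀ h hδ
  set φ := 3 / 2 * μ * θ₀ with hφ
  have hφ0 : 0 < φ := by positivity
  -- This fraction of the exponent is given up to produce the geometric factor. It is chosen so that
  -- (1 - τ)(φ + η) = φ + η/2, which still leaves an excess η/2.
  set τ := η / 2 / (φ + η) with hτ
  have hτ0 : 0 < τ := by positivity
  have hτ1 : τ ≤ 1 := by
    rw [hτ, div_le_one (by positivity)]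
    linarith
  have hτe : (1 - τ) * (φ + η) = φ + η / 2 := by
    rw [hτ]
    field_simp
    ring
  refine ⟨η / 2, τ * μ, by positivity, by positivity, fun n t hn ht htn m => ?_⟩
  rcases Nat.eq_zero_or_pos m with rfl | hm
  · have : coeff n (normSeries 0) = 0 := by
      have := coeff_normSeries_pow 0 1 n
      rw [pow_one] at this
      rw [this]
      simp [continuations, show n ≠ 0 by omega]
    rw [this, mul_zero]
    have := leadingWeight_nonneg 0
    have := leadingRatio_nonneg 0
    split_ifs <;> positivity
  have hM : (0 : ℝ) < m + 2 := by positivity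
  set M : ℝ := m + 2 with hMdef
  have hθ : 0 < M / t := by positivity
  have hexp : ∀ c : ℝ, 0 ≤ c → φ + η ≤ μ * (M / t) + c / (M / t) ^ 2 →
      Real.exp (-μ * m) * Real.exp (-(c * n / M ^ 2)) ≤
        Real.exp (2 * μ) * Real.exp (-((φ + η / 2) * t)) * Real.exp (-(τ * μ)) ^ m := by
    intro c hc hle
    have e1 : (μ * (M / t) + c / (M / t) ^ 2) * t = μ * M + c * n / M ^ 2 := by
      rw [← htn]
      field_simp
    have h1 : (φ + η) * t ≤ μ * M + c * n / M ^ 2 := by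
      rw [← e1]
      gcongr
    have h2 : 0 ≤ c * n / M ^ 2 := by positivity
    rw [← Real.exp_nat_mul, ← Real.exp_add, ← Real.exp_add, ← Real.exp_add, Real.exp_le_exp]
    have h3 : (φ + η / 2) * t = (1 - τ) * ((φ + η) * t) := by rw [← hτe]; ring
    rw [h3]
    have h4 : (1 - τ) * ((φ + η) * t) ≤ (1 - τ) * (μ * M + c * n / M ^ 2) :=
      mul_le_mul_of_nonneg_left h1 (by linarith)
    have h5 : 0 ≤ τ * (c * n / M ^ 2) := by positivity
    have h6 : 0 ≤ τ * μ := by positivity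
    have h7 : μ * (m : ℝ) = μ * M - 2 * μ := by rw [hMdef]; ring
    have h8 : τ * μ * (m : ℝ) = τ * (μ * M) - 2 * (τ * μ) := by rw [hMdef]; ring
    nlinarith
  have hx := Real.exp_pos (-μ * (m : ℝ))
  set E := Real.exp (2 * μ) * Real.exp (-((φ + η / 2) * t)) * Real.exp (-(τ * μ)) ^ m with hE
  have hr : Real.exp (-μ * m) * remainder m n ≤ 2 * E := by
    calc _ ≤ Real.exp (-μ * m) * (2 * Real.exp (-(4 * Real.pi ^ 2 * n / M ^ 2))) := by
          gcongr
          exact remainder_le m n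
      _ = 2 * (Real.exp (-μ * m) * Real.exp (-(4 * Real.pi ^ 2 * n / M ^ 2))) := by ring
      _ ≤ _ := by
          gcongr
          exact hexp _ (by positivity) (hrem _ hθ)
  have hgoal : 4 * Real.exp (2 * μ) * Real.exp (-((φ + η / 2) * t)) * Real.exp (-(τ * μ)) ^ m =
      4 * E := by rw [hE]; ring
  have hEpos : 0 < E := by positivity
  rw [coeff_normSeries_eq hm, mul_add, hgoal]
  split_ifs with hw
  · linarith
  · rw [mem_window, not_le] at hw
    have hd : δ ≤ |M / t - θ₀| := by
      have : M / t - θ₀ = (M - θ₀ * t) / t := by field_simp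
      rw [this, abs_div, abs_of_pos ht, le_div_iff₀ ht]
      exact hw.le
    have hl : Real.exp (-μ * m) * (leadingWeight m * leadingRatio m ^ n) ≤ 2 * E := by
      calc _ ≤ Real.exp (-μ * m) * (2 * Real.exp (-(Real.pi ^ 2 * n / M ^ 2))) := by
            have h1 := leadingWeight_le m
            have h2 := leadingRatio_pow_le m n
            have h3 := pow_nonneg (leadingRatio_nonneg m) n
            gcongr
        _ = 2 * (Real.exp (-μ * m) * Real.exp (-(Real.pi ^ 2 * n / M ^ 2))) := by ring
        _ ≤ _ := by
            gcongr
            exact hexp _ (by positivity) (hfar _ hθ hd)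
    linarith

theorem exists_le_leading_term {μ θ₀ δ : ℝ} (hμ : 0 < μ) (hθ₀ : 0 < θ₀)
    (h : μ * θ₀ ^ 3 = 2 * Real.pi ^ 2) (hδ : 0 < δ) :
    ∃ c t₀, 0 < c ∧ ∀ (n : ℕ) (t : ℝ), t₀ ≤ t → t ^ 3 = n → ∃ m ∈ window θ₀ δ t,
      c / t ^ 3 * Real.exp (-(3 / 2 * μ * θ₀ * t)) ≤
        Real.exp (-μ * m) * (leadingWeight m * leadingRatio m ^ n) := by
  have hpi := Real.pi_pos
  -- The witness is m = ⌈θ₀t⌉. The first factor pays for rounding up, the second comes from the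
  -- bound on `leadingWeight` with m + 2 ≤ (θ₀ + 3)t, and the third from the quartic error in cos²,
  -- which at n = t³ is at most 2π⁴/θ₀⁴.
  refine ⟨Real.exp (-μ) * (16 / (θ₀ + 3) ^ 3) * Real.exp (-(2 * Real.pi ^ 4 / θ₀ ^ 4)),
    1 + 3 / δ + 2 * Real.pi / θ₀, by positivity, fun n t ht htn => ?_⟩
  have hp1 : 0 < 3 / δ := by positivity
  have hp2 : 0 < 2 * Real.pi / θ₀ := by positivity
  have ht1 : 1 ≤ t := by linarith
  have ht0 : 0 < t := by linarith
  have htδ : 3 ≤ δ * t := by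
    have : 3 / δ ≤ t := by linarith
    rw [div_le_iff₀ hδ] at this
    linarith
  have htθ : 2 * Real.pi ≤ θ₀ * t := by
    have : 2 * Real.pi / θ₀ ≤ t := by linarith
    rw [div_le_iff₀ hθ₀] at this
    linarith
  set m : ℕ := ⌈θ₀ * t⌉₊ with hm
  have hm1 : θ₀ * t ≤ m := Nat.le_ceil _
  have hm2 : (m : ℝ) < θ₀ * t + 1 := Nat.ceil_lt_add_one (by positivity)
  refine ⟨m, mem_window.2 (abs_le.2 ⟨by linarith, by linarith⟩), ?_⟩
  have hM : (0 : ℝ) < m + 2 := by positivity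
  have hMlow : θ₀ * t ≤ (m : ℝ) + 2 := by linarith
  have hMup : (m : ℝ) + 2 ≤ (θ₀ + 3) * t := by nlinarith
  have hu : Real.pi / ((m : ℝ) + 2) ≤ Real.pi / (θ₀ * t) := by gcongr
  have hu2 : Real.pi / (θ₀ * t) ≤ 1 / 2 := by
    rw [div_le_div_iff₀ (by positivity) (by norm_num)]
    linarith
  have hu0 : 0 < Real.pi / ((m : ℝ) + 2) := by positivity
  have h1 : Real.exp (-μ * (θ₀ * t + 1)) ≤ Real.exp (-μ * m) := by
    rw [Real.exp_le_exp]
    nlinarith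
  have h2 : 16 / (θ₀ + 3) ^ 3 / t ^ 3 ≤ leadingWeight m := by
    refine le_trans ?_ (le_leadingWeight m)
    rw [div_div, ← mul_pow]
    gcongr
  have h3 : Real.exp (-(Real.pi ^ 2 / θ₀ ^ 2 * t + 2 * Real.pi ^ 4 / θ₀ ^ 4)) ≤
      leadingRatio m ^ n := by
    have hs := Real.exp_neg_le_cos_sq (u := Real.pi / ((m : ℝ) + 2)) (by nlinarith)
    have hle : (Real.pi / ((m : ℝ) + 2)) ^ 2 + 2 * (Real.pi / ((m : ℝ) + 2)) ^ 4 ≤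
        (Real.pi / (θ₀ * t)) ^ 2 + 2 * (Real.pi / (θ₀ * t)) ^ 4 := by gcongr
    calc _ ≤ Real.exp (-((Real.pi / (θ₀ * t)) ^ 2 + 2 * (Real.pi / (θ₀ * t)) ^ 4)) ^ n := by
          rw [← Real.exp_nat_mul, Real.exp_le_exp, ← htn]
          have e1 : t ^ 3 * -((Real.pi / (θ₀ * t)) ^ 2 + 2 * (Real.pi / (θ₀ * t)) ^ 4) =
              -(Real.pi ^ 2 / θ₀ ^ 2 * t + 2 * Real.pi ^ 4 / θ₀ ^ 4 * (1 / t)) := by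
            field_simp
          rw [e1, neg_le_neg_iff]
          have : 1 / t ≤ 1 := by
            rw [div_le_one ht0]
            exact ht1
          have h5 : 0 ≤ 2 * Real.pi ^ 4 / θ₀ ^ 4 := by positivity
          nlinarith
      _ ≤ leadingRatio m ^ n := by
          unfold leadingRatio
          refine pow_le_pow_left₀ (Real.exp_pos _).le (le_trans ?_ hs) n
          rw [Real.exp_le_exp]
          linarith
  have e2 : Real.pi ^ 2 / θ₀ ^ 2 = μ * θ₀ / 2 := by
    rw [show Real.pi ^ 2 = μ * θ₀ ^ 3 / 2 by linarith]
    field_simp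
  rw [e2] at h3
  have e3 : Real.exp (-μ) * (16 / (θ₀ + 3) ^ 3) * Real.exp (-(2 * Real.pi ^ 4 / θ₀ ^ 4)) / t ^ 3 *
      Real.exp (-(3 / 2 * μ * θ₀ * t)) = Real.exp (-μ * (θ₀ * t + 1)) *
      ((16 / (θ₀ + 3) ^ 3 / t ^ 3) *
        Real.exp (-(μ * θ₀ / 2 * t + 2 * Real.pi ^ 4 / θ₀ ^ 4))) := by
    have : Real.exp (-μ * (θ₀ * t + 1)) * Real.exp (-(μ * θ₀ / 2 * t + 2 * Real.pi ^ 4 / θ₀ ^ 4)) =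
        Real.exp (-μ) * Real.exp (-(2 * Real.pi ^ 4 / θ₀ ^ 4)) *
          Real.exp (-(3 / 2 * μ * θ₀ * t)) := by
      rw [← Real.exp_add, ← Real.exp_add, ← Real.exp_add]
      congr 1
      ring
    linear_combination (-(16 / (θ₀ + 3) ^ 3 / t ^ 3)) * this
  rw [e3]
  have := leadingWeight_nonneg m
  gcongr

theorem cbrt_pow_three (n : ℕ) : ((n : ℝ) ^ (1 / 3 : ℝ)) ^ 3 = n := by
  rw [← Real.rpow_natCast, ← Real.rpow_mul (Nat.cast_nonneg n)]
  norm_num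

theorem tendsto_cbrt : Tendsto (fun n : ℕ => (n : ℝ) ^ (1 / 3 : ℝ)) atTop atTop :=
  (tendsto_rpow_atTop (by norm_num)).comp tendsto_natCast_atTop_atTop

open PowerSeries in
/-- The sum over all numbers of levels is dominated by the leading terms in the window. -/
theorem eventually_tsum_le_window {μ θ₀ δ ε : ℝ} (hμ : 0 < μ) (hθ₀ : 0 < θ₀)
    (h : μ * θ₀ ^ 3 = 2 * Real.pi ^ 2) (hδ : 0 < δ) (hε : 0 < ε) :
    ∀ᶠ n : ℕ in atTop, ∑' m : ℕ, ENNReal.ofReal (Real.exp (-μ * m) * coeff n (normSeries m)) ≤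
      ENNReal.ofReal ((1 + ε) * ∑ m ∈ window θ₀ δ ((n : ℝ) ^ (1 / 3 : ℝ)),
        Real.exp (-μ * m) * (leadingWeight m * leadingRatio m ^ n)) := by
  obtain ⟨η, τ, hη, hτ, hle⟩ := exp_mul_coeff_le hμ hθ₀ h hδ
  obtain ⟨c, t₀, hc, hlow⟩ := exists_le_leading_term hμ hθ₀ h hδ
  have hq1 : Real.exp (-τ) < 1 := by
    rw [Real.exp_lt_one_iff]
    linarith
  set A := 4 * Real.exp (2 * μ) * (1 - Real.exp (-τ))⁻¹ with hA
  have hA0 : 0 < A := by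
    have : 0 < 1 - Real.exp (-τ) := by linarith
    positivity
  -- The relative error: the exponential excess beats the factor t³ lost in the lower bound for the
  -- leading term.
  have hlim : Tendsto (fun t : ℝ => A * (t ^ 3 * Real.exp (-(η * t)))) atTop (𝓝 0) := by
    have h1 := (Real.tendsto_pow_mul_exp_neg_atTop_nhds_zero 3).comp
      (tendsto_id.const_mul_atTop hη)
    have h2 := h1.const_mul (A / η ^ 3)
    rw [mul_zero] at h2
    refine h2.congr fun t => ?_
    simp only [Function.comp_apply, id]
    field_simp
  have hev : ∀ᶠ t : ℝ in atTop, A * (t ^ 3 * Real.exp (-(η * t))) ≤ ε * c :=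
    (hlim.eventually (gt_mem_nhds (by positivity))).mono fun t ht => ht.le
  filter_upwards [tendsto_cbrt.eventually hev, tendsto_cbrt.eventually (eventually_ge_atTop t₀),
    tendsto_cbrt.eventually (eventually_gt_atTop 0), eventually_ge_atTop 1] with n h1 h2 h3 h4
  set t := (n : ℝ) ^ (1 / 3 : ℝ) with ht
  have htn : t ^ 3 = n := cbrt_pow_three n
  have hpos : ∀ m : ℕ, 0 ≤ Real.exp (-μ * m) * (leadingWeight m * leadingRatio m ^ n) := by
    intro m
    have := leadingWeight_nonneg m
    have := leadingRatio_nonneg m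
    positivity
  set S := ∑ m ∈ window θ₀ δ t, Real.exp (-μ * m) * (leadingWeight m * leadingRatio m ^ n) with hS
  have hSlow : c / t ^ 3 * Real.exp (-(3 / 2 * μ * θ₀ * t)) ≤ S := by
    obtain ⟨m, hm, hle⟩ := hlow n t h2 htn
    exact hle.trans (Finset.single_le_sum (fun i _ => hpos i) hm)
  have hS0 : 0 ≤ S := Finset.sum_nonneg fun i _ => hpos i
  set E := 4 * Real.exp (2 * μ) * Real.exp (-((3 / 2 * μ * θ₀ + η) * t)) with hE
  have hE0 : 0 ≤ E := by positivity
  have herr : E * (1 - Real.exp (-τ))⁻¹ ≤ ε * S := by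
    have e1 : E * (1 - Real.exp (-τ))⁻¹ = A * (t ^ 3 * Real.exp (-(η * t))) *
        (1 / t ^ 3 * Real.exp (-(3 / 2 * μ * θ₀ * t))) := by
      have : Real.exp (-((3 / 2 * μ * θ₀ + η) * t)) =
          Real.exp (-(η * t)) * Real.exp (-(3 / 2 * μ * θ₀ * t)) := by
        rw [← Real.exp_add]
        congr 1
        ring
      rw [hE, hA, this]
      field_simp
    rw [e1]
    calc _ ≤ ε * c * (1 / t ^ 3 * Real.exp (-(3 / 2 * μ * θ₀ * t))) := by gcongr
      _ = ε * (c / t ^ 3 * Real.exp (-(3 / 2 * μ * θ₀ * t))) := by ring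
      _ ≤ _ := by gcongr
  calc ∑' m : ℕ, ENNReal.ofReal (Real.exp (-μ * m) * coeff n (normSeries m))
      ≤ ∑' m : ℕ, (ENNReal.ofReal (if m ∈ window θ₀ δ t then
          Real.exp (-μ * m) * (leadingWeight m * leadingRatio m ^ n) else 0) +
          ENNReal.ofReal (E * Real.exp (-τ) ^ m)) := by
        refine ENNReal.tsum_le_tsum fun m => ?_
        exact (ENNReal.ofReal_le_ofReal (hle n t h4 h3 htn m)).trans ENNReal.ofReal_add_le
    _ = ENNReal.ofReal S + ENNReal.ofReal (E * (1 - Real.exp (-τ))⁻¹) := by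
        rw [ENNReal.tsum_add]
        congr 1
        · rw [tsum_eq_sum (s := window θ₀ δ t), hS, ENNReal.ofReal_sum_of_nonneg fun i _ => hpos i]
          · refine Finset.sum_congr rfl fun m hm => ?_
            rw [if_pos hm]
          · intro m hm
            rw [if_neg hm, ENNReal.ofReal_zero]
        · rw [← ENNReal.ofReal_tsum_of_nonneg (fun m => by positivity), tsum_mul_left,
            tsum_geometric_of_lt_one (Real.exp_pos _).le hq1]
          exact (summable_geometric_of_lt_one (Real.exp_pos _).le hq1).mul_left _
    _ ≤ ENNReal.ofReal ((1 + ε) * S) := by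
        rw [← ENNReal.ofReal_add hS0 (by
          have : 0 < 1 - Real.exp (-τ) := by linarith
          positivity)]
        exact ENNReal.ofReal_le_ofReal (by linarith)

/-- In a small window, the leading weight times the size is close to `2 μ`. -/
theorem exists_window {μ θ₀ y : ℝ} (hμ : 0 < μ) (hθ₀ : 0 < θ₀)
    (h : μ * θ₀ ^ 3 = 2 * Real.pi ^ 2) (hy : y < 2 * μ) :
    ∃ δ, 0 < δ ∧ ∀ (C m₁ : ℕ), ∀ᶠ n : ℕ in atTop,
      ∀ m ∈ window θ₀ δ ((n : ℝ) ^ (1 / 3 : ℝ)), m₁ ≤ m ∧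
        y ≤ leadingWeight m * ((n - C : ℕ) : ℝ) := by
  have hpi := Real.pi_pos
  -- One small e serves all approximations: two factors 1 - e from sin u ≥ (1 - e)u, one from n - C
  -- ≥ (1 - e)n, and θ₀ + e from the width of the window. At e = 0 the bound is 4π²/θ₀³ = 2μ.
  obtain ⟨e, he0, he1, heθ, hey⟩ : ∃ e : ℝ, 0 < e ∧ e < 1 ∧ e < θ₀ / 2 ∧
      y < 4 * Real.pi ^ 2 * (1 - e) ^ 3 / (θ₀ + e) ^ 3 := by
    have hcont : ContinuousAt (fun e : ℝ => 4 * Real.pi ^ 2 * (1 - e) ^ 3 / (θ₀ + e) ^ 3) 0 := by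
      refine ContinuousAt.div (by fun_prop) (by fun_prop) ?_
      simp [hθ₀.ne']
    have hval : y < 4 * Real.pi ^ 2 * (1 - (0 : ℝ)) ^ 3 / (θ₀ + 0) ^ 3 := by
      have : 4 * Real.pi ^ 2 * (1 - (0 : ℝ)) ^ 3 / (θ₀ + 0) ^ 3 = 2 * μ := by
        rw [show Real.pi ^ 2 = μ * θ₀ ^ 3 / 2 by linarith]
        field_simp
        ring
      rwa [this]
    have h1 := (hcont.eventually (lt_mem_nhds hval)).filter_mono (nhdsWithin_le_nhds (s := Set.Ioi 0))
    have h2 : ∀ᶠ e : ℝ in 𝓝[>] 0, e < 1 := nhdsWithin_le_nhds (gt_mem_nhds one_pos)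
    have h3 : ∀ᶠ e : ℝ in 𝓝[>] 0, e < θ₀ / 2 := nhdsWithin_le_nhds (gt_mem_nhds (by positivity))
    obtain ⟨e, ⟨⟨a, b⟩, c⟩, d⟩ := (((h1.and h2).and h3).and self_mem_nhdsWithin).exists
    exact ⟨e, d, b, c, a⟩
  refine ⟨e, he0, fun C m₁ => ?_⟩
  filter_upwards [tendsto_cbrt.eventually (eventually_ge_atTop (2 * Real.pi / (θ₀ * e))),
    tendsto_cbrt.eventually (eventually_ge_atTop (2 * (m₁ + 2) / θ₀)),
    tendsto_natCast_atTop_atTop.eventually (eventually_ge_atTop ((C : ℝ) / e))] with n h1 h2 h3 m hm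
  set t := (n : ℝ) ^ (1 / 3 : ℝ) with ht
  have htn : t ^ 3 = n := cbrt_pow_three n
  have ht0 : 0 < t := lt_of_lt_of_le (by positivity) h1
  rw [mem_window, abs_le] at hm
  rw [div_le_iff₀ (by positivity)] at h1 h2 h3
  have hMlow : θ₀ / 2 * t ≤ (m : ℝ) + 2 := by nlinarith
  have hMup : (m : ℝ) + 2 ≤ (θ₀ + e) * t := by nlinarith
  have hM : (0 : ℝ) < m + 2 := by positivity
  constructor
  · have : (m₁ : ℝ) ≤ m := by linarith
    exact_mod_cast this
  · set u := Real.pi / ((m : ℝ) + 2) with hu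
    have hu0 : 0 < u := by positivity
    have hue : u ≤ e := by
      rw [hu, div_le_iff₀ hM]
      nlinarith
    have hsin : (1 - e) * u ≤ Real.sin u := by
      have := Real.sin_gt_sub_cube hu0
      nlinarith [mul_pos hu0 hu0]
    have hn : (1 - e) * (n : ℝ) ≤ ((n - C : ℕ) : ℝ) := by
      have : (n : ℝ) - C ≤ ((n - C : ℕ) : ℝ) := by
        rw [sub_le_iff_le_add]
        exact_mod_cast (show n ≤ n - C + C by omega)
      linarith
    have h1e : 0 ≤ 1 - e := by linarith
    calc y ≤ 4 * Real.pi ^ 2 * (1 - e) ^ 3 / (θ₀ + e) ^ 3 := hey.le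
      _ = 4 * Real.pi ^ 2 * (1 - e) ^ 2 / ((θ₀ + e) * t) ^ 3 * ((1 - e) * t ^ 3) := by
          field_simp
      _ ≤ 4 * Real.pi ^ 2 * (1 - e) ^ 2 / ((m : ℝ) + 2) ^ 3 * ((1 - e) * t ^ 3) := by
          gcongr
      _ = 4 * ((1 - e) * u) ^ 2 / (m + 2) * ((1 - e) * n) := by
          rw [htn, hu]
          field_simp
      _ ≤ leadingWeight m * ((n - C : ℕ) : ℝ) := by
          unfold leadingWeight
          rw [← hu]
          gcongr

/-! ### Comparison of k vertices with one vertex -/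

/-- The eigenfunction of the branching process that governs the limit. -/
noncomputable def harmonicWeight (μ : ℝ) (k : ℕ) : ℝ :=
  ∑ j ∈ Finset.range k, (k.choose (j + 1) : ℝ) * (μ ^ j / j.factorial)

-- The sum for one vertex is dominated by its window, and inside the window
-- `le_coeff_normSeries_pow` bounds the coefficient of the K-th power below, term by term, by the
-- leading term times a factor tending to 2^(K-1) `harmonicWeight μ K`. The shift s accounts for
-- edges already used by the fixed ball.
open PowerSeries in
theorem eventually_le_tsum_coeff_pow {μ : ℝ} (hμ : 0 < μ) (K s : ℕ) {c : ℝ}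
    (hc0 : 0 ≤ c) (hc : c < 2 ^ (K - 1) * harmonicWeight μ K) :
    ∀ᶠ n : ℕ in atTop,
      ENNReal.ofReal c *
        ∑' m : ℕ, ENNReal.ofReal (Real.exp (-μ * m) * coeff n (normSeries m)) ≤
      ∑' m : ℕ, ENNReal.ofReal (Real.exp (-μ * m) * coeff (n - s) (normSeries m ^ K)) := by
  obtain ⟨θ₀, hθ₀, h⟩ : ∃ θ₀ : ℝ, 0 < θ₀ ∧ μ * θ₀ ^ 3 = 2 * Real.pi ^ 2 := by
    have hpi := Real.pi_pos
    refine ⟨(2 * Real.pi ^ 2 / μ) ^ (1 / 3 : ℝ), by positivity, ?_⟩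
    rw [← Real.rpow_natCast, ← Real.rpow_mul (by positivity)]
    norm_num
    field_simp
  -- The factor gained over one vertex, with β the mass of bounded progeny and y the leading weight
  -- times the size; their limiting values are 2 and 2μ.
  set w : ℝ → ℝ → ℝ := fun β y => ∑ j ∈ Finset.range K, (K.choose (j + 1) : ℝ) *
      β ^ (K - (j + 1)) * y ^ j / j.factorial with hw
  have hw2 : w 2 (2 * μ) = 2 ^ (K - 1) * harmonicWeight μ K := by
    simp only [hw, harmonicWeight, Finset.mul_sum]
    refine Finset.sum_congr rfl fun j hj => ?_
    have hj := Finset.mem_range.1 hj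
    rw [mul_pow, show K - 1 = (K - (j + 1)) + j by omega, pow_add]
    ring
  obtain ⟨e, he0, he1, heμ, hec⟩ : ∃ e : ℝ, 0 < e ∧ e < 1 ∧ e < μ ∧
      c * (1 + e) < w (2 - e) (2 * μ - e) := by
    have hcont : ContinuousAt (fun e : ℝ => w (2 - e) (2 * μ - e) - c * (1 + e)) 0 := by
      simp only [hw]
      fun_prop
    have hval : 0 < w (2 - 0) (2 * μ - 0) - c * (1 + 0) := by
      rw [sub_zero, sub_zero, hw2]
      linarith
    have h1 := (hcont.eventually (lt_mem_nhds hval)).filter_mono (nhdsWithin_le_nhds (s := Set.Ioi 0))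
    have h2 : ∀ᶠ e : ℝ in 𝓝[>] 0, e < 1 := nhdsWithin_le_nhds (gt_mem_nhds one_pos)
    have h3 : ∀ᶠ e : ℝ in 𝓝[>] 0, e < μ := nhdsWithin_le_nhds (gt_mem_nhds hμ)
    obtain ⟨e, ⟨⟨a, b⟩, c⟩, d⟩ := (((h1.and h2).and h3).and self_mem_nhdsWithin).exists
    exact ⟨e, d, b, c, by linarith⟩
  obtain ⟨m₀, hm₀⟩ : ∃ m₀ : ℕ, 2 - e < 2 * ((m₀ : ℝ) + 1) / (m₀ + 2) := by
    obtain ⟨m₀, hm₀⟩ := exists_nat_gt (2 / e)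
    refine ⟨m₀, ?_⟩
    rw [lt_div_iff₀ (by positivity)]
    rw [div_lt_iff₀ he0] at hm₀
    nlinarith
  obtain ⟨L, hL⟩ := (((hasSum_coeff_normSeries m₀).tendsto_sum_nat.eventually
    (lt_mem_nhds hm₀))).exists
  set β := ∑ l ∈ Finset.range L, coeff l (normSeries m₀) with hβ
  obtain ⟨δ, hδ, hwin⟩ := exists_window hμ hθ₀ h (show 2 * μ - e < 2 * μ by linarith)
  filter_upwards [hwin (s + L * K) (max m₀ 1), eventually_tsum_le_window hμ hθ₀ h hδ he0,
    eventually_ge_atTop (s + L * K)] with n h1 h2 h3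
  have hα := leadingWeight_nonneg
  have hρ := leadingRatio_nonneg
  calc _ ≤ ENNReal.ofReal c * _ := mul_le_mul_right h2 _
    _ = ENNReal.ofReal (∑ m ∈ window θ₀ δ ((n : ℝ) ^ (1 / 3 : ℝ)), c * (1 + e) *
          (Real.exp (-μ * m) * (leadingWeight m * leadingRatio m ^ n))) := by
        rw [← ENNReal.ofReal_mul hc0, ← Finset.mul_sum, mul_assoc]
    _ ≤ ENNReal.ofReal (∑ m ∈ window θ₀ δ ((n : ℝ) ^ (1 / 3 : ℝ)),
          Real.exp (-μ * m) * coeff (n - s) (normSeries m ^ K)) := by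
        refine ENNReal.ofReal_le_ofReal (Finset.sum_le_sum fun m hm => ?_)
        obtain ⟨hm1, hm2⟩ := h1 m hm
        have hb := le_coeff_normSeries_pow hβ (m := m) (by omega) (by omega) K (n - s) (by omega)
        rw [Nat.sub_sub] at hb
        have hρn : leadingRatio m ^ n ≤ leadingRatio m ^ (n - s) :=
          pow_le_pow_of_le_one (hρ m) (leadingRatio_le_one m) (by omega)
        have hmono : c * (1 + e) ≤ w β (leadingWeight m * ((n - (s + L * K) : ℕ) : ℝ)) := by
          refine hec.le.trans ?_
          simp only [hw]
          have hL' := hL.le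
          have : 0 ≤ 2 - e := by linarith
          have : 0 ≤ 2 * μ - e := by linarith
          have : 0 ≤ β := by linarith
          gcongr
        have hα' := hα m
        have hρ' := hρ m
        calc c * (1 + e) * (Real.exp (-μ * m) * (leadingWeight m * leadingRatio m ^ n))
            = Real.exp (-μ * m) * (leadingWeight m * leadingRatio m ^ n * (c * (1 + e))) := by ring
          _ ≤ Real.exp (-μ * m) * (leadingWeight m * leadingRatio m ^ (n - s) *
              w β (leadingWeight m * ((n - (s + L * K) : ℕ) : ℝ))) := by
              gcongr
          _ ≤ _ := by
              gcongr
    _ = ∑ m ∈ window θ₀ δ ((n : ℝ) ^ (1 / 3 : ℝ)),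
          ENNReal.ofReal (Real.exp (-μ * m) * coeff (n - s) (normSeries m ^ K)) := by
        refine ENNReal.ofReal_sum_of_nonneg fun m _ => ?_
        exact mul_nonneg (Real.exp_pos _).le (coeff_pow_nonneg (coeff_normSeries_nonneg m) _ _)
    _ ≤ _ := ENNReal.sum_le_tsum _

end PlanarTree

/-! ### The critical geometric branching process and its eigenfunction -/

theorem Nat.choose_mul_choose_add (k j i : ℕ) :
    (k + j + i).choose (j + i) * (j + i).choose j = (k + j).choose j * (k + j + i).choose i := by
  have h := Nat.choose_mul (n := k + j + i) (k := j + i) (s := i) (by omega)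
  rw [Nat.add_sub_cancel, Nat.add_sub_cancel] at h
  rw [Nat.choose_symm_add (a := j) (b := i), h, mul_comm]

/-- Vandermonde's identity. It expresses the expected binomial moments of the next generation
through those of the present one. -/
theorem Nat.multichoose_succ_eq_sum (k j : ℕ) :
    Nat.multichoose k (j + 1) =
      ∑ i ∈ Finset.range (j + 1), j.choose i * k.choose (i + 1) := by
  rw [Nat.multichoose_eq, show k + (j + 1) - 1 = k + j by omega, Nat.add_choose_eq,
    Finset.Nat.sum_antidiagonal_eq_sum_range_succ (fun a b => k.choose a * j.choose b),
    Finset.sum_range_succ']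
  rw [show j + 1 - 0 = j + 1 from rfl, Nat.choose_succ_self, mul_zero, add_zero]
  refine Finset.sum_congr rfl fun i hi => ?_
  have := Finset.mem_range.1 hi
  rw [show j + 1 - (i + 1) = j - i by omega, Nat.choose_symm (by omega), mul_comm]

theorem Nat.mul_choose_eq (k j : ℕ) :
    k * k.choose j = j * k.choose j + (j + 1) * k.choose (j + 1) := by
  have h := Nat.choose_succ_right_eq k j
  rcases le_or_gt j k with hjk | hjk
  · obtain ⟨d, rfl⟩ : ∃ d, k = j + d := ⟨k - j, by omega⟩
    rw [Nat.add_sub_cancel_left] at h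
    linarith
  · rw [Nat.choose_eq_zero_of_lt hjk, Nat.choose_eq_zero_of_lt (by omega)]
    simp

/-- Factorial moments of the Poisson distribution. -/
theorem Real.hasSum_pow_div_factorial_mul_descFactorial (x : ℝ) (i : ℕ) :
    HasSum (fun j : ℕ => x ^ j / j.factorial * (j.descFactorial i : ℝ)) (x ^ i * Real.exp x) := by
  rw [← hasSum_nat_add_iff' i, Finset.sum_eq_zero, sub_zero]
  · have h := (NormedSpace.expSeries_div_hasSum_exp x).mul_left (x ^ i)
    rw [← Real.exp_eq_exp_ℝ] at h
    refine h.congr_fun fun j => ?_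
    have h1 := Nat.factorial_mul_descFactorial (show i ≤ j + i by omega)
    rw [Nat.add_sub_cancel] at h1
    have h2 : (j.factorial : ℝ) * ((j + i).descFactorial i : ℝ) = (j + i).factorial := by
      exact_mod_cast h1
    rw [← h2, pow_add]
    have h3 : (j.factorial : ℝ) ≠ 0 := by positivity
    have h4 : ((j + i).descFactorial i : ℝ) ≠ 0 := by
      intro h0
      rw [h0, mul_zero] at h2
      exact (Nat.factorial_ne_zero (j + i)) (by exact_mod_cast h2.symm)
    field_simp
  · intro j hj
    rw [Nat.descFactorial_eq_zero_iff_lt.2 (Finset.mem_range.1 hj)]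
    simp

namespace PlanarTree

/-- The expected number of `j`-subsets in the next generation of a critical geometric branching
process. -/
theorem tsum_multichoose_mul_choose (k j : ℕ) :
    ∑' b : ℕ, (Nat.multichoose k b : ℝ≥0∞) * ((2⁻¹ : ℝ≥0∞) ^ (k + b) * (b.choose j : ℝ≥0∞)) =
      (Nat.multichoose k j : ℝ≥0∞) := by
  rcases k with _ | k
  · rw [tsum_eq_single 0]
    · rcases j with _ | j <;> simp
    · intro b hb
      obtain ⟨b, rfl⟩ := Nat.exists_eq_succ_of_ne_zero hb
      simp
  -- After a shift of b by j and a regrouping of the two binomial coefficients, the sum is a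
  -- negative binomial series at 1/2.
  · have hs := hasSum_choose_mul_geometric_of_norm_lt_one (k + j) (r := (2⁻¹ : ℝ)) (by norm_num)
    have hs2 := hs.mul_left (((k + j).choose j : ℝ) * 2⁻¹ ^ (k + 1 + j))
    have hval : ((k + j).choose j : ℝ) * 2⁻¹ ^ (k + 1 + j) * (1 / (1 - 2⁻¹) ^ (k + j + 1)) =
        (k + j).choose j := by
      have : (1 : ℝ) - 2⁻¹ = 2⁻¹ := by norm_num
      rw [this, show k + 1 + j = k + j + 1 by ring, mul_assoc, mul_one_div_cancel (by positivity),
        mul_one]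
    rw [hval] at hs2
    have hterm : ∀ b : ℕ, (Nat.multichoose (k + 1) b : ℝ≥0∞) *
        ((2⁻¹ : ℝ≥0∞) ^ (k + 1 + b) * (b.choose j : ℝ≥0∞)) =
        ENNReal.ofReal (Nat.multichoose (k + 1) b * (2⁻¹ ^ (k + 1 + b) * b.choose j)) := by
      intro b
      rw [ENNReal.ofReal_mul (by positivity), ENNReal.ofReal_mul (by positivity),
        ENNReal.ofReal_natCast, ENNReal.ofReal_natCast, ENNReal.ofReal_pow (by positivity),
        ENNReal.ofReal_inv_of_pos (by norm_num), ENNReal.ofReal_ofNat]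
    have hsum : HasSum (fun b : ℕ => (Nat.multichoose (k + 1) b : ℝ) *
        (2⁻¹ ^ (k + 1 + b) * b.choose j)) (((k + j).choose j : ℕ) : ℝ) := by
      rw [← hasSum_nat_add_iff' j, Finset.sum_eq_zero, sub_zero]
      · refine hs2.congr_fun fun i => ?_
        have h := Nat.choose_mul_choose_add k j i
        have h' : ((k + j + i).choose (j + i) : ℝ) * (j + i).choose j =
          (k + j).choose j * (k + j + i).choose i := by exact_mod_cast h
        rw [Nat.multichoose_eq, show k + 1 + (i + j) - 1 = k + j + i by omega, add_comm i j,
          show i + (k + j) = k + j + i by ring, show k + 1 + (j + i) = k + 1 + j + i by ring,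
          pow_add _ (k + 1 + j), Nat.choose_symm_add (a := k + j) (b := i)]
        linear_combination (2⁻¹ ^ (k + 1 + j) * 2⁻¹ ^ i : ℝ) * h'
      · intro b hb
        rw [Nat.choose_eq_zero_of_lt (Finset.mem_range.1 hb)]
        simp
    simp_rw [hterm]
    rw [← ENNReal.ofReal_tsum_of_nonneg (fun b => by positivity) hsum.summable, hsum.tsum_eq,
      ENNReal.ofReal_natCast, Nat.multichoose_eq, show k + 1 + j - 1 = k + j by omega]

/-- The probability that the critical geometric Galton–Watson tree has `T` as its ball of
radius `r`. -/
noncomputable def gwWeight (r : ℕ) (T : PlanarTree) : ℝ≥0∞ :=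
  2 * 2 ^ T.width r * 4⁻¹ ^ T.volume r

/-- The expectation of a function of the width at height `r` of the critical geometric
Galton–Watson tree. -/
noncomputable def gwSum (r : ℕ) (F : ℕ → ℝ≥0∞) : ℝ≥0∞ :=
  ∑' T : Ball r, gwWeight r T.1 * F (T.1.width r)

/-- The new factor is the probability of b children in a prescribed arrangement, each of the k
vertices having offspring law 2^(-(i+1)). -/
theorem gwWeight_extension {r : ℕ} {T : PlanarTree} (U : Extension r T) :
    gwWeight (r + 1) U.1 = gwWeight r T * 2⁻¹ ^ (T.width r + U.1.width (r + 1)) := by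
  have hv : U.1.volume (r + 1) = T.volume r + U.1.width (r + 1) := by
    rw [volume_succ, ← volume_ball le_rfl U.1, U.2.2]
  set b := U.1.width (r + 1) with hb
  have h2 : (2 : ℝ≥0∞) * 2⁻¹ = 1 := ENNReal.mul_inv_cancel (by norm_num) (by norm_num)
  have h4 : (4⁻¹ : ℝ≥0∞) = 2⁻¹ * 2⁻¹ := by
    rw [← ENNReal.mul_inv (by norm_num) (by norm_num)]
    norm_num
  have h5 : (2 : ℝ≥0∞) * 4⁻¹ = 2⁻¹ := by rw [h4, ← mul_assoc, h2, one_mul]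
  rw [gwWeight, gwWeight, hv, ← hb, pow_add, pow_add]
  calc (2 : ℝ≥0∞) * 2 ^ b * (4⁻¹ ^ T.volume r * 4⁻¹ ^ b)
      = 2 * 4⁻¹ ^ T.volume r * (2 * 4⁻¹) ^ b := by rw [mul_pow]; ring
    _ = 2 * 4⁻¹ ^ T.volume r * (2⁻¹) ^ b * (2 * 2⁻¹) ^ T.width r := by
        rw [h5, h2, one_pow, mul_one]
    _ = _ := by rw [mul_pow]; ring

theorem tsum_gwWeight_extension {r : ℕ} (hr : 1 ≤ r) {T : PlanarTree} (hT : ball r T = T)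
    (F : ℕ → ℝ≥0∞) :
    ∑' U : Extension r T, gwWeight (r + 1) U.1 * F (U.1.width (r + 1)) =
      gwWeight r T * ∑' b, (Nat.multichoose (T.width r) b : ℝ≥0∞) *
        (2⁻¹ ^ (T.width r + b) * F b) := by
  rw [← tsum_extension hr hT (fun b => 2⁻¹ ^ (T.width r + b) * F b), ← ENNReal.tsum_mul_left]
  refine tsum_congr fun U => ?_
  rw [gwWeight_extension, mul_assoc]

theorem gwSum_one (F : ℕ → ℝ≥0∞) : gwSum 1 F = F 1 := by
  rw [gwSum, tsum_eq_single ⟨edge, ball_one edge⟩]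
  · have : (2 : ℝ≥0∞) * 2 ^ 1 * 4⁻¹ ^ 1 = 1 := by
      rw [pow_one, pow_one, show (2 : ℝ≥0∞) * 2 = 4 by norm_num]
      exact ENNReal.mul_inv_cancel (by norm_num) (by norm_num)
    rw [gwWeight, volume_edge, show edge.width 1 = 1 from rfl, this, one_mul]
  · rintro ⟨T, hT⟩ hne
    exact absurd (Subtype.ext (hT.symm.trans (ball_one T))) hne

theorem gwSum_succ {r : ℕ} (hr : 1 ≤ r) (F : ℕ → ℝ≥0∞) :
    gwSum (r + 1) F = gwSum r fun k => ∑' b, (Nat.multichoose k b : ℝ≥0∞) *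
      (2⁻¹ ^ (k + b) * F b) := by
  rw [gwSum, ← (ballSuccEquiv r).tsum_eq, ENNReal.tsum_sigma', gwSum]
  refine tsum_congr fun T => ?_
  exact tsum_gwWeight_extension hr T.2 F

theorem gwSum_tsum (r : ℕ) (F : ℕ → ℕ → ℝ≥0∞) :
    gwSum r (fun k => ∑' j, F j k) = ∑' j, gwSum r (F j) := by
  simp_rw [gwSum, ← ENNReal.tsum_mul_left]
  exact ENNReal.tsum_comm

theorem gwSum_const_mul (r : ℕ) (c : ℝ≥0∞) (F : ℕ → ℝ≥0∞) :
    gwSum r (fun k => c * F k) = c * gwSum r F := by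
  simp_rw [gwSum, ← ENNReal.tsum_mul_left]
  exact tsum_congr fun T => by ring

theorem gwSum_add (r : ℕ) (F G : ℕ → ℝ≥0∞) :
    gwSum r (fun k => F k + G k) = gwSum r F + gwSum r G := by
  simp_rw [gwSum, mul_add]
  exact ENNReal.tsum_add

theorem gwSum_sum (r : ℕ) {ι : Type*} (s : Finset ι) (F : ι → ℕ → ℝ≥0∞) :
    gwSum r (fun k => ∑ i ∈ s, F i k) = ∑ i ∈ s, gwSum r (F i) := by
  classical
  induction s using Finset.induction_on with
  | empty => simp [gwSum]
  | insert a s ha ih =>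
    simp_rw [Finset.sum_insert ha]
    rw [gwSum_add, ih]

/-- One generation maps the sequence n^j to Σ_i C(j,i) n^i = (n + 1)^j, by
`tsum_multichoose_mul_choose` and Vandermonde. -/
theorem gwSum_choose (n j : ℕ) :
    gwSum (n + 1) (fun k => (k.choose (j + 1) : ℝ≥0∞)) = (n : ℝ≥0∞) ^ j := by
  induction n generalizing j with
  | zero =>
    rw [zero_add, gwSum_one]
    rcases j with _ | j
    · simp
    · simp [Nat.choose_eq_zero_of_lt]
  | succ n ih =>
    rw [gwSum_succ (by omega)]
    simp_rw [tsum_multichoose_mul_choose, Nat.multichoose_succ_eq_sum]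
    push_cast
    rw [gwSum_sum]
    simp_rw [gwSum_const_mul, ih]
    rw [add_pow]
    refine Finset.sum_congr rfl fun i _ => ?_
    ring

theorem ofReal_harmonicWeight {μ : ℝ} (hμ : 0 < μ) (k : ℕ) :
    ENNReal.ofReal (harmonicWeight μ k) =
      ∑' j : ℕ, ENNReal.ofReal (μ ^ j / j.factorial) * (k.choose (j + 1) : ℝ≥0∞) := by
  rw [tsum_eq_sum (s := Finset.range k), harmonicWeight,
    ENNReal.ofReal_sum_of_nonneg fun j _ => by positivity]
  · refine Finset.sum_congr rfl fun j _ => ?_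
    rw [ENNReal.ofReal_mul (by positivity), ENNReal.ofReal_natCast, mul_comm]
  · intro j hj
    have : ¬ j < k := fun h => hj (Finset.mem_range.2 h)
    rw [Nat.choose_eq_zero_of_lt (by omega)]
    simp

theorem ofReal_pow_div_factorial_mul {μ : ℝ} (hμ : 0 < μ) (n j : ℕ) :
    ENNReal.ofReal (μ ^ j / j.factorial) * (n : ℝ≥0∞) ^ j =
      ENNReal.ofReal ((μ * n) ^ j / j.factorial) := by
  rw [← ENNReal.ofReal_natCast n, ← ENNReal.ofReal_pow (by positivity),
    ← ENNReal.ofReal_mul (by positivity), mul_pow]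
  congr 1
  ring

/-- `harmonicWeight` is an eigenfunction of the branching process. -/
theorem tsum_multichoose_mul_harmonicWeight {μ : ℝ} (hμ : 0 < μ) (k : ℕ) :
    ∑' b : ℕ, (Nat.multichoose k b : ℝ≥0∞) *
      (2⁻¹ ^ (k + b) * ENNReal.ofReal (harmonicWeight μ b)) =
      ENNReal.ofReal (Real.exp μ) * ENNReal.ofReal (harmonicWeight μ k) := by
  have h1 : ∀ b : ℕ, (Nat.multichoose k b : ℝ≥0∞) *
      (2⁻¹ ^ (k + b) * ENNReal.ofReal (harmonicWeight μ b)) =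
      ∑' j : ℕ, ENNReal.ofReal (μ ^ j / j.factorial) * ((Nat.multichoose k b : ℝ≥0∞) *
      (2⁻¹ ^ (k + b) * (b.choose (j + 1) : ℝ≥0∞))) := by
    intro b
    rw [ofReal_harmonicWeight hμ, ← ENNReal.tsum_mul_left, ← ENNReal.tsum_mul_left]
    refine tsum_congr fun j => ?_
    ring
  simp_rw [h1]
  rw [ENNReal.tsum_comm]
  simp_rw [ENNReal.tsum_mul_left, tsum_multichoose_mul_choose]
  have h2 : ∀ j : ℕ, (Nat.multichoose k (j + 1) : ℝ≥0∞) =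
      ∑' i : ℕ, (j.choose i : ℝ≥0∞) * (k.choose (i + 1) : ℝ≥0∞) := by
    intro j
    rw [tsum_eq_sum (s := Finset.range (j + 1)), Nat.multichoose_succ_eq_sum]
    · push_cast
      rfl
    · intro i hi
      have : ¬ i < j + 1 := fun h => hi (Finset.mem_range.2 h)
      rw [Nat.choose_eq_zero_of_lt (by omega)]
      simp
  simp_rw [h2, ← ENNReal.tsum_mul_left]
  rw [ENNReal.tsum_comm, ofReal_harmonicWeight hμ, ← ENNReal.tsum_mul_left]
  refine tsum_congr fun i => ?_
  -- After exchanging the sums, the weights μ^j/j! are reproduced by the Poisson binomial moments,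
  -- up to the eigenvalue exp(μ).
  have h3 : HasSum (fun j : ℕ => μ ^ j / j.factorial * (j.choose i : ℝ))
      (Real.exp μ * (μ ^ i / i.factorial)) := by
    have := (Real.hasSum_pow_div_factorial_mul_descFactorial μ i).mul_left (1 / (i.factorial : ℝ))
    convert! this using 1
    · funext j
      rw [Nat.descFactorial_eq_factorial_mul_choose]
      push_cast
      field_simp
    · ring
  rw [← mul_assoc, ← ENNReal.ofReal_mul (Real.exp_pos _).le, ← h3.tsum_eq,
    ENNReal.ofReal_tsum_of_nonneg (fun j => by positivity) h3.summable, ← ENNReal.tsum_mul_right]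
  refine tsum_congr fun j => ?_
  rw [ENNReal.ofReal_mul (by positivity), ENNReal.ofReal_natCast, mul_assoc]

/-! ### Moments of the width under the transformed process -/

/-- First moment of the width in the transformed process. -/
theorem gwSum_harmonicWeight_mul_width {μ : ℝ} (hμ : 0 < μ) (n : ℕ) :
    gwSum (n + 1) (fun k => ENNReal.ofReal (harmonicWeight μ k) * (k : ℝ≥0∞)) =
      ENNReal.ofReal (Real.exp (μ * n) * (μ * n ^ 2 + (μ + 2) * n + 1)) := by
  -- The factor k is absorbed by `Nat.mul_choose_eq`, so that only binomial coefficients remain and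
  -- `gwSum_choose` applies.
  have h1 : ∀ k : ℕ, ENNReal.ofReal (harmonicWeight μ k) * (k : ℝ≥0∞) =
      ∑' j : ℕ, ENNReal.ofReal (μ ^ j / j.factorial) *
        (((j + 1 : ℕ) : ℝ≥0∞) * (k.choose (j + 1) : ℝ≥0∞) +
          ((j + 2 : ℕ) : ℝ≥0∞) * (k.choose (j + 1 + 1) : ℝ≥0∞)) := by
    intro k
    rw [ofReal_harmonicWeight hμ, ← ENNReal.tsum_mul_right]
    refine tsum_congr fun j => ?_
    rw [mul_assoc]
    congr 1
    have := Nat.mul_choose_eq k (j + 1)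
    rw [mul_comm]
    exact_mod_cast this
  simp_rw [h1]
  rw [gwSum_tsum]
  simp_rw [gwSum_const_mul, gwSum_add, gwSum_const_mul, gwSum_choose]
  set x := μ * n with hx
  have h2 : ∀ j : ℕ, ENNReal.ofReal (μ ^ j / j.factorial) * (((j + 1 : ℕ) : ℝ≥0∞) * (n : ℝ≥0∞) ^ j +
      ((j + 2 : ℕ) : ℝ≥0∞) * (n : ℝ≥0∞) ^ (j + 1)) =
      ENNReal.ofReal (x ^ j / j.factorial * ((j + 1) + (j + 2) * n)) := by
    intro j
    rw [ENNReal.ofReal_mul (by positivity), ← ofReal_pow_div_factorial_mul hμ, mul_assoc]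
    congr 1
    rw [show ((j : ℝ) + 1) + (j + 2) * n = (((j + 1) + (j + 2) * n : ℕ) : ℝ) by push_cast; ring,
      ENNReal.ofReal_natCast]
    push_cast
    ring
  have h3 : HasSum (fun j : ℕ => x ^ j / j.factorial * (((j : ℝ) + 1) + (j + 2) * n))
      (Real.exp x * (μ * n ^ 2 + (μ + 2) * n + 1)) := by
    have a0 := (Real.hasSum_pow_div_factorial_mul_descFactorial x 0).mul_left (1 + 2 * (n : ℝ))
    have a1 := (Real.hasSum_pow_div_factorial_mul_descFactorial x 1).mul_left (1 + (n : ℝ))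
    convert! a0.add a1 using 1
    · funext j
      simp
      ring
    · rw [hx]
      ring
  simp_rw [h2]
  rw [← ENNReal.ofReal_tsum_of_nonneg (fun j => by positivity) h3.summable, h3.tsum_eq]

/-- Second moment of the width in the transformed process. -/
theorem gwSum_harmonicWeight_mul_width_sq {μ : ℝ} (hμ : 0 < μ) (n : ℕ) :
    gwSum (n + 1) (fun k => ENNReal.ofReal (harmonicWeight μ k) * (k : ℝ≥0∞) ^ 2) =
      ENNReal.ofReal (Real.exp (μ * n) * (((μ * n) ^ 2 + 3 * (μ * n) + 1) +
        n * (2 * (μ * n) ^ 2 + 9 * (μ * n) + 6) + n ^ 2 * ((μ * n) ^ 2 + 6 * (μ * n) + 6))) := by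
  have h1 : ∀ k : ℕ, ENNReal.ofReal (harmonicWeight μ k) * (k : ℝ≥0∞) ^ 2 =
      ∑' j : ℕ, ENNReal.ofReal (μ ^ j / j.factorial) *
        ((((j + 1) ^ 2 : ℕ) : ℝ≥0∞) * (k.choose (j + 1) : ℝ≥0∞) +
          (((j + 2) * (2 * j + 3) : ℕ) : ℝ≥0∞) * (k.choose (j + 1 + 1) : ℝ≥0∞) +
          (((j + 2) * (j + 3) : ℕ) : ℝ≥0∞) * (k.choose (j + 2 + 1) : ℝ≥0∞)) := by
    intro k
    rw [ofReal_harmonicWeight hμ, ← ENNReal.tsum_mul_right]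
    refine tsum_congr fun j => ?_
    rw [mul_assoc]
    congr 1
    have e1 := Nat.mul_choose_eq k (j + 1)
    have e2 := Nat.mul_choose_eq k (j + 2)
    have : k.choose (j + 1) * k ^ 2 = (j + 1) ^ 2 * k.choose (j + 1) +
        (j + 2) * (2 * j + 3) * k.choose (j + 1 + 1) +
        (j + 2) * (j + 3) * k.choose (j + 2 + 1) := by
      have e3 : k.choose (j + 1) * k ^ 2 = k * (k * k.choose (j + 1)) := by ring
      rw [e3, e1, mul_add, mul_left_comm, e1, mul_left_comm k, e2]
      ring
    exact_mod_cast this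
  simp_rw [h1]
  rw [gwSum_tsum]
  simp_rw [gwSum_const_mul, gwSum_add, gwSum_const_mul, gwSum_choose]
  set x := μ * n with hx
  have h2 : ∀ j : ℕ, ENNReal.ofReal (μ ^ j / j.factorial) *
      ((((j + 1) ^ 2 : ℕ) : ℝ≥0∞) * (n : ℝ≥0∞) ^ j +
        (((j + 2) * (2 * j + 3) : ℕ) : ℝ≥0∞) * (n : ℝ≥0∞) ^ (j + 1) +
        (((j + 2) * (j + 3) : ℕ) : ℝ≥0∞) * (n : ℝ≥0∞) ^ (j + 2)) =
      ENNReal.ofReal (x ^ j / j.factorial * (((j : ℝ) + 1) ^ 2 + (j + 2) * (2 * j + 3) * n +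
        (j + 2) * (j + 3) * n ^ 2)) := by
    intro j
    rw [ENNReal.ofReal_mul (by positivity), ← ofReal_pow_div_factorial_mul hμ, mul_assoc]
    congr 1
    rw [show ((j : ℝ) + 1) ^ 2 + (j + 2) * (2 * j + 3) * n + (j + 2) * (j + 3) * n ^ 2 =
      (((j + 1) ^ 2 + (j + 2) * (2 * j + 3) * n + (j + 2) * (j + 3) * n ^ 2 : ℕ) : ℝ) by
        push_cast; ring, ENNReal.ofReal_natCast]
    push_cast
    ring
  have h3 : HasSum (fun j : ℕ => x ^ j / j.factorial * (((j : ℝ) + 1) ^ 2 +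
      (j + 2) * (2 * j + 3) * n + (j + 2) * (j + 3) * n ^ 2))
      (Real.exp x * ((x ^ 2 + 3 * x + 1) + n * (2 * x ^ 2 + 9 * x + 6) +
        n ^ 2 * (x ^ 2 + 6 * x + 6))) := by
    -- The quadratic polynomial in j is expanded in the falling factorials 1, j and j(j-1).
    have a0 := (Real.hasSum_pow_div_factorial_mul_descFactorial x 0).mul_left
      (1 + 6 * (n : ℝ) + 6 * (n : ℝ) ^ 2)
    have a1 := (Real.hasSum_pow_div_factorial_mul_descFactorial x 1).mul_left
      (3 + 9 * (n : ℝ) + 6 * (n : ℝ) ^ 2)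
    have a2 := (Real.hasSum_pow_div_factorial_mul_descFactorial x 2).mul_left
      (1 + 2 * (n : ℝ) + (n : ℝ) ^ 2)
    convert! (a0.add a1).add a2 using 1
    · funext j
      have : ((j.descFactorial 2 : ℕ) : ℝ) = j * (j - 1) := by
        rcases j with _ | j
        · simp
        · simp [Nat.descFactorial_succ]
          ring
      rw [this]
      simp
      ring
    · ring
  simp_rw [h2]
  rw [← ENNReal.ofReal_tsum_of_nonneg (fun j => by positivity) h3.summable, h3.tsum_eq]

theorem harmonicWeight_zero (μ : ℝ) : harmonicWeight μ 0 = 0 := by simp [harmonicWeight]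

theorem harmonicWeight_pos {μ : ℝ} (hμ : 0 < μ) {k : ℕ} (hk : k ≠ 0) : 0 < harmonicWeight μ k := by
  refine Finset.sum_pos (fun j hj => ?_) (by simpa using hk)
  have hj := Finset.mem_range.1 hj
  have : 0 < k.choose (j + 1) := Nat.choose_pos (by omega)
  positivity

/-! ### Construction of the limit measure -/

/-- The probability that the ball of radius `r` of the local limit is `T`. -/
noncomputable def limitProb (μ : ℝ) (r : ℕ) (T : PlanarTree) : ℝ≥0∞ :=
  heightFugacity μ ^ (r - 1) * (gwWeight r T * ENNReal.ofReal (harmonicWeight μ (T.width r)))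

theorem gwWeight_ne_zero (r : ℕ) (T : PlanarTree) : gwWeight r T ≠ 0 := by
  unfold gwWeight
  simp

theorem gwWeight_ne_top (r : ℕ) (T : PlanarTree) : gwWeight r T ≠ ⊤ := by
  unfold gwWeight
  refine ENNReal.mul_ne_top (ENNReal.mul_ne_top (by simp) (by simp)) (by simp)

theorem limitProb_ne_top {μ : ℝ} (hμ : 0 < μ) (r : ℕ) (T : PlanarTree) : limitProb μ r T ≠ ⊤ :=
  ENNReal.mul_ne_top (ENNReal.pow_ne_top (heightFugacity_lt_one hμ).ne_top)
    (ENNReal.mul_ne_top (gwWeight_ne_top r T) ENNReal.ofReal_ne_top)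

theorem limitProb_eq_zero_iff {μ : ℝ} (hμ : 0 < μ) (r : ℕ) (T : PlanarTree) :
    limitProb μ r T = 0 ↔ T.width r = 0 := by
  constructor
  · intro h
    by_contra hne
    have h1 : ENNReal.ofReal (harmonicWeight μ (T.width r)) ≠ 0 :=
      (ENNReal.ofReal_pos.2 (harmonicWeight_pos hμ hne)).ne'
    exact mul_ne_zero (pow_ne_zero _ (heightFugacity_pos μ).ne')
      (mul_ne_zero (gwWeight_ne_zero r T) h1) h
  · intro h
    simp [limitProb, h, harmonicWeight_zero]

theorem heightFugacity_mul_exp (μ : ℝ) :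
    heightFugacity μ * ENNReal.ofReal (Real.exp μ) = 1 := by
  rw [heightFugacity, ← ENNReal.ofReal_mul (Real.exp_pos _).le, ← Real.exp_add]
  simp

/-- Consistency of the cylinder probabilities: the eigenvalue exp(μ) cancels one factor
`heightFugacity μ`. -/
theorem tsum_limitProb_extension {μ : ℝ} (hμ : 0 < μ) {r : ℕ} (hr : 1 ≤ r) {T : PlanarTree}
    (hT : ball r T = T) : ∑' U : Extension r T, limitProb μ (r + 1) U.1 = limitProb μ r T := by
  simp only [limitProb]
  rw [ENNReal.tsum_mul_left,
    tsum_gwWeight_extension hr hT fun b => ENNReal.ofReal (harmonicWeight μ b),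
    tsum_multichoose_mul_harmonicWeight hμ]
  obtain ⟨r, rfl⟩ : ∃ k, r = k + 1 := ⟨r - 1, by omega⟩
  simp only [Nat.add_sub_cancel]
  calc heightFugacity μ ^ (r + 1) * (gwWeight (r + 1) T * (ENNReal.ofReal (Real.exp μ) *
        ENNReal.ofReal (harmonicWeight μ (T.width (r + 1)))))
      = (heightFugacity μ * ENNReal.ofReal (Real.exp μ)) * (heightFugacity μ ^ r *
        (gwWeight (r + 1) T * ENNReal.ofReal (harmonicWeight μ (T.width (r + 1))))) := by ring
    _ = _ := by rw [heightFugacity_mul_exp, one_mul]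

theorem limitProb_edge (μ : ℝ) : limitProb μ 1 edge = 1 := by
  have h : gwWeight 1 edge = 1 := by
    rw [gwWeight, volume_edge, show edge.width 1 = 1 from rfl, pow_one, pow_one,
      show (2 : ℝ≥0∞) * 2 = 4 by norm_num]
    exact ENNReal.mul_inv_cancel (by norm_num) (by norm_num)
  rw [limitProb, h, show edge.width 1 = 1 from rfl]
  simp [harmonicWeight]

/-- The index set of all balls of positive radius. -/
abbrev BallIndex : Type := Σ n : ℕ, Ball (n + 1)

instance (r : ℕ) (T : PlanarTree) : MeasurableSpace (Extension r T) := ⊤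

instance (r : ℕ) (T : PlanarTree) : DiscreteMeasurableSpace (Extension r T) := ⟨fun _ => trivial⟩

/-- The law of the next level, given a ball of positive probability. -/
noncomputable def extensionPMF {μ : ℝ} (hμ : 0 < μ) (i : BallIndex)
    (h : limitProb μ (i.1 + 1) i.2.1 ≠ 0) : PMF (Extension (i.1 + 1) i.2.1) :=
  ⟨fun U => limitProb μ (i.1 + 1 + 1) U.1 / limitProb μ (i.1 + 1) i.2.1, by
    have : ∑' U : Extension (i.1 + 1) i.2.1,
        limitProb μ (i.1 + 1 + 1) U.1 / limitProb μ (i.1 + 1) i.2.1 = 1 := by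
      simp_rw [div_eq_mul_inv]
      rw [ENNReal.tsum_mul_right, tsum_limitProb_extension hμ (by omega) i.2.2,
        ENNReal.mul_inv_cancel h (limitProb_ne_top hμ _ _)]
    rw [← this]
    exact ENNReal.summable.hasSum⟩

open Classical in
/-- The law of the next level, given the ball (balls of probability zero are left unchanged). -/
noncomputable def stepPMF {μ : ℝ} (hμ : 0 < μ) (i : BallIndex) : PMF (Extension (i.1 + 1) i.2.1) :=
  if h : limitProb μ (i.1 + 1) i.2.1 = 0 then
    PMF.pure ⟨i.2.1, ball_eq_self_mono (by omega) (by omega) i.2.2, i.2.2⟩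
  else extensionPMF hμ i h

theorem stepPMF_apply {μ : ℝ} (hμ : 0 < μ) {i : BallIndex} (h : limitProb μ (i.1 + 1) i.2.1 ≠ 0)
    (U : Extension (i.1 + 1) i.2.1) :
    stepPMF hμ i U = limitProb μ (i.1 + 1 + 1) U.1 / limitProb μ (i.1 + 1) i.2.1 := by
  rw [stepPMF, dif_neg h]
  rfl

/-- Independent choices of an extension for every ball. -/
abbrev Choices : Type := ∀ i : BallIndex, Extension (i.1 + 1) i.2.1

/-- The law of the independent choices. -/
noncomputable def choicesMeasure {μ : ℝ} (hμ : 0 < μ) : Measure Choices :=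
  Measure.infinitePi fun i => (stepPMF hμ i).toMeasure

instance {μ : ℝ} (hμ : 0 < μ) : IsProbabilityMeasure (choicesMeasure hμ) := by
  unfold choicesMeasure
  infer_instance

/-- The ball of radius `n + 1` grown from the choices. -/
def grow (ω : Choices) : ∀ n : ℕ, Ball (n + 1)
  | 0 => ⟨edge, ball_one edge⟩
  | n + 1 => ⟨(ω ⟨n, grow ω n⟩).1, (ω ⟨n, grow ω n⟩).2.1⟩

theorem ball_grow_succ (ω : Choices) (n : ℕ) :
    ball (n + 1) (grow ω (n + 1)).1 = (grow ω n).1 :=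
  (ω ⟨n, grow ω n⟩).2.2

/-- The event that the choices along the balls of `T` produce the next ball of `T`. -/
def chosen (T : PlanarTree) (i : BallIndex) : Set (Extension (i.1 + 1) i.2.1) :=
  {U | U.1 = ball (i.1 + 1 + 1) T}

/-- The ball of radius `n + 1` as an index. -/
def ballIndex (T : PlanarTree) : ℕ ↪ BallIndex :=
  ⟨fun n => ⟨n, ball (n + 1) T, ball_ball le_rfl T⟩, fun _ _ h => congrArg Sigma.fst h⟩

/-- Growing into a prescribed ball constrains only the choices at finitely many distinct indices, so
its probability is a product, which telescopes in `choicesMeasure_grow_eq`. -/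
theorem grow_eq_iff (ω : Choices) (T : PlanarTree) (n : ℕ) :
    (grow ω n).1 = ball (n + 1) T ↔ ∀ k < n, ω (ballIndex T k) ∈ chosen T (ballIndex T k) := by
  induction n with
  | zero =>
    simp only [Nat.not_lt_zero, false_implies, implies_true, iff_true]
    exact (ball_one T).symm
  | succ n ih =>
    have key : (grow ω (n + 1)).1 = ball (n + 1 + 1) T ↔
        (grow ω n).1 = ball (n + 1) T ∧ ω (ballIndex T n) ∈ chosen T (ballIndex T n) := by
      constructor
      · intro h
        have h1 : (grow ω n).1 = ball (n + 1) T := by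
          rw [← ball_grow_succ, h, ball_ball (Nat.le_succ _)]
        have h2 : grow ω n = ⟨ball (n + 1) T, ball_ball le_rfl T⟩ := Subtype.ext h1
        refine ⟨h1, ?_⟩
        change (ω ⟨n, grow ω n⟩).1 = _ at h
        rw [h2] at h
        exact h
      · rintro ⟨h1, h2⟩
        have h3 : grow ω n = ⟨ball (n + 1) T, ball_ball le_rfl T⟩ := Subtype.ext h1
        change (ω ⟨n, grow ω n⟩).1 = _
        rw [h3]
        exact h2
    rw [key, ih]
    constructor
    · rintro ⟨h1, h2⟩ k hk
      rcases Nat.lt_succ_iff_lt_or_eq.1 hk with h | rfl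
      · exact h1 k h
      · exact h2
    · intro h
      exact ⟨fun k hk => h k (by omega), h n (by omega)⟩

theorem setOf_grow_eq (T : PlanarTree) (n : ℕ) :
    {ω : Choices | (grow ω n).1 = ball (n + 1) T} =
      Set.pi ((Finset.range n).map (ballIndex T) : Finset BallIndex) (chosen T) := by
  ext ω
  simp only [Set.mem_ofPred_eq, grow_eq_iff, Set.mem_pi, Finset.coe_map, Set.mem_image,
    Finset.coe_range, Set.mem_Iio, forall_exists_index, and_imp, forall_apply_eq_imp_iff₂]

theorem measurableSet_grow_eq (T : PlanarTree) (n : ℕ) :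
    MeasurableSet {ω : Choices | (grow ω n).1 = ball (n + 1) T} := by
  rw [setOf_grow_eq]
  exact MeasurableSet.pi (Finset.countable_toSet _) fun i _ => MeasurableSet.of_discrete

theorem choicesMeasure_grow_eq {μ : ℝ} (hμ : 0 < μ) (T : PlanarTree) (n : ℕ) :
    choicesMeasure hμ {ω : Choices | (grow ω n).1 = ball (n + 1) T} =
      limitProb μ (n + 1) (ball (n + 1) T) := by
  rw [setOf_grow_eq, choicesMeasure, Measure.infinitePi_pi _ fun i _ => MeasurableSet.of_discrete,
    Finset.prod_map]
  induction n with
  | zero => rw [Finset.prod_range_zero, zero_add, ball_one, limitProb_edge]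
  | succ n ih =>
    rw [Finset.prod_range_succ, ih]
    by_cases h : limitProb μ (n + 1) (ball (n + 1) T) = 0
    -- A ball of probability zero has an empty last level, hence so have its extensions; the default
    -- law in `stepPMF` plays no role.
    · rw [h, zero_mul, eq_comm, limitProb_eq_zero_iff hμ, width_ball_of_le T le_rfl]
      rw [limitProb_eq_zero_iff hμ, width_ball_of_le T le_rfl] at h
      exact width_succ_eq_zero h
    · have hs : chosen T (ballIndex T n) = {(⟨ball (n + 1 + 1) T, ball_ball le_rfl T,
          ball_ball (Nat.le_succ _) T⟩ : Extension ((ballIndex T n).1 + 1) (ballIndex T n).2.1)} := by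
        ext U
        rw [Set.mem_singleton_iff, Subtype.ext_iff]
        rfl
      rw [hs, PMF.toMeasure_apply_singleton _ _ (MeasurableSet.of_discrete), stepPMF_apply hμ h]
      exact ENNReal.mul_div_cancel h (limitProb_ne_top hμ _ _)

/-- A consistent sequence of balls is the sequence of balls of a tree. -/
theorem exists_forall_ball_eq (Y : ℕ → PlanarTree) (h0 : ∀ n, ball (n + 1) (Y n) = Y n)
    (h : ∀ n, ball (n + 1) (Y (n + 1)) = Y n) : ∃ T : PlanarTree, ∀ n, ball (n + 1) T = Y n := by
  have hb : ∀ m n, m ≤ n → ball (m + 1) (Y n) = Y m := by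
    intro m n hmn
    induction n, hmn using Nat.le_induction with
    | base => exact h0 m
    | succ n hmn ih => rw [← ih, ← h n, ball_ball (by omega)]
  have hw : ∀ m n s, s ≤ m + 1 → m ≤ n → (Y n).width s = (Y m).width s := by
    intro m n s hs hmn
    rw [← hb m n hmn, width_ball_of_le _ hs]
  let T : PlanarTree :=
    { width := fun s => (Y s).width s
      parent := fun s i => ((Y (s + 1)).parent s i).cast (hw s (s + 1) s (by omega) (by omega))
      parent_mono := fun s i j hij => (Y (s + 1)).parent_mono s hij
      width_zero := (Y 0).width_zero
      width_one := (Y 1).width_one }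
  refine ⟨T, fun n => eq_of_val (fun s => ?_) (fun s i h1 h2 => ?_)⟩
  · rw [width_ball]
    split_ifs with hs
    · change (Y s).width s = _
      rcases le_total s n with hsn | hsn
      · exact (hw s n s (by omega) hsn).symm
      · exact hw n s s (by omega) hsn
    · exact (width_eq_zero_of_le ((ball_eq_self_iff (by omega)).1 (h0 n)) (by omega)).symm
  · have hs := le_of_lt_ite h1
    change ((Y (s + 1)).parent s ⟨i, _⟩ : ℕ) = _
    rcases le_total (s + 1) n with hsn | hsn
    · have e := hb (s + 1) n hsn
      exact val_congr e.symm s i _ (by rw [e, hw (s + 1) n (s + 1) (by omega) hsn] at *; exact h2)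
    · have e := hb n (s + 1) hsn
      exact val_congr e s i (by rw [e]; exact h2) h2

/-- The infinite tree grown from the choices. -/
noncomputable def grownTree (ω : Choices) : PlanarTree :=
  (exists_forall_ball_eq (fun n => (grow ω n).1) (fun n => (grow ω n).2)
    (ball_grow_succ ω)).choose

theorem ball_grownTree (ω : Choices) (n : ℕ) : ball (n + 1) (grownTree ω) = (grow ω n).1 :=
  (exists_forall_ball_eq (fun n => (grow ω n).1) (fun n => (grow ω n).2)
    (ball_grow_succ ω)).choose_spec n

/-- The part of an open set that is a union of cylinders of radius `r`. -/
def cylinderPart (r : ℕ) (G : Set PlanarTree) : Set PlanarTree :=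
  {T | ∀ U, ball r U = ball r T → U ∈ G}

theorem cylinderPart_subset (r : ℕ) (G : Set PlanarTree) : cylinderPart r G ⊆ G :=
  fun T h => h T rfl

theorem cylinderPart_mono (G : Set PlanarTree) : Monotone fun r => cylinderPart r G :=
  fun _ _ hrs _ h U hU => h U (ball_eq_mono hrs hU)

/-- Every metric ball contains a cylinder, so open sets are exhausted by increasing countable unions
of cylinders. This serves both measurability and the weak limit. -/
theorem iUnion_cylinderPart {G : Set PlanarTree} (hG : IsOpen G) :
    ⋃ n : ℕ, cylinderPart (n + 1) G = G := by
  refine Set.Subset.antisymm (Set.iUnion_subset fun n => cylinderPart_subset _ _) fun T hT => ?_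
  obtain ⟨ε, hε, hball⟩ := Metric.isOpen_iff.1 hG T hT
  obtain ⟨n, hn⟩ := exists_nat_one_div_lt hε
  refine Set.mem_iUnion.2 ⟨n, fun U hU => hball (Metric.mem_ball.2 (dist_lt_iff.2 ?_))⟩
  exact ⟨n + 1, by omega, hU, by exact_mod_cast hn⟩

theorem cylinderPart_eq_iUnion (r : ℕ) (G : Set PlanarTree) :
    cylinderPart r G = ⋃ T : {T : Ball r // ∀ U, ball r U = T.1 → U ∈ G},
      {U | ball r U = T.1.1} := by
  ext T
  simp only [Set.mem_iUnion, Set.mem_ofPred_eq]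
  constructor
  · intro h
    exact ⟨⟨⟨ball r T, ball_ball le_rfl T⟩, h⟩, rfl⟩
  · rintro ⟨⟨V, hV⟩, hT⟩ U hU
    exact hV U (hU.trans hT)

theorem pairwise_disjoint_cylinder (r : ℕ) (p : Ball r → Prop) :
    Pairwise (Function.onFun Disjoint fun T : {T : Ball r // p T} =>
      {U : PlanarTree | ball r U = T.1.1}) := by
  intro S T hne
  refine Set.disjoint_left.2 fun U hS hT => hne ?_
  exact Subtype.ext (Subtype.ext (hS.symm.trans hT))

theorem measurable_grownTree : Measurable grownTree := by
  refine measurable_of_isOpen fun G hG => ?_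
  rw [← iUnion_cylinderPart hG, Set.preimage_iUnion]
  refine MeasurableSet.iUnion fun n => ?_
  rw [cylinderPart_eq_iUnion, Set.preimage_iUnion]
  refine MeasurableSet.iUnion fun T => ?_
  have : grownTree ⁻¹' {U | ball (n + 1) U = T.1.1} =
      {ω | (grow ω n).1 = ball (n + 1) T.1.1} := by
    ext ω
    simp only [Set.mem_preimage, Set.mem_ofPred_eq, ball_grownTree, T.1.2]
  rw [this]
  exact measurableSet_grow_eq _ n

/-- The local limit of the height weighted trees. -/
noncomputable def limitMeasure {μ : ℝ} (hμ : 0 < μ) : Measure PlanarTree :=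
  (choicesMeasure hμ).map grownTree

instance {μ : ℝ} (hμ : 0 < μ) : IsProbabilityMeasure (limitMeasure hμ) :=
  Measure.isProbabilityMeasure_map measurable_grownTree.aemeasurable

theorem limitMeasure_cylinder {μ : ℝ} (hμ : 0 < μ) {r : ℕ} (hr : 1 ≤ r) {T : PlanarTree}
    (hT : ball r T = T) : limitMeasure hμ {U | ball r U = T} = limitProb μ r T := by
  obtain ⟨n, rfl⟩ : ∃ n, r = n + 1 := ⟨r - 1, by omega⟩
  rw [limitMeasure, Measure.map_apply measurable_grownTree (measurableSet_cylinder _ _)]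
  have := choicesMeasure_grow_eq hμ T n
  rw [hT] at this
  rw [← this]
  congr 1
  ext ω
  simp only [Set.mem_preimage, Set.mem_ofPred_eq, ball_grownTree]

/-! ### Weak convergence to the limit measure -/

open PowerSeries in
theorem continuationSeries_eq {μ : ℝ} (k n : ℕ) :
    continuationSeries (heightFugacity μ) k n = ENNReal.ofReal (4 ^ n) *
      ∑' m : ℕ, ENNReal.ofReal (Real.exp (-μ * m) * coeff n (normSeries m ^ k)) := by
  rw [continuationSeries, ← ENNReal.tsum_mul_left]
  refine tsum_congr fun m => ?_
  rw [heightFugacity_pow, ← ENNReal.ofReal_natCast, ← ENNReal.ofReal_mul (Real.exp_pos _).le,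
    ← ENNReal.ofReal_mul (by positivity), coeff_normSeries_pow]
  congr 1
  have : (4 : ℝ) ^ n * (1 / 4) ^ n = 1 := by
    rw [← mul_pow]
    norm_num
  linear_combination (-(Real.exp (-μ * m) * continuations m k n)) * this

open PowerSeries in
theorem coeff_normSeries_le_two (m n : ℕ) : coeff n (normSeries m) ≤ 2 := by
  have h := le_hasSum (hasSum_coeff_normSeries m) n fun j _ => coeff_normSeries_nonneg m j
  refine h.trans ?_
  rw [div_le_iff₀ (by positivity)]
  linarith

theorem continuationSeries_one_ne_top {μ : ℝ} (hμ : 0 < μ) (n : ℕ) :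
    continuationSeries (heightFugacity μ) 1 n ≠ ⊤ := by
  rw [continuationSeries_eq]
  refine ENNReal.mul_ne_top ENNReal.ofReal_ne_top ?_
  have hx := heightFugacity_lt_one hμ
  refine ne_top_of_le_ne_top (b := ∑' m : ℕ, heightFugacity μ ^ m * 2) ?_
    (ENNReal.tsum_le_tsum fun m => ?_)
  · rw [ENNReal.tsum_mul_right, ENNReal.tsum_geometric]
    refine ENNReal.mul_ne_top (ENNReal.inv_ne_top.2 (tsub_pos_of_lt hx).ne') (by simp)
  · rw [heightFugacity_pow, ENNReal.ofReal_mul (Real.exp_pos _).le, pow_one]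
    gcongr
    rw [← ENNReal.ofReal_ofNat]
    exact ENNReal.ofReal_le_ofReal (coeff_normSeries_le_two m n)

theorem continuationSeries_one_ne_zero (μ : ℝ) (n : ℕ) :
    continuationSeries (heightFugacity μ) 1 n ≠ 0 := by
  rw [continuationSeries_eq]
  refine mul_ne_zero (ENNReal.ofReal_pos.2 (by positivity)).ne' fun h => ?_
  have h1 := ENNReal.tsum_eq_zero.1 h 1
  rw [ENNReal.ofReal_eq_zero, pow_one, coeff_normSeries_eq le_rfl] at h1
  have h2 : 0 < leadingWeight 1 := lt_of_lt_of_le (by positivity) (le_leadingWeight 1)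
  have h3 : 0 < leadingRatio 1 := by
    unfold leadingRatio
    norm_num [Real.cos_pi_div_three]
  have h4 := remainder_nonneg 1 n
  have h5 := Real.exp_pos (-μ * (1 : ℕ))
  have : 0 < Real.exp (-μ * (1 : ℕ)) *
      (leadingWeight 1 * leadingRatio 1 ^ n + remainder 1 n) := by positivity
  linarith

theorem isProbabilityMeasure_finiteSizeMeasure {μ : ℝ} (hμ : 0 < μ) {N : ℕ} (hN : 1 ≤ N) :
    IsProbabilityMeasure (finiteSizeMeasure μ N) := by
  refine ⟨?_⟩
  have hx1 : 1 - heightFugacity μ ≠ 0 := (tsub_pos_of_lt (heightFugacity_lt_one hμ)).ne'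
  have hx2 : 1 - heightFugacity μ ≠ ⊤ := ne_top_of_le_ne_top ENNReal.one_ne_top tsub_le_self
  have hZ := partitionFunction_eq hμ hN
  have hZ0 : partitionFunction μ N ≠ 0 := by
    rw [hZ]
    exact mul_ne_zero hx1 (mul_ne_zero (heightFugacity_pos μ).ne'
      (continuationSeries_one_ne_zero μ _))
  have hZt : partitionFunction μ N ≠ ⊤ := by
    rw [hZ]
    exact ENNReal.mul_ne_top hx2 (ENNReal.mul_ne_top (heightFugacity_lt_one hμ).ne_top
      (continuationSeries_one_ne_top hμ _))
  rw [finiteSizeMeasure_apply μ N MeasurableSet.univ]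
  simp only [Set.mem_univ, and_true]
  have h1 : ∑' U : PlanarTree, {U : PlanarTree | U.size = (N : ℕ∞)}.indicator (weight μ) U =
      partitionFunction μ N :=
    (tsum_subtype {T : PlanarTree | T.size = (N : ℕ∞)} (weight μ)).symm
  rw [h1, ENNReal.div_self hZ0 hZt]

theorem one_le_volume {r : ℕ} (hr : 1 ≤ r) (T : PlanarTree) : 1 ≤ T.volume r := by
  rw [volume]
  have := Finset.single_le_sum (f := fun s => T.width (s + 1)) (fun _ _ => Nat.zero_le _)
    (Finset.mem_range.2 hr)
  simpa [T.width_one] using this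

theorem gwWeight_eq_ofReal {r : ℕ} (T : PlanarTree) (hw : T.width r ≠ 0) (hv : 1 ≤ T.volume r) :
    gwWeight r T = ENNReal.ofReal (2 ^ (T.width r - 1) * (4⁻¹) ^ (T.volume r - 1)) := by
  obtain ⟨a, ha⟩ : ∃ a, T.width r = a + 1 := ⟨T.width r - 1, by omega⟩
  obtain ⟨b, hb⟩ : ∃ b, T.volume r = b + 1 := ⟨T.volume r - 1, by omega⟩
  rw [gwWeight, ha, hb, ENNReal.ofReal_mul (by positivity), ENNReal.ofReal_pow (by positivity),
    ENNReal.ofReal_pow (by positivity), ENNReal.ofReal_inv_of_pos (by norm_num),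
    ENNReal.ofReal_ofNat, ENNReal.ofReal_ofNat, Nat.add_sub_cancel, Nat.add_sub_cancel]
  have h4 : (2 : ℝ≥0∞) * 2 * 4⁻¹ = 1 := by
    rw [show (2 : ℝ≥0∞) * 2 = 4 by norm_num]
    exact ENNReal.mul_inv_cancel (by norm_num) (by norm_num)
  calc (2 : ℝ≥0∞) * 2 ^ (a + 1) * 4⁻¹ ^ (b + 1) = 2 ^ a * 4⁻¹ ^ b * (2 * 2 * 4⁻¹) := by ring
    _ = _ := by rw [h4, mul_one]

/-- Fatou bound for the finite size measures on cylinders. -/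
theorem limitProb_le_liminf {μ : ℝ} (hμ : 0 < μ) {r : ℕ} (hr : 1 ≤ r) {T : PlanarTree}
    (hT : ball r T = T) :
    limitProb μ r T ≤ liminf (fun N : ℕ => finiteSizeMeasure μ (N + 1) {U | ball r U = T})
      atTop := by
  by_cases hw : T.width r = 0
  · rw [(limitProb_eq_zero_iff hμ r T).2 hw]
    exact zero_le
  set K := T.width r with hK
  -- With total size n + 1, the ball leaves n - s edges to be placed, while the partition function
  -- refers to n edges above the first one.
  set s := T.volume r - 1 with hs
  have hv := one_le_volume hr T
  set x := heightFugacity μ with hx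
  have hx0 : x ^ (r - 1) ≠ 0 := pow_ne_zero _ (heightFugacity_pos μ).ne'
  have hxt : x ^ (r - 1) ≠ ⊤ := ENNReal.pow_ne_top (heightFugacity_lt_one hμ).ne_top
  have hΦ := harmonicWeight_pos hμ hw
  have hp : limitProb μ r T =
      x ^ (r - 1) * ENNReal.ofReal (4⁻¹ ^ s * (2 ^ (K - 1) * harmonicWeight μ K)) := by
    rw [limitProb, gwWeight_eq_ofReal T hw hv, ← ENNReal.ofReal_mul (by positivity)]
    congr 2
    ring
  have key : ∀ c : ℝ, 0 ≤ c → c < 2 ^ (K - 1) * harmonicWeight μ K →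
      x ^ (r - 1) * ENNReal.ofReal (4⁻¹ ^ s * c) ≤
        liminf (fun N : ℕ => finiteSizeMeasure μ (N + 1) {U | ball r U = T}) atTop := by
    intro c hc0 hc
    refine le_liminf_of_le (by isBoundedDefault) ?_
    filter_upwards [eventually_le_tsum_coeff_pow hμ K s hc0 hc, eventually_ge_atTop s] with n h1 h2
    rw [finiteSizeMeasure_cylinder hμ hr hT hw (by omega) (by omega)]
    refine mul_le_mul_right ?_ _
    rw [ENNReal.le_div_iff_mul_le (Or.inl (continuationSeries_one_ne_zero μ _))
      (Or.inl (continuationSeries_one_ne_top hμ _)), show n + 1 - 1 = n by omega,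
      show n + 1 - T.volume r = n - s by omega, continuationSeries_eq, continuationSeries_eq]
    simp only [pow_one]
    have e : (4 : ℝ) ^ n * 4⁻¹ ^ s = 4 ^ (n - s) := by
      rw [inv_pow, ← div_eq_mul_inv, pow_sub₀ _ (by norm_num) h2, div_eq_mul_inv]
    calc _ = ENNReal.ofReal (4 ^ n * 4⁻¹ ^ s) * (ENNReal.ofReal c *
          ∑' m : ℕ, ENNReal.ofReal (Real.exp (-μ * m) * PowerSeries.coeff n (normSeries m))) := by
          rw [ENNReal.ofReal_mul (by positivity), ENNReal.ofReal_mul (by positivity)]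
          ring
      _ ≤ _ := by
          rw [e]
          exact mul_le_mul_right h1 _
  rw [hp]
  set w := 2 ^ (K - 1) * harmonicWeight μ K with hwdef
  have hw0 : 0 < w := by positivity
  -- The eventual bound is available only for constants strictly below w, so w is approached from
  -- the left.
  have hlim : Tendsto (fun c : ℝ => x ^ (r - 1) * ENNReal.ofReal (4⁻¹ ^ s * c)) (𝓝[<] w)
      (𝓝 (x ^ (r - 1) * ENNReal.ofReal (4⁻¹ ^ s * w))) := by
    refine ENNReal.Tendsto.const_mul ?_ (Or.inr hxt)
    refine (ENNReal.tendsto_ofReal ?_)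
    exact ((continuous_const.mul continuous_id).tendsto w).mono_left nhdsWithin_le_nhds
  refine le_of_tendsto hlim ?_
  filter_upwards [self_mem_nhdsWithin, nhdsWithin_le_nhds (lt_mem_nhds hw0)] with c h1 h2
  exact key c (le_of_lt h2) h1

theorem measure_cylinderPart (ν : Measure PlanarTree) (r : ℕ) (G : Set PlanarTree) :
    ν (cylinderPart r G) = ∑' T : {T : Ball r // ∀ U, ball r U = T.1 → U ∈ G},
      ν {U | ball r U = T.1.1} := by
  rw [cylinderPart_eq_iUnion, measure_iUnion (pairwise_disjoint_cylinder r _)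
    fun T => measurableSet_cylinder r _]

/-- Fatou's lemma for counting measure. -/
theorem tsum_liminf_le {ι : Type*} [Countable ι] (f : ℕ → ι → ℝ≥0∞) :
    ∑' i, liminf (fun n => f n i) atTop ≤ liminf (fun n => ∑' i, f n i) atTop := by
  let _ : MeasurableSpace ι := ⊤
  have : MeasurableSingletonClass ι := ⟨fun _ => trivial⟩
  have h := lintegral_liminf_le (u := atTop) (μ := Measure.count) (f := f) fun n => measurable_from_top
  simpa only [lintegral_count] using h

theorem limitMeasure_le_liminf {μ : ℝ} (hμ : 0 < μ) {G : Set PlanarTree} (hG : IsOpen G) :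
    limitMeasure hμ G ≤ liminf (fun N : ℕ => finiteSizeMeasure μ (N + 1) G) atTop := by
  conv_lhs => rw [← iUnion_cylinderPart hG]
  rw [Monotone.measure_iUnion fun m n h => cylinderPart_mono G (Nat.succ_le_succ h)]
  refine iSup_le fun n => ?_
  rw [measure_cylinderPart]
  calc _ ≤ ∑' T : {T : Ball (n + 1) // ∀ U, ball (n + 1) U = T.1 → U ∈ G},
        liminf (fun N : ℕ => finiteSizeMeasure μ (N + 1) {U | ball (n + 1) U = T.1.1}) atTop := by
        refine ENNReal.tsum_le_tsum fun T => ?_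
        rw [limitMeasure_cylinder hμ (by omega) T.1.2]
        exact limitProb_le_liminf hμ (by omega) T.1.2
    _ ≤ _ := tsum_liminf_le _
    _ ≤ _ := by
        refine liminf_le_liminf (Eventually.of_forall fun N => ?_)
        rw [← measure_cylinderPart]
        exact measure_mono (cylinderPart_subset _ _)

theorem isLocalLimit_limitMeasure {μ : ℝ} (hμ : 0 < μ) : IsLocalLimit μ (limitMeasure hμ) := by
  refine ⟨inferInstance, fun F => ?_⟩
  let ν : ProbabilityMeasure PlanarTree := ⟨limitMeasure hμ, inferInstance⟩
  let νs : ℕ → ProbabilityMeasure PlanarTree := fun N =>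
    ⟨finiteSizeMeasure μ (N + 1), isProbabilityMeasure_finiteSizeMeasure hμ (by omega)⟩
  have h : Tendsto νs atTop (𝓝 ν) :=
    tendsto_of_forall_isOpen_le_liminf' fun G hG => limitMeasure_le_liminf hμ hG
  rw [ProbabilityMeasure.tendsto_iff_forall_integral_tendsto] at h
  -- The sizes are shifted by one because there is no tree of size 0, so that `finiteSizeMeasure μ
  -- 0` is not a probability measure.
  exact (tendsto_add_atTop_iff_nat (f := fun N => ∫ T, F T ∂(finiteSizeMeasure μ N)) 1).1 (h F)

/-! ### Mean square estimates for widths and volumes -/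

theorem measurable_width (r : ℕ) : Measurable fun T : PlanarTree => T.width r := by
  refine measurable_to_countable' fun k => IsOpen.measurableSet ?_
  rw [isOpen_iff_forall_mem_open]
  intro T hT
  refine ⟨{U | ball r U = ball r T}, fun U hU => ?_, isOpen_cylinder r _, rfl⟩
  have hU' : ball r U = ball r T := hU
  rw [Set.mem_preimage, Set.mem_singleton_iff] at hT ⊢
  rw [← hT, ← width_ball_of_le U le_rfl, hU', width_ball_of_le T le_rfl]

theorem lintegral_width {μ : ℝ} (hμ : 0 < μ) (n : ℕ) (F : ℕ → ℝ≥0∞) :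
    ∫⁻ T, F (T.width (n + 1)) ∂(limitMeasure hμ) = heightFugacity μ ^ n *
      gwSum (n + 1) (fun k => ENNReal.ofReal (harmonicWeight μ k) * F k) := by
  have huniv : (Set.univ : Set PlanarTree) =
      ⋃ T : Ball (n + 1), {U | ball (n + 1) U = T.1} := by
    ext U
    simp only [Set.mem_univ, Set.mem_iUnion, Set.mem_ofPred_eq, true_iff]
    exact ⟨⟨ball (n + 1) U, ball_ball le_rfl U⟩, rfl⟩
  rw [← setLIntegral_univ, huniv, lintegral_iUnion (fun T => measurableSet_cylinder _ _)
    (fun S T hne => Set.disjoint_left.2 fun U hS hT =>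
      hne (Subtype.ext ((Eq.symm hS).trans hT))), gwSum, ← ENNReal.tsum_mul_left]
  refine tsum_congr fun T => ?_
  have h : ∀ U ∈ {U : PlanarTree | ball (n + 1) U = T.1},
      F (U.width (n + 1)) = F (T.1.width (n + 1)) := by
    intro U hU
    rw [← width_ball_of_le U le_rfl, show ball (n + 1) U = T.1 from hU]
  rw [setLIntegral_congr_fun (measurableSet_cylinder _ _) h, setLIntegral_const,
    limitMeasure_cylinder hμ (by omega) T.2, limitProb, Nat.add_sub_cancel]
  ring

theorem heightFugacity_pow_mul_ofReal (μ : ℝ) (n : ℕ) (a : ℝ) :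
    heightFugacity μ ^ n * ENNReal.ofReal (Real.exp (μ * n) * a) = ENNReal.ofReal a := by
  rw [heightFugacity_pow, ← ENNReal.ofReal_mul (Real.exp_pos _).le, ← mul_assoc, ← Real.exp_add]
  simp

/-- The mean square deviation of the width at height `n + 1` from `μ n²`. -/
theorem lintegral_width_sub_sq {μ : ℝ} (hμ : 0 < μ) (n : ℕ) :
    ∫⁻ T, ENNReal.ofReal (((T.width (n + 1) : ℝ) - μ * n ^ 2) ^ 2) ∂(limitMeasure hμ) =
      ENNReal.ofReal (2 * μ * n ^ 3 + (6 + 7 * μ + μ ^ 2) * n ^ 2 + (6 + 3 * μ) * n + 1) := by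
  set a : ℝ := μ * n ^ 2 with ha
  have ha0 : 0 ≤ a := by positivity
  have h1 := lintegral_width hμ n fun k => (k : ℝ≥0∞)
  rw [gwSum_harmonicWeight_mul_width hμ, heightFugacity_pow_mul_ofReal] at h1
  have h2 := lintegral_width hμ n fun k => (k : ℝ≥0∞) ^ 2
  rw [gwSum_harmonicWeight_mul_width_sq hμ, heightFugacity_pow_mul_ofReal] at h2
  have hmeas : Measurable fun T : PlanarTree => (T.width (n + 1) : ℝ≥0∞) :=
    measurable_from_top.comp (measurable_width (n + 1))
  -- The square is expanded with the cross term moved to the left, so that all terms are nonnegative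
  -- and no truncated subtraction occurs under the integral.
  have hpt : ∀ T : PlanarTree, ENNReal.ofReal (((T.width (n + 1) : ℝ) - a) ^ 2) +
      ENNReal.ofReal (2 * a) * (T.width (n + 1) : ℝ≥0∞) =
      (T.width (n + 1) : ℝ≥0∞) ^ 2 + ENNReal.ofReal (a ^ 2) := by
    intro T
    rw [← ENNReal.ofReal_natCast, ← ENNReal.ofReal_mul (by positivity),
      ← ENNReal.ofReal_add (by positivity) (by positivity), ← ENNReal.ofReal_pow (by positivity),
      ← ENNReal.ofReal_add (by positivity) (by positivity)]
    congr 1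
    ring
  have hint : ∫⁻ T, ENNReal.ofReal (((T.width (n + 1) : ℝ) - a) ^ 2) ∂(limitMeasure hμ) +
      ENNReal.ofReal (2 * a) * ∫⁻ T, (T.width (n + 1) : ℝ≥0∞) ∂(limitMeasure hμ) =
      ∫⁻ T, (T.width (n + 1) : ℝ≥0∞) ^ 2 ∂(limitMeasure hμ) + ENNReal.ofReal (a ^ 2) := by
    rw [← lintegral_const_mul _ hmeas, ← lintegral_add_right _ (hmeas.const_mul _)]
    simp_rw [hpt]
    rw [lintegral_add_right _ measurable_const, lintegral_const, measure_univ, mul_one]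
  rw [h1, h2, ← ENNReal.ofReal_mul (by positivity),
    ← ENNReal.ofReal_add (by positivity) (by positivity)] at hint
  have hfin := ENNReal.eq_sub_of_add_eq ENNReal.ofReal_ne_top hint
  rw [hfin, ← ENNReal.ofReal_sub _ (by positivity)]
  congr 1
  rw [ha]
  ring

/-- Cauchy–Schwarz over the R levels costs a factor R, and each of the R levels contributes O(R³).
No information on correlations between levels is used. -/
theorem exists_lintegral_volume_sub_sq_le {μ : ℝ} (hμ : 0 < μ) :
    ∃ C : ℝ, 0 < C ∧ ∀ R : ℕ, ∫⁻ T, ENNReal.ofReal (((T.volume R : ℝ) -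
      ∑ s ∈ Finset.range R, μ * (s : ℝ) ^ 2) ^ 2) ∂(limitMeasure hμ) ≤
        ENNReal.ofReal (C * R ^ 5) := by
  set C := 2 * μ + (6 + 7 * μ + μ ^ 2) + (6 + 3 * μ) + 1 with hC
  have hC0 : 0 < C := by positivity
  refine ⟨C, hC0, fun R => ?_⟩
  have hmeas : ∀ s : ℕ, Measurable fun T : PlanarTree =>
      ENNReal.ofReal (((T.width (s + 1) : ℝ) - μ * s ^ 2) ^ 2) := fun s =>
    (measurable_from_top (f := fun k : ℕ => ENNReal.ofReal (((k : ℝ) - μ * s ^ 2) ^ 2))).comp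
      (measurable_width (s + 1))
  have hpt : ∀ T : PlanarTree, ENNReal.ofReal (((T.volume R : ℝ) -
      ∑ s ∈ Finset.range R, μ * (s : ℝ) ^ 2) ^ 2) ≤ (R : ℝ≥0∞) *
      ∑ s ∈ Finset.range R, ENNReal.ofReal (((T.width (s + 1) : ℝ) - μ * s ^ 2) ^ 2) := by
    intro T
    rw [← ENNReal.ofReal_sum_of_nonneg fun s _ => sq_nonneg _, ← ENNReal.ofReal_natCast R,
      ← ENNReal.ofReal_mul (by positivity)]
    refine ENNReal.ofReal_le_ofReal ?_
    have := sq_sum_le_card_mul_sum_sq (s := Finset.range R)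
      (f := fun s : ℕ => (T.width (s + 1) : ℝ) - μ * s ^ 2)
    rw [Finset.card_range, Finset.sum_sub_distrib] at this
    rw [volume]
    push_cast
    exact this
  calc _ ≤ ∫⁻ T, (R : ℝ≥0∞) * ∑ s ∈ Finset.range R,
        ENNReal.ofReal (((T.width (s + 1) : ℝ) - μ * s ^ 2) ^ 2) ∂(limitMeasure hμ) :=
        lintegral_mono hpt
    _ = (R : ℝ≥0∞) * ∑ s ∈ Finset.range R, ENNReal.ofReal
        (2 * μ * s ^ 3 + (6 + 7 * μ + μ ^ 2) * s ^ 2 + (6 + 3 * μ) * s + 1) := by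
        rw [lintegral_const_mul _ (Finset.measurable_sum _ fun s _ => hmeas s),
          lintegral_finsetSum _ fun s _ => hmeas s]
        simp_rw [lintegral_width_sub_sq hμ]
    _ ≤ (R : ℝ≥0∞) * ∑ s ∈ Finset.range R, ENNReal.ofReal (C * R ^ 3) := by
        gcongr with s hs
        have hs := Finset.mem_range.1 hs
        have hsR : (s : ℝ) ≤ R := by exact_mod_cast hs.le
        have h1R : (1 : ℝ) ≤ R := by exact_mod_cast (show 1 ≤ R by omega)
        have e3 : (s : ℝ) ^ 3 ≤ (R : ℝ) ^ 3 := by gcongr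
        have e2 : (s : ℝ) ^ 2 ≤ (R : ℝ) ^ 3 := by
          calc (s : ℝ) ^ 2 ≤ (R : ℝ) ^ 2 := by gcongr
            _ ≤ (R : ℝ) ^ 3 := pow_le_pow_right₀ h1R (by norm_num)
        have e1 : (s : ℝ) ≤ R ^ 3 := hsR.trans (le_self_pow₀ h1R (by norm_num))
        have e0 : (1 : ℝ) ≤ R ^ 3 := one_le_pow₀ h1R
        calc 2 * μ * (s : ℝ) ^ 3 + (6 + 7 * μ + μ ^ 2) * s ^ 2 + (6 + 3 * μ) * s + 1
            ≤ 2 * μ * R ^ 3 + (6 + 7 * μ + μ ^ 2) * R ^ 3 + (6 + 3 * μ) * R ^ 3 + R ^ 3 := by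
              gcongr
          _ = C * R ^ 3 := by rw [hC]; ring
    _ = ENNReal.ofReal (C * R ^ 5) := by
        rw [Finset.sum_const, Finset.card_range, nsmul_eq_mul, ← ENNReal.ofReal_natCast R,
          ← ENNReal.ofReal_mul (by positivity), ← ENNReal.ofReal_mul (by positivity)]
        congr 1
        ring

theorem sum_sq_le (R : ℕ) : ∑ s ∈ Finset.range R, (s : ℝ) ^ 2 ≤ (R : ℝ) ^ 3 := by
  calc ∑ s ∈ Finset.range R, (s : ℝ) ^ 2 ≤ ∑ s ∈ Finset.range R, (R : ℝ) ^ 2 := by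
        gcongr with s hs
        exact (Finset.mem_range.1 hs).le
    _ = _ := by
        rw [Finset.sum_const, Finset.card_range, nsmul_eq_mul]
        ring

theorem le_sum_sq {R : ℕ} (hR : 2 ≤ R) :
    (R : ℝ) ^ 3 / 8 ≤ ∑ s ∈ Finset.range R, (s : ℝ) ^ 2 := by
  induction R, hR using Nat.le_induction with
  | base => norm_num [Finset.sum_range_succ]
  | succ R hR ih =>
    rw [Finset.sum_range_succ]
    have : (2 : ℝ) ≤ R := by exact_mod_cast hR
    push_cast
    nlinarith

theorem volume_mono (T : PlanarTree) : Monotone fun r => T.volume r :=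
  monotone_nat_of_le_succ fun r => by
    rw [volume_succ]
    omega

/-! ### Almost sure growth and the dimension -/

/-- Almost surely, the volume at dyadic radii is close to its mean. -/
theorem ae_eventually_volume_two_pow {μ : ℝ} (hμ : 0 < μ) :
    ∀ᵐ T ∂(limitMeasure hμ), ∀ᶠ k : ℕ in atTop,
      μ / 16 * ((2 : ℝ) ^ k) ^ 3 ≤ T.volume (2 ^ k) ∧
        (T.volume (2 ^ k) : ℝ) ≤ 2 * μ * ((2 : ℝ) ^ k) ^ 3 := by
  obtain ⟨C, hC0, hC⟩ := exists_lintegral_volume_sub_sq_le hμ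
  set f : ℕ → PlanarTree → ℝ≥0∞ := fun R T => ENNReal.ofReal (((T.volume R : ℝ) -
      ∑ s ∈ Finset.range R, μ * (s : ℝ) ^ 2) ^ 2) with hf
  -- The mean Σ μs² lies between μR³/8 and μR³, so a deviation of μR³/16 is affordable. Chebyshev
  -- then gives a bound of order R^5/R^6, summable along R = 2^k.
  set ε : ℕ → ℝ≥0∞ := fun R => ENNReal.ofReal ((μ / 16 * (R : ℝ) ^ 3) ^ 2) with hε
  have hfm : ∀ R, Measurable (f R) := by
    intro R
    have : Measurable fun T : PlanarTree => T.volume R :=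
      Finset.measurable_sum _ fun s _ => measurable_width (s + 1)
    exact (measurable_from_top (f := fun v : ℕ => ENNReal.ofReal (((v : ℝ) -
      ∑ s ∈ Finset.range R, μ * (s : ℝ) ^ 2) ^ 2))).comp this
  have hbound : ∀ k : ℕ, limitMeasure hμ {T | ε (2 ^ k) ≤ f (2 ^ k) T} ≤
      ENNReal.ofReal (C / (μ / 16) ^ 2 * (1 / 2) ^ k) := by
    intro k
    have hpos : (0 : ℝ) < ((2 ^ k : ℕ) : ℝ) := by positivity
    refine (meas_ge_le_lintegral_div (hfm _).aemeasurable
      (ENNReal.ofReal_pos.2 (by positivity)).ne' ENNReal.ofReal_ne_top).trans ?_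
    refine (ENNReal.div_le_div_right (hC _) _).trans ?_
    rw [← ENNReal.ofReal_div_of_pos (by positivity)]
    refine ENNReal.ofReal_le_ofReal (le_of_eq ?_)
    push_cast
    field_simp
    rw [← mul_pow]
    norm_num
  have hsum : ∑' k : ℕ, limitMeasure hμ {T | ε (2 ^ k) ≤ f (2 ^ k) T} ≠ ⊤ := by
    refine ne_top_of_le_ne_top ?_ (ENNReal.tsum_le_tsum hbound)
    have hs : Summable fun k : ℕ => C / (μ / 16) ^ 2 * (1 / 2 : ℝ) ^ k :=
      summable_geometric_two.mul_left _
    rw [← ENNReal.ofReal_tsum_of_nonneg (fun k => by positivity) hs]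
    exact ENNReal.ofReal_ne_top
  filter_upwards [ae_eventually_notMem hsum] with T hT
  filter_upwards [hT, eventually_ge_atTop 1] with k hk hk1
  set R := 2 ^ k with hR
  have hR2 : 2 ≤ R := by
    calc 2 = 2 ^ 1 := rfl
      _ ≤ 2 ^ k := Nat.pow_le_pow_right (by norm_num) hk1
  have hRr : ((2 : ℝ) ^ k) = (R : ℝ) := by rw [hR]; push_cast; rfl
  rw [hRr]
  have hlt : ((T.volume R : ℝ) - ∑ s ∈ Finset.range R, μ * (s : ℝ) ^ 2) ^ 2 <
      (μ / 16 * (R : ℝ) ^ 3) ^ 2 := by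
    by_contra hge
    exact hk (ENNReal.ofReal_le_ofReal (not_lt.1 hge))
  have habs := abs_lt_of_sq_lt_sq hlt (by positivity)
  rw [← Finset.mul_sum, abs_lt] at habs
  have h1 := mul_le_mul_of_nonneg_left (sum_sq_le R) hμ.le
  have h2 := mul_le_mul_of_nonneg_left (le_sum_sq hR2) hμ.le
  have h3 : 0 < μ * (R : ℝ) ^ 3 := by
    have : (0 : ℝ) < R := by exact_mod_cast (show 0 < R by omega)
    positivity
  constructor <;> linarith [habs.1, habs.2]

/-- Almost surely, the volume of balls grows cubically. -/
theorem ae_volume_growth {μ : ℝ} (hμ : 0 < μ) :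
    ∀ᵐ T ∂(limitMeasure hμ), ∃ r₀ : ℕ, ∀ r : ℕ, r₀ ≤ r →
      μ / 128 * (r : ℝ) ^ 3 ≤ (ballVolume r T : ℝ) ∧
        (ballVolume r T : ℝ) ≤ 16 * μ * (r : ℝ) ^ 3 := by
  filter_upwards [ae_eventually_volume_two_pow hμ] with T hT
  obtain ⟨k₀, hk₀⟩ := eventually_atTop.1 hT
  refine ⟨2 ^ k₀, fun r hr => ?_⟩
  have hr1 : 1 ≤ r := le_trans Nat.one_le_two_pow hr
  have hk : k₀ ≤ Nat.log 2 r := Nat.le_log_of_pow_le (by norm_num) hr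
  set k := Nat.log 2 r with hkdef
  have h1 : 2 ^ k ≤ r := Nat.pow_log_le_self 2 (by omega)
  have h2 : r < 2 ^ (k + 1) := Nat.lt_pow_succ_log_self (by norm_num) r
  have h1' : (2 : ℝ) ^ k ≤ r := by exact_mod_cast h1
  have h2' : (r : ℝ) ≤ 2 * 2 ^ k := by
    have : (r : ℝ) ≤ 2 ^ (k + 1) := by exact_mod_cast h2.le
    linarith [pow_succ (2 : ℝ) k]
  have hlow := (hk₀ k hk).1
  have hup := (hk₀ (k + 1) (by omega)).2
  have hv1 : (T.volume (2 ^ k) : ℝ) ≤ T.volume r := by exact_mod_cast volume_mono T h1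
  have hv2 : (T.volume r : ℝ) ≤ T.volume (2 ^ (k + 1)) := by exact_mod_cast volume_mono T h2.le
  rw [ballVolume_eq hr1]
  -- Passing from r to the neighbouring powers of 2 costs a factor 8 on each side: μ/16 becomes
  -- μ/128 and 2μ becomes 16μ.
  have hc1 : (r : ℝ) ^ 3 ≤ 8 * ((2 : ℝ) ^ k) ^ 3 := by
    calc (r : ℝ) ^ 3 ≤ (2 * 2 ^ k) ^ 3 := by gcongr
      _ = _ := by ring
  have hc2 : ((2 : ℝ) ^ (k + 1)) ^ 3 ≤ 8 * (r : ℝ) ^ 3 := by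
    calc ((2 : ℝ) ^ (k + 1)) ^ 3 = 8 * ((2 : ℝ) ^ k) ^ 3 := by ring
      _ ≤ _ := by gcongr
  constructor
  · nlinarith
  · nlinarith

/-- Cubic volume growth implies that the volume growth exponent is `3`. -/
theorem hasHausdorffDim_three {T : PlanarTree} {C₁ C₂ : ℝ} (hC₁ : 0 < C₁) (hC₂ : 0 < C₂) {r₀ : ℕ}
    (h : ∀ r : ℕ, r₀ ≤ r → C₁ * (r : ℝ) ^ 3 ≤ (ballVolume r T : ℝ) ∧
      (ballVolume r T : ℝ) ≤ C₂ * (r : ℝ) ^ 3) : HasHausdorffDim T 3 := by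
  have hlog : Tendsto (fun r : ℕ => Real.log (r : ℝ)) atTop atTop :=
    Real.tendsto_log_atTop.comp tendsto_natCast_atTop_atTop
  have hlim : ∀ C : ℝ, Tendsto (fun r : ℕ => Real.log C / Real.log (r : ℝ) + 3) atTop (𝓝 3) := by
    intro C
    have := (hlog.const_div_atTop (Real.log C)).add_const 3
    rwa [zero_add] at this
  have hval : ∀ C : ℝ, 0 < C → ∀ r : ℕ, 2 ≤ r →
      Real.log (C * (r : ℝ) ^ 3) / Real.log r = Real.log C / Real.log (r : ℝ) + 3 := by
    intro C hC r hr
    have hr1 : (1 : ℝ) < r := by exact_mod_cast (show 1 < r by omega)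
    have hl := Real.log_pos hr1
    rw [Real.log_mul hC.ne' (by positivity), Real.log_pow]
    field_simp
    push_cast
    ring
  refine tendsto_of_tendsto_of_tendsto_of_le_of_le' (hlim C₁) (hlim C₂) ?_ ?_
  · filter_upwards [eventually_ge_atTop r₀, eventually_ge_atTop 2] with r hr hr2
    have hr1 : (1 : ℝ) < r := by exact_mod_cast (show 1 < r by omega)
    have hl := Real.log_pos hr1
    rw [← hval C₁ hC₁ r hr2]
    exact div_le_div_of_nonneg_right (Real.log_le_log (by positivity) (h r hr).1) hl.le
  · filter_upwards [eventually_ge_atTop r₀, eventually_ge_atTop 2] with r hr hr2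
    have hr1 : (1 : ℝ) < r := by exact_mod_cast (show 1 < r by omega)
    have hl := Real.log_pos hr1
    rw [← hval C₂ hC₂ r hr2]
    have hpos : 0 < C₁ * (r : ℝ) ^ 3 := by positivity
    exact div_le_div_of_nonneg_right
      (Real.log_le_log (hpos.trans_le (h r hr).1) (h r hr).2) hl.le

end PlanarTree

/-- For `μ > 0` the local limit `ν = ν^{(μ)}` exists, and it has cubic volume growth. -/
theorem mainTheorem8 (μ : ℝ) (hμ : 0 < μ) :
    ∃ ν : Measure PlanarTree, PlanarTree.IsLocalLimit μ ν ∧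
      (∃ C₁ C₂ : ℝ, 0 < C₁ ∧ 0 < C₂ ∧
        ∀ᵐ T ∂ν, ∃ r₀ : ℕ, ∀ r : ℕ, r₀ ≤ r →
          C₁ * (r : ℝ) ^ 3 ≤ (PlanarTree.ballVolume r T : ℝ) ∧
          (PlanarTree.ballVolume r T : ℝ) ≤ C₂ * ((r : ℝ) ^ 3 * Real.log (r : ℝ))) ∧
      ∀ᵐ T ∂ν, PlanarTree.HasHausdorffDim T 3 := by
  refine ⟨PlanarTree.limitMeasure hμ, PlanarTree.isLocalLimit_limitMeasure hμ,
    ⟨μ / 128, 16 * μ, by positivity, by positivity, ?_⟩, ?_⟩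
  · filter_upwards [PlanarTree.ae_volume_growth hμ] with T ⟨r₀, hT⟩
    -- From r = 3 > e on, log r ≥ 1, so the cubic upper bound implies the one with the logarithm.
    refine ⟨max r₀ 3, fun r hr => ?_⟩
    obtain ⟨h1, h2⟩ := hT r (le_trans (le_max_left _ _) hr)
    refine ⟨h1, h2.trans ?_⟩
    have hr3 : (3 : ℝ) ≤ r := by exact_mod_cast le_trans (le_max_right _ _) hr
    have hlog : 1 ≤ Real.log (r : ℝ) := by
      rw [Real.le_log_iff_exp_le (by linarith)]
      exact (Real.exp_one_lt_d9.le.trans (by norm_num)).trans hr3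
    have h3 : (r : ℝ) ^ 3 ≤ (r : ℝ) ^ 3 * Real.log r :=
      le_mul_of_one_le_right (by positivity) hlog
    exact mul_le_mul_of_nonneg_left h3 (by positivity)
  · filter_upwards [PlanarTree.ae_volume_growth hμ] with T ⟨r₀, hT⟩
    exact PlanarTree.hasHausdorffDim_three (by positivity) (by positivity) hT
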